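/- **Setting.** Let $\omega\subset\mathbb R^2$ be a nonempty bounded connected open set and $Z'=(-\tfrac12,\tfrac12)^2$. Let $h:\mathbb R^2\to(0,\infty)$ be $Z'$-periodic and Lipschitz, $h_{\max}=\max h$, $Z=\{(z',z_3): z'\in Z',\ 0<z_3<h(z')\}$, $\widehat\Gamma_0=Z'\times\{0\}$, $\widehat\Gamma_1=\{(z',h(z')):z'\in Z'\}$. Let $\mu,\mu_{\rm eff},K,k>0$, $\mathbf f'\in L^2(\omega)^2$, $b\in L^1(\omega)$ (for instance a constant), $1<q<3/2$, and $M=\sqrt{\mu/(K\mu_{\rm eff})}$. The subscript $\#$ denotes $Z'$-periodicity in $z'$, the subscript $0$ zero mean. Let $(\widehat{\mathbf u},\widetilde p,\widehat T)$, with $\widehat{\mathbf u}=(\widehat{\mathbf u}',\widehat u_3)$ and $\widehat u_3=0$, be a weak solution of the homogenized system of the regime $0<\ell<1$, that is: $\widehat{\mathbf u},\partial_{z_3}\widehat{\mathbf u}\in L^2(\omega\times Z)^3$, $\widetilde p\in H^1(\omega)\cap L^2_0(\omega)$, $\widehat T,\partial_{z_3}\widehat T\in L^q(\omega\times Z)$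 and, for some $\widehat\pi=\widehat\pi(x',z')\in L^2(\omega;L^2_{0,\#}(Z'))$, with periodicity in $z'$, $$\begin{cases} -\mu_{\rm eff}\,\partial_{z_3}^2\widehat{\mathbf u}'+\frac{\mu}{K}\widehat{\mathbf u}'+\nabla_{z'}\widehat\pi=\mathbf f'(x')-\nabla_{x'}\widetilde p(x') & \text{in }\omega\times Z,\\ {\rm div}_{z'}\Big(\int_0^{h(z')}\widehat{\mathbf u}'\,dz_3\Big)=0 & \text{in }\omega\times Z',\\ -k\,\partial_{z_3}^2\widehat T=\frac{\mu}{K}|\widehat{\mathbf u}'|^2+\mu_{\rm eff}|\partial_{z_3}\widehat{\mathbf u}'|^2 & \text{in }\omega\times Z,\\ \widehat{\mathbf u}=0 & \text{on }\omega\times(\widehat\Gamma_0\cup\widehat\Gamma_1),\\ \widehat T=0\ \text{ on }\omega\times\widehat\Gamma_1,\qquad -k\,\partial_{z_3}\widehat T=b\ \text{ on }\omega\times\widehat\Gamma_0,\\ {\rm div}_{x'}\mathbf V_{\rm av}'=0\ \text{ in }\omega,\qquad \mathbf V_{\rm av}'\cdot n=0\ \text{ on }\partial\omega, \end{cases}$$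 where, with $\widehat{\mathbf u}$ and $\widehat T$ extended by zero outside $Z$ in the variable $z$, $\widetilde{\mathbf u}(x',z_3)=\int_{Z'}\widehat{\mathbf u}(x',z',z_3)\,dz'$, $\widetilde T(x',z_3)=\int_{Z'}\widehat T(x',z',z_3)\,dz'$ and $$\mathbf V_{\rm av}(x')=\int_0^{h_{\max}}\widetilde{\mathbf u}(x',z_3)\,dz_3,\qquad T_{\rm av}(x')=\int_0^{h_{\max}}\widetilde T(x',z_3)\,dz_3 .$$ The equations in $\omega$ with a condition on $\partial\omega$ (here and in (ii)) are understood in the weak sense, $\int_\omega \mathbf F\cdot\nabla\psi=0$ for all $\psi\in H^1(\omega)$. **Statement.** Put $$c(z')=\frac2M\,\frac{e^{Mh(z')}+e^{-Mh(z')}-2}{e^{Mh(z')}-e^{-Mh(z')}}-h(z').$$ For $i=1,2$ the cell problem $-{\rm div}_{z'}\{c(z')(e_i+\nabla_{z'}\pi^i(z'))\}=0$ in $Z'$ has a unique weak solution $\pi^i\in H^1_\#(Z')$ with $\int_{Z'}\pi^i\,dz'=0$. Define $A_M\in\mathbb R^{2\times2}$ by $$(A_M)_{ij}=-\int_{Z'}c(z')\,(e_i+\nabla_{z'}\pi^i(z'))\cdot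 e_j\,dz' .$$ Then the following hold. (i) $\mathbf V_{\rm av}'=\frac K\mu A_M\big(\mathbf f'-\nabla_{x'}\widetilde p\big)$ and $V_{{\rm av},3}=0$ a.e. in $\omega$. (ii) $\widetilde p$ is the unique weak solution in $H^1(\omega)\cap L^2_0(\omega)$ of $$-{\rm div}_{x'}\Big(\frac K\mu A_M(\nabla_{x'}\widetilde p-\mathbf f')\Big)=0\ \text{ in }\omega,\qquad \Big(\frac K\mu A_M(\nabla_{x'}\widetilde p-\mathbf f')\Big)\cdot n=0\ \text{ on }\partial\omega .$$ (iii) $T_{\rm av}(x')=\int_Z\widehat T(x',z)\,dz$ for a.e. $x'\in\omega$ and, for a.e. $(x',z)\in\omega\times Z$, writing $h=h(z')$, $$\begin{aligned}\widehat T(x',z)={}&\frac bk(h-z_3)-\frac{\mu}{kK}\Big(\int_{z_3}^{h}\!\!\int_\xi^{h}|\widehat{\mathbf u}'(x',z',\tau)|^2\,d\tau\,d\xi-(h-z_3)\int_0^{h}|\widehat{\mathbf u}'(x',z',\xi)|^2\,d\xi\Big)\\&-\frac{\mu_{\rm eff}}{k}\Big(\int_{z_3}^{h}\!\!\int_\xi^{h}|\partial_{z_3}\widehat{\mathbf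 u}'(x',z',\tau)|^2\,d\tau\,d\xi-(h-z_3)\int_0^{h}|\partial_{z_3}\widehat{\mathbf u}'(x',z',\xi)|^2\,d\xi\Big),\end{aligned}$$ where $$\widehat{\mathbf u}'(x',z)=\frac K\mu\sum_{i=1}^2\big(f_i(x')-\partial_{x_i}\widetilde p(x')\big)\big(A_1^\star(z')e^{Mz_3}+A_2^\star(z')e^{-Mz_3}+1\big)\big(e_i+\nabla_{z'}\pi^i(z')\big),$$ $$A_1^\star=-\frac{1-e^{-Mh}}{e^{Mh}-e^{-Mh}},\qquad A_2^\star=\frac{1-e^{Mh}}{e^{Mh}-e^{-Mh}} .$$ -/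

import Mathlib

open MeasureTheory Set Filter
open scoped Matrix

noncomputable section

namespace ThinFilm

/-- The horizontal plane `ℝ²`. -/
abbrev E2 := EuclideanSpace ℝ (Fin 2)

/-- The space `ℝ³` in which the velocity takes its values. -/
abbrev E3 := EuclideanSpace ℝ (Fin 3)

/-- Points `(x', z', z₃)`, with macroscopic variable `x'` and microscopic variable
`z = (z', z₃)`. -/
abbrev X := E2 × E2 × ℝ

/-- The coordinate vector `e_i` of `ℝ²`. -/
def e (i : Fin 2) : E2 := EuclideanSpace.single i 1

/-- The horizontal part `v' = (v₁, v₂)` of `v = (v₁, v₂, v₃)`. -/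
def horiz (v : E3) : E2 := !₂[v 0, v 1]

/-- The periodicity cell `Z' = (-1/2, 1/2)²`. -/
def Zp : Set E2 := {z | ∀ i, -(1 / 2 : ℝ) < z i ∧ z i < 1 / 2}

/-- The reference cell `Z = {(z', z₃) : z' ∈ Z', 0 < z₃ < h(z')}`. -/
def Zcell (h : E2 → ℝ) : Set (E2 × ℝ) := {z | z.1 ∈ Zp ∧ 0 < z.2 ∧ z.2 < h z.1}

/-- `Z'`-periodicity, i.e. periodicity with period one in each coordinate. -/
def Periodic {α : Type*} (F : E2 → α) : Prop := ∀ z i, F (z + e i) = F z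

/-- The `j`-th partial derivative of a (smooth) function on `ℝ²`. -/
def pd (j : Fin 2) (φ : E2 → ℝ) (x : E2) : ℝ := fderiv ℝ φ x (e j)

/-! ### Sobolev spaces in the plane -/

/-- `g` is the weak gradient of `p` in the open set `U ⊆ ℝ²`. -/
def IsWeakGrad (U : Set E2) (p : E2 → ℝ) (g : E2 → E2) : Prop :=
  ∀ φ : E2 → ℝ, ContDiff ℝ ((⊤ : ℕ∞) : WithTop ℕ∞) φ → HasCompactSupport φ → tsupport φ ⊆ U →
    ∀ j, ∫ x in U, p x * pd j φ x = -∫ x in U, g x j * φ x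

/-- `p ∈ H¹(U)`, with weak gradient `g`. -/
structure IsH1 (U : Set E2) (p : E2 → ℝ) (g : E2 → E2) : Prop where
  memLp : MemLp p 2 (volume.restrict U)
  memLp_grad : MemLp g 2 (volume.restrict U)
  weakGrad : IsWeakGrad U p g

/-- `ψ ∈ H¹_#(Z')`, with weak gradient `η`: `ψ` is a periodic function on the whole plane, and
`η` is its weak gradient in the whole plane, so that traces on opposite sides of `Z'` agree. -/
structure IsPerH1 (ψ : E2 → ℝ) (η : E2 → E2) : Prop where
  periodic : Periodic ψ
  periodic_grad : Periodic η
  memLp : MemLp ψ 2 (volume.restrict Zp)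
  memLp_grad : MemLp η 2 (volume.restrict Zp)
  weakGrad : IsWeakGrad univ ψ η

/-! ### Test functions on `ω × Z` and vertical derivatives -/

/-- Smooth functions of `(x', z', z₃)`, compactly supported in `x' ∈ ω` and `Z'`-periodic
in `z'`. -/
structure IsTest (ω : Set E2) (φ : X → ℝ) : Prop where
  smooth : ContDiff ℝ ((⊤ : ℕ∞) : WithTop ℕ∞) φ
  support : ∃ C, IsCompact C ∧ C ⊆ ω ∧ ∀ x z, x ∉ C → φ (x, z) = 0
  periodic : ∀ x t, Periodic fun z' => φ (x, z', t)

/-- `φ` vanishes near the upper boundary `z₃ = h(z')`. -/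
def ZeroNearTop (h : E2 → ℝ) (φ : X → ℝ) : Prop :=
  ∃ δ > 0, ∀ x z' t, h z' - δ ≤ t → φ (x, z', t) = 0

/-- `φ` vanishes near the lower boundary `z₃ = 0`. -/
def ZeroNearBottom (φ : X → ℝ) : Prop :=
  ∃ δ > 0, ∀ x z' t, t ≤ δ → φ (x, z', t) = 0

/-- `∂φ/∂z₃`. -/
def d3 (φ : X → ℝ) (y : X) : ℝ := deriv (fun t => φ (y.1, y.2.1, t)) y.2.2

/-- `∂φ/∂z_j`, `j = 1, 2`. -/
def dz (j : Fin 2) (φ : X → ℝ) (y : X) : ℝ := pd j (fun z' => φ (y.1, z', y.2.2)) y.2.1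

/-- The set `ω × Z`. -/
def bulk (ω : Set E2) (h : E2 → ℝ) : Set X := ω ×ˢ Zcell h

/-- The integration by parts formula `∫_{ω×Z} v ∂₃φ = -∫_{ω×Z} g φ`, without boundary terms. -/
def Green3 (ω : Set E2) (h : E2 → ℝ) (v g φ : X → ℝ) : Prop :=
  ∫ y in bulk ω h, v y * d3 φ y = -∫ y in bulk ω h, g y * φ y

/-- `g` is the weak derivative `∂v/∂z₃` in `ω × Z`. -/
def IsWeakD3 (ω : Set E2) (h : E2 → ℝ) (v g : X → ℝ) : Prop :=
  ∀ φ, IsTest ω φ → ZeroNearTop h φ → ZeroNearBottom φ → Green3 ω h v g φ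

/-- `v` (with `∂v/∂z₃ = g`) has zero trace on the upper boundary `ω × Γ̂₁`: there is no boundary
term in Green's formula for test functions that need not vanish there. -/
def ZeroOnTop (ω : Set E2) (h : E2 → ℝ) (v g : X → ℝ) : Prop :=
  ∀ φ, IsTest ω φ → ZeroNearBottom φ → Green3 ω h v g φ

/-- `v` (with `∂v/∂z₃ = g`) has zero trace on the lower boundary `ω × Γ̂₀`. -/
def ZeroOnBottom (ω : Set E2) (h : E2 → ℝ) (v g : X → ℝ) : Prop :=
  ∀ φ, IsTest ω φ → ZeroNearTop h φ → Green3 ω h v g φ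

/-! ### Averages -/

/-- `h_max`. -/
def hMax (h : E2 → ℝ) : ℝ := ⨆ z, h z

/-- The cell average `ṽ(x', z₃) = ∫_{Z'} v̂(x', z', z₃) dz'`, where `v̂(x', ·)` is extended by zero
outside `Z`. -/
def tilde {F : Type*} [NormedAddCommGroup F] [NormedSpace ℝ F]
    (h : E2 → ℝ) (v : X → F) (x : E2) (t : ℝ) : F :=
  ∫ z' in Zp, (Zcell h).indicator (fun z => v (x, z)) (z', t)

/-- The vertical average `∫_0^{h_max} ṽ(x', z₃) dz₃`. -/
def average {F : Type*} [NormedAddCommGroup F] [NormedSpace ℝ F]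
    (h : E2 → ℝ) (v : X → F) (x : E2) : F :=
  ∫ t in (0 : ℝ)..hMax h, tilde h v x t

/-! ### The homogenized system -/

/-- The film thickness profile: a positive `Z'`-periodic function in `W^{1,∞}(ℝ²)`. -/
structure IsProfile (h : E2 → ℝ) : Prop where
  pos : ∀ z, 0 < h z
  periodic : Periodic h
  lipschitz : ∃ L, LipschitzWith L h

/-- `(û, p̃, T̂)` is a weak solution of the homogenized system on `ω × Z`. Here `du`, `dp`, `dT`
are the weak derivatives `∂û/∂z₃`, `∇p̃`, `∂T̂/∂z₃` and `ϖ` is the microscopic pressure.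
An element of `L²_#` is determined by its values on one cell; periodicity across the sides of the
cell is expressed by testing with all periodic functions. -/
structure IsLimitSolution (ω : Set E2) (h : E2 → ℝ) (μ μeff K k q : ℝ) (f : E2 → E2)
    (b : E2 → ℝ) (u du : X → E3) (p : E2 → ℝ) (dp : E2 → E2) (T dT : X → ℝ)
    (ϖ : E2 × E2 → ℝ) : Prop where
  /-- `p̃ ∈ H¹(ω) ∩ L²_0(ω)` -/
  p_H1 : IsH1 ω p dp
  p_mean : ∫ x in ω, p x = 0
  /-- `û ∈ L²(ω × Z)³`, `∂û/∂z₃ ∈ L²(ω × Z)³` -/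
  u_L2 : MemLp u 2 (volume.restrict (bulk ω h))
  du_L2 : MemLp du 2 (volume.restrict (bulk ω h))
  u_deriv : ∀ i, IsWeakD3 ω h (fun y => u y i) (fun y => du y i)
  /-- `û = 0` on `ω × (Γ̂₀ ∪ Γ̂₁)` -/
  u_top : ∀ i, ZeroOnTop ω h (fun y => u y i) (fun y => du y i)
  u_bottom : ∀ i, ZeroOnBottom ω h (fun y => u y i) (fun y => du y i)
  /-- `û₃ = 0` -/
  u_three : ∀ᵐ y ∂volume.restrict (bulk ω h), u y 2 = 0
  /-- the microscopic pressure lies in `L²(ω; L²_{0,#}(Z'))` -/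
  micro_L2 : MemLp ϖ 2 (volume.restrict (ω ×ˢ Zp))
  micro_mean : ∀ᵐ x ∂volume.restrict ω, ∫ z' in Zp, ϖ (x, z') = 0
  /-- `-μ_eff ∂²û'/∂z₃² + (μ/K) û' + ∇_{z'} ϖ = f' - ∇p̃` in `ω × Z` -/
  momentum : ∀ j : Fin 2, ∀ φ, IsTest ω φ → ZeroNearTop h φ → ZeroNearBottom φ →
    μeff * (∫ y in bulk ω h, horiz (du y) j * d3 φ y)
        + μ / K * (∫ y in bulk ω h, horiz (u y) j * φ y)
        - (∫ y in bulk ω h, ϖ (y.1, y.2.1) * dz j φ y)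
      = ∫ y in bulk ω h, (f y.1 j - dp y.1 j) * φ y
  /-- `div_{z'} ∫_0^{h(z')} û' dz₃ = 0` in `ω × Z'`, periodically in `z'`; the test functions are
  those that do not depend on `z₃` -/
  micro_div : ∀ φ, IsTest ω φ → (∀ x z' t, φ (x, z', t) = φ (x, z', 0)) →
    ∫ y in ω ×ˢ Zp, ∑ j : Fin 2,
      (∫ t in (0 : ℝ)..h y.2, horiz (u (y.1, y.2, t)) j) * dz j φ (y.1, y.2, 0) = 0
  /-- `div_{x'} ∫_0^{h_max} ũ' dz₃ = 0` in `ω` and `(∫_0^{h_max} ũ' dz₃) · n = 0` on `∂ω` -/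
  macro_div : ∀ ψ η, IsH1 ω ψ η →
    ∫ x in ω, inner ℝ (horiz (average h u x)) (η x) = 0
  /-- `T̂ ∈ L^q(ω × Z)`, `∂T̂/∂z₃ ∈ L^q(ω × Z)` -/
  T_Lq : MemLp T (ENNReal.ofReal q) (volume.restrict (bulk ω h))
  dT_Lq : MemLp dT (ENNReal.ofReal q) (volume.restrict (bulk ω h))
  T_deriv : IsWeakD3 ω h T dT
  /-- `T̂ = 0` on `ω × Γ̂₁` -/
  T_top : ZeroOnTop ω h T dT
  /-- `-k ∂²T̂/∂z₃² = (μ/K)|û'|² + μ_eff |∂û'/∂z₃|²` in `ω × Z` and `-k ∂T̂/∂z₃ = b` on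
  `ω × Γ̂₀` -/
  heat : ∀ ζ, IsTest ω ζ → ZeroNearTop h ζ →
    k * (∫ y in bulk ω h, dT y * d3 ζ y)
      = μ / K * (∫ y in bulk ω h, ‖horiz (u y)‖ ^ 2 * ζ y)
        + μeff * (∫ y in bulk ω h, ‖horiz (du y)‖ ^ 2 * ζ y)
        + ∫ y in ω ×ˢ Zp, b y.1 * ζ (y.1, y.2, 0)

/-! ### The cell problem, the permeability tensor and the Reynolds equation -/

/-- `(2/M) (e^{Mh} + e^{-Mh} - 2) / (e^{Mh} - e^{-Mh}) - h`. -/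
def cellCoeff (M : ℝ) (h : E2 → ℝ) (z : E2) : ℝ :=
  2 / M * ((Real.exp (M * h z) + Real.exp (-(M * h z)) - 2)
    / (Real.exp (M * h z) - Real.exp (-(M * h z)))) - h z

/-- `ψ ∈ H¹_#(Z')`, with gradient `γ` and zero mean, is a weak solution of
`-div_{z'} (c (e_i + ∇ψ)) = 0`, where `c` is `cellCoeff M h`. -/
structure IsCellSolution (M : ℝ) (h : E2 → ℝ) (i : Fin 2) (ψ : E2 → ℝ) (γ : E2 → E2) :
    Prop where
  perH1 : IsPerH1 ψ γ
  mean : ∫ z in Zp, ψ z = 0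
  weak : ∀ χ η, IsPerH1 χ η → ∫ z in Zp, cellCoeff M h z * inner ℝ (e i + γ z) (η z) = 0

/-- The permeability tensor, in terms of the gradients `γ i` of the cell solutions. -/
def permeability (M : ℝ) (h : E2 → ℝ) (γ : Fin 2 → E2 → E2) : Matrix (Fin 2) (Fin 2) ℝ :=
  Matrix.of fun i j => -∫ z in Zp, cellCoeff M h z * inner ℝ (e i + γ i z) (e j)

/-- Action of a matrix on a vector. -/
def act (A : Matrix (Fin 2) (Fin 2) ℝ) (v : E2) : E2 := WithLp.toLp 2 (A *ᵥ v.ofLp)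

/-- `p ∈ H¹(ω) ∩ L²_0(ω)`, with gradient `g`, is a weak solution of
`-div((K/μ) A (∇p - f)) = 0` in `ω`, `(K/μ) A (∇p - f) · n = 0` on `∂ω`. -/
structure IsReynoldsSolution (ω : Set E2) (κ : ℝ) (A : Matrix (Fin 2) (Fin 2) ℝ) (f : E2 → E2)
    (p : E2 → ℝ) (g : E2 → E2) : Prop where
  h1 : IsH1 ω p g
  mean : ∫ x in ω, p x = 0
  weak : ∀ ψ η, IsH1 ω ψ η → ∫ x in ω, inner ℝ (κ • act A (g x - f x)) (η x) = 0

/-- `A₁* = -(1 - e^{-Mh}) / (e^{Mh} - e^{-Mh})`. -/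
def A1 (M : ℝ) (h : E2 → ℝ) (z : E2) : ℝ :=
  -((1 - Real.exp (-(M * h z))) / (Real.exp (M * h z) - Real.exp (-(M * h z))))

/-- `A₂* = (1 - e^{Mh}) / (e^{Mh} - e^{-Mh})`. -/
def A2 (M : ℝ) (h : E2 → ℝ) (z : E2) : ℝ :=
  (1 - Real.exp (M * h z)) / (Real.exp (M * h z) - Real.exp (-(M * h z)))

/-- `∫_{z₃}^{h} ∫_ξ^{h} F(τ) dτ dξ - (h - z₃) ∫_0^{h} F(ξ) dξ`. -/
def doubleInt (F : ℝ → ℝ) (h z3 : ℝ) : ℝ :=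
  (∫ ξ in z3..h, ∫ τ in ξ..h, F τ) - (h - z3) * ∫ ξ in (0 : ℝ)..h, F ξ

end ThinFilm

end

set_option linter.unusedSectionVars false
set_option linter.unusedVariables false
set_option linter.unusedSimpArgs false

/-! For almost every base point `(x', z')` each horizontal velocity component solves a linear
equation in `z₃` alone. Its right-hand side `g = f' - ∇p̃ - ∇ϖ` does not depend on `z₃`, and the
velocity vanishes at `0` and `h`. The solution is therefore `(K/μ) g` times one explicit profile,
and the vertical integral of that profile is `-c`, where `c` is `cellCoeff M h`. The
incompressibility condition then reads `div (c g) = 0`, while `(f' - ∇p̃) - g` is the gradient of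
`ϖ` over the cell. Since `c < 0`, these two properties determine `g`, and `∑ rᵢ (eᵢ + ∇πⁱ)` with `r
= f' - ∇p̃` has both of them. Integration over the cell gives Darcy's law. The macroscopic
divergence condition turns this into the Reynolds equation, and uniqueness follows because the
tensor is symmetric positive definite and `ω` is connected. The temperature comes from integrating
the heat equation twice in `z₃`, first from the flux at the bottom and then from the zero value at
the top.

All equations are weak, so three devices replace classical arguments.

Vertical direction: a compactly supported test function is the `z₃`-derivative of another test
function once its vertical integral has been removed by a bump. Hence weakly `z₃`-constant functions
depend on the base point only (`exists_ae_eq_base_of_d3`), and functions with zero trace are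
integrals of their derivatives (`ae_eq_tail`, `ae_eq_primitive`). The same device produces `g` as a
square integrable function and eliminates the pressure (`IsMomentumComponent.exists_forcing`). The
second order equation is then solved through two first integrals (`exists_exp_combination`,
`slice_coefficients`).

Cell: a periodic weak gradient is characterized by a relation between Fourier coefficients
(`TrigGrad`). Parseval's identity then yields integration by parts and the Poincaré inequality. The
relation also involves countably many test functions only, so equations on `ω × Z'` can be localized
to almost every `x'` with a single null set (`ae_flux_eq_sum`). The cell problem is solved by
orthogonal projection in `L²` weighted with `-c` (`exists_isCellSolution`), and `g` is identified in
`flux_eq_sum`.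

Macroscopic domain: mollification shows that a function with zero weak gradient is locally constant,
hence constant on a connected set (`exists_ae_const`). -/

namespace ThinFilm

/-! ### Fubini's theorem below a graph -/

section Subgraph

variable {α : Type*} [MeasurableSpace α]

/-- The region between `0` and the graph of `h`. -/
def subgraph (h : α → ℝ) : Set (α × ℝ) := {r | 0 < r.2 ∧ r.2 < h r.1}

theorem measurableSet_subgraph {h : α → ℝ} (hh : Measurable h) : MeasurableSet (subgraph h) :=
  (measurableSet_lt measurable_const measurable_snd).inter
    (measurableSet_lt measurable_snd (hh.comp measurable_fst))

theorem indicator_subgraph {F : Type*} [Zero F] (h : α → ℝ) (g : α × ℝ → F) (a : α) :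
    (fun t => (subgraph h).indicator g (a, t)) =
      (Ioo 0 (h a)).indicator fun t => g (a, t) := by
  ext t
  by_cases ht : 0 < t ∧ t < h a
  · rw [indicator_of_mem (show (a, t) ∈ subgraph h from ht), indicator_of_mem (show t ∈ Ioo 0 (h a) from ht)]
  · rw [indicator_of_notMem (show (a, t) ∉ subgraph h from ht),
      indicator_of_notMem (show t ∉ Ioo 0 (h a) from ht)]

variable {ρ : Measure α} [SFinite ρ] {h : α → ℝ} {F : Type*} [NormedAddCommGroup F]

theorem integrable_slice_subgraph (hh : Measurable h) {g : α × ℝ → F}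
    (hg : IntegrableOn g (subgraph h) (ρ.prod volume)) :
    ∀ᵐ a ∂ρ, IntegrableOn (fun t => g (a, t)) (Ioo 0 (h a)) := by
  rw [← integrable_indicator_iff (measurableSet_subgraph hh)] at hg
  filter_upwards [hg.prod_right_ae] with a ha
  rw [← integrable_indicator_iff measurableSet_Ioo]
  rwa [indicator_subgraph] at ha

theorem interval_eq_Ioo [NormedSpace ℝ F] (hpos : ∀ a, 0 < h a) (g : α × ℝ → F) (a : α) :
    ∫ t in (0 : ℝ)..h a, g (a, t) = ∫ t, (subgraph h).indicator g (a, t) := by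
  rw [indicator_subgraph, integral_indicator measurableSet_Ioo,
    intervalIntegral.integral_of_le (hpos a).le, integral_Ioc_eq_integral_Ioo]

theorem integrable_inner_subgraph [NormedSpace ℝ F] (hh : Measurable h) (hpos : ∀ a, 0 < h a) {g : α × ℝ → F}
    (hg : IntegrableOn g (subgraph h) (ρ.prod volume)) :
    Integrable (fun a => ∫ t in (0 : ℝ)..h a, g (a, t)) ρ := by
  rw [← integrable_indicator_iff (measurableSet_subgraph hh)] at hg
  simp_rw [interval_eq_Ioo hpos]
  exact hg.integral_prod_left

theorem integral_subgraph [NormedSpace ℝ F] (hh : Measurable h) (hpos : ∀ a, 0 < h a) {g : α × ℝ → F}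
    (hg : IntegrableOn g (subgraph h) (ρ.prod volume)) :
    ∫ r in subgraph h, g r ∂(ρ.prod volume) = ∫ a, (∫ t in (0 : ℝ)..h a, g (a, t)) ∂ρ := by
  rw [← integrable_indicator_iff (measurableSet_subgraph hh)] at hg
  simp_rw [interval_eq_Ioo hpos]
  rw [← integral_indicator (measurableSet_subgraph hh), integral_prod _ hg]

theorem ae_slice_subgraph (hh : Measurable h) {P : α × ℝ → Prop}
    (hP : ∀ᵐ r ∂(ρ.prod volume).restrict (subgraph h), P r) :
    ∀ᵐ a ∂ρ, ∀ᵐ t ∂volume.restrict (Ioo 0 (h a)), P (a, t) := by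
  rw [ae_restrict_iff' (measurableSet_subgraph hh)] at hP
  filter_upwards [Measure.ae_ae_of_ae_prod hP] with a ha
  rw [ae_restrict_iff' measurableSet_Ioo]
  filter_upwards [ha] with t ht hmem using ht hmem

theorem ae_base_subgraph {R : α → Prop} (hR : ∀ᵐ a ∂ρ, R a) :
    ∀ᵐ r ∂(ρ.prod volume).restrict (subgraph h), R r.1 :=
  ae_restrict_of_ae (Measure.quasiMeasurePreserving_fst.ae hR)

/-- A function whose slices are bounded by an integrable function of the base point is integrable
below a bounded graph. -/
theorem integrableOn_subgraph_of_bound (hh : Measurable h) {B : ℝ} (hB : ∀ a, h a ≤ B)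
    {g : α × ℝ → F} (hg : AEStronglyMeasurable g ((ρ.prod volume).restrict (subgraph h)))
    {m : α → ℝ} (hm : Integrable m ρ)
    (hb : ∀ᵐ r ∂(ρ.prod volume).restrict (subgraph h), ‖g r‖ ≤ m r.1) :
    IntegrableOn g (subgraph h) (ρ.prod volume) := by
  have h1 : IntegrableOn (fun r : α × ℝ => m r.1) (subgraph h) (ρ.prod volume) := by
    have h2 : Integrable (fun r : α × ℝ => m r.1 * (1 : ℝ)) (ρ.prod (volume.restrict (Ioo 0 B))) :=
      hm.mul_prod (integrable_const 1)
    have h3 : IntegrableOn (fun r : α × ℝ => m r.1) (univ ×ˢ Ioo 0 B) (ρ.prod volume) := by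
      rw [IntegrableOn, ← Measure.prod_restrict, Measure.restrict_univ]
      simpa using h2
    refine h3.mono_set ?_
    intro r hr
    exact ⟨trivial, hr.1, hr.2.trans_le (hB _)⟩
  exact h1.mono' hg hb

end Subgraph

/-! ### The cell -/

theorem measurableSet_Zp : MeasurableSet Zp := by
  have : Zp = ⋂ i, {z : E2 | -(1 / 2 : ℝ) < z i ∧ z i < 1 / 2} := by ext; simp [Zp]
  rw [this]
  refine MeasurableSet.iInter fun i => ?_
  have h1 : Measurable fun z : E2 => z i := by fun_prop
  exact (measurableSet_lt measurable_const h1).inter (measurableSet_lt h1 measurable_const)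

theorem isOpen_Zp : IsOpen Zp := by
  have : Zp = ⋂ i, {z : E2 | -(1 / 2 : ℝ) < z i ∧ z i < 1 / 2} := by ext; simp [Zp]
  rw [this]
  refine isOpen_iInter_of_finite fun i => ?_
  have h1 : Continuous fun z : E2 => z i := by fun_prop
  exact (isOpen_lt continuous_const h1).inter (isOpen_lt h1 continuous_const)

/-- The lattice vector with integer coordinates `k`. -/
noncomputable def lat (k : Fin 2 → ℤ) : E2 := WithLp.toLp 2 fun i => (k i : ℝ)

@[simp] theorem lat_apply (k : Fin 2 → ℤ) (i : Fin 2) : lat k i = k i := rfl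

@[simp] theorem e_apply (i j : Fin 2) : e i j = if j = i then 1 else 0 := by
  simp [e]

theorem Periodic.add_zsmul {α : Type*} {F : E2 → α} (hF : Periodic F) (z : E2) (i : Fin 2)
    (n : ℤ) : F (z + n • e i) = F z := by
  have h : ∀ i, Function.Periodic F (e i) := fun i z => hF z i
  exact (h i).zsmul n z

theorem Periodic.add_lat {α : Type*} {F : E2 → α} (hF : Periodic F) (z : E2) (k : Fin 2 → ℤ) :
    F (z + lat k) = F z := by
  have : z + lat k = z + k 0 • e 0 + k 1 • e 1 := by
    ext i; fin_cases i <;> simp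
  rw [this, hF.add_zsmul, hF.add_zsmul]

/-- The integer coordinates of the translate of the cell that contains `z`. -/
noncomputable def cellIdx (z : E2) : Fin 2 → ℤ := fun i => ⌊z i + 1 / 2⌋

/-- The representative of `z` modulo the lattice in the cell. -/
noncomputable def cellRep (z : E2) : E2 := z + lat (-cellIdx z)

theorem cellRep_apply (z : E2) (i : Fin 2) : cellRep z i = z i - ⌊z i + 1 / 2⌋ := by
  simp [cellRep, cellIdx]; ring

theorem Periodic.cellRep {α : Type*} {F : E2 → α} (hF : Periodic F) (z : E2) :
    F (cellRep z) = F z := hF.add_lat z _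

theorem cellRep_mem (z : E2) (i : Fin 2) :
    -(1 / 2 : ℝ) ≤ ThinFilm.cellRep z i ∧ ThinFilm.cellRep z i < 1 / 2 := by
  rw [cellRep_apply]
  have := Int.floor_le (z i + 1 / 2)
  have := Int.lt_floor_add_one (z i + 1 / 2)
  constructor <;> linarith

theorem cellRep_of_mem {z : E2} (hz : z ∈ Zp) : ThinFilm.cellRep z = z := by
  ext i
  have : ⌊z i + 1 / 2⌋ = 0 := by
    rw [Int.floor_eq_zero_iff]; constructor <;> linarith [(hz i).1, (hz i).2]
  rw [cellRep_apply, this]; simp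

theorem periodic_comp_cellRep {α : Type*} (F : E2 → α) : Periodic fun z => F (ThinFilm.cellRep z) := by
  intro z i
  refine congrArg F ?_
  ext j
  simp only [cellRep_apply, PiLp.add_apply, e_apply]
  split_ifs
  · rw [show z j + 1 + 1 / 2 = z j + 1 / 2 + 1 by ring, Int.floor_add_one]; push_cast; ring
  · simp

theorem volume_Zp : volume Zp = 1 := by
  have := (EuclideanSpace.volume_preserving_symm_measurableEquiv_toLp (Fin 2)).measure_preimage_equiv
    (Set.pi univ fun _ => Ioo (-(1 / 2 : ℝ)) (1 / 2))
  rw [Real.volume_pi_Ioo] at this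
  convert this using 1
  · congr 1; ext z; simp [Zp, Set.mem_pi]
  · norm_num

instance isProbabilityMeasure_Zp : IsProbabilityMeasure (volume.restrict Zp) :=
  ⟨by rw [Measure.restrict_apply_univ, volume_Zp]⟩

theorem norm_le_of_coord {z : E2} (hz : ∀ i, |z i| ≤ 1 / 2) : ‖z‖ ≤ 1 := by
  rw [EuclideanSpace.norm_eq, Real.sqrt_le_one, Fin.sum_univ_two]
  have := hz 0; have := hz 1
  have h0 := abs_nonneg (z 0); have h1 := abs_nonneg (z 1)
  simp only [Real.norm_eq_abs]
  nlinarith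

theorem isBounded_Zp : Bornology.IsBounded Zp := by
  refine (Metric.isBounded_closedBall (x := (0 : E2)) (r := 1)).subset fun z hz => ?_
  rw [mem_closedBall_zero_iff]
  exact norm_le_of_coord fun i => abs_le.2 ⟨(hz i).1.le, (hz i).2.le⟩

theorem cellRep_norm_le (z : E2) : ‖ThinFilm.cellRep z‖ ≤ 1 :=
  norm_le_of_coord fun i => abs_le.2 ⟨(cellRep_mem z i).1, (cellRep_mem z i).2.le⟩

theorem IsProfile.continuous {h : E2 → ℝ} (hh : IsProfile h) : Continuous h := by
  obtain ⟨L, hL⟩ := hh.lipschitz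
  exact hL.continuous

/-- By periodicity every value of `h` is attained in the closed unit ball, which contains all cell
representatives. The extrema over this compact set bound `h` globally, and the minimum is positive.
-/
theorem IsProfile.exists_bounds {h : E2 → ℝ} (hh : IsProfile h) :
    ∃ H B : ℝ, 0 < H ∧ ∀ z, H ≤ h z ∧ h z ≤ B := by
  have hc : IsCompact (Metric.closedBall (0 : E2) 1) := isCompact_closedBall _ _
  have hne : (Metric.closedBall (0 : E2) 1).Nonempty := ⟨0, by simp⟩
  obtain ⟨a, -, ha⟩ := hc.exists_isMinOn hne hh.continuous.continuousOn
  obtain ⟨b, -, hb⟩ := hc.exists_isMaxOn hne hh.continuous.continuousOn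
  refine ⟨h a, h b, hh.pos a, fun z => ?_⟩
  have hz : ThinFilm.cellRep z ∈ Metric.closedBall (0 : E2) 1 := by
    rw [mem_closedBall_zero_iff]; exact cellRep_norm_le z
  rw [← hh.periodic.cellRep z]
  exact ⟨ha hz, hb hz⟩

theorem Zcell_eq (h : E2 → ℝ) : Zcell h = (Zp ×ˢ univ) ∩ subgraph h := by
  ext z; simp [Zcell, subgraph]

theorem isOpen_Zcell {h : E2 → ℝ} (hh : Continuous h) : IsOpen (Zcell h) := by
  rw [Zcell_eq]
  exact (isOpen_Zp.prod isOpen_univ).inter ((isOpen_lt continuous_const continuous_snd).inter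
    (isOpen_lt continuous_snd (hh.comp continuous_fst)))

theorem isOpen_bulk {ω : Set E2} (hω : IsOpen ω) {h : E2 → ℝ} (hh : Continuous h) :
    IsOpen (bulk ω h) := hω.prod (isOpen_Zcell hh)

theorem restrict_Zcell {h : E2 → ℝ} (hh : Measurable h) :
    (volume.restrict (Zcell h) : Measure (E2 × ℝ)) =
      (((volume.restrict Zp).prod volume).restrict (subgraph h)) := by
  have h1 : (volume.restrict Zp).prod (volume : Measure ℝ) =
      (volume : Measure (E2 × ℝ)).restrict (Zp ×ˢ univ) := by
    rw [Measure.volume_eq_prod, ← Measure.prod_restrict, Measure.restrict_univ]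
  rw [h1, Measure.restrict_restrict (measurableSet_subgraph hh), Zcell_eq, inter_comm]

/-- Reassociating the variables presents `ω × Z` as the region below the graph of `h` over the base
`ω × Z'`. All slicing and Fubini statements on `ω × Z` are transported along this map. -/
theorem restrict_bulk_map {ω : Set E2} {h : E2 → ℝ} (hh : Measurable h) :
    MeasurePreserving (MeasurableEquiv.prodAssoc.symm : X ≃ᵐ (E2 × E2) × ℝ)
      (volume.restrict (bulk ω h))
      (((volume.restrict (ω ×ˢ Zp)).prod volume).restrict (subgraph fun p => h p.2)) := by
  have h1 : (volume.restrict (ω ×ˢ Zp)).prod (volume : Measure ℝ) =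
      (volume : Measure ((E2 × E2) × ℝ)).restrict ((ω ×ˢ Zp) ×ˢ univ) := by
    rw [Measure.volume_eq_prod (E2 × E2) ℝ, ← Measure.prod_restrict, Measure.restrict_univ]
  have hs := measurableSet_subgraph (h := fun p : E2 × E2 => h p.2) (hh.comp measurable_snd)
  rw [h1, Measure.restrict_restrict hs]
  have h2 : MeasurePreserving (MeasurableEquiv.prodAssoc.symm : X ≃ᵐ (E2 × E2) × ℝ) volume volume :=
    (volume_preserving_prodAssoc (α₁ := E2) (β₁ := E2) (γ₁ := ℝ)).symm _
  have h3 := h2.restrict_preimage_emb (MeasurableEquiv.measurableEmbedding _)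
    (subgraph (fun p : E2 × E2 => h p.2) ∩ (ω ×ˢ Zp) ×ˢ univ)
  have h4 : (MeasurableEquiv.prodAssoc.symm : X ≃ᵐ (E2 × E2) × ℝ) ⁻¹'
      (subgraph (fun p : E2 × E2 => h p.2) ∩ (ω ×ˢ Zp) ×ˢ univ) = bulk ω h := by
    ext y
    change ((0 < y.2.2 ∧ y.2.2 < h y.2.1) ∧ (y.1 ∈ ω ∧ y.2.1 ∈ Zp) ∧ True) ↔
      (y.1 ∈ ω ∧ (y.2.1 ∈ Zp ∧ 0 < y.2.2 ∧ y.2.2 < h y.2.1))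
    tauto
  rwa [h4] at h3

/-! ### Slicing `ω × Z` into vertical segments over `ω × Z'` -/

section Bulk

variable {ω : Set E2} {h : E2 → ℝ} {F : Type*} [NormedAddCommGroup F]

theorem integrableOn_bulk_iff (hh : Measurable h) (g : X → F) :
    IntegrableOn g (bulk ω h) ↔
      IntegrableOn (fun r : (E2 × E2) × ℝ => g (r.1.1, r.1.2, r.2)) (subgraph fun p => h p.2)
        ((volume.restrict (ω ×ˢ Zp)).prod volume) :=
  ((restrict_bulk_map hh).integrable_comp_emb (MeasurableEquiv.measurableEmbedding _)
    (g := fun r : (E2 × E2) × ℝ => g (r.1.1, r.1.2, r.2)))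

theorem integral_bulk [NormedSpace ℝ F] (hh : Measurable h) (hpos : ∀ z, 0 < h z) {g : X → F}
    (hg : IntegrableOn g (bulk ω h)) :
    ∫ y in bulk ω h, g y = ∫ p in ω ×ˢ Zp, ∫ t in (0 : ℝ)..h p.2, g (p.1, p.2, t) := by
  have h1 := (restrict_bulk_map (ω := ω) hh).integral_comp (MeasurableEquiv.measurableEmbedding _)
    (fun r : (E2 × E2) × ℝ => g (r.1.1, r.1.2, r.2))
  rw [← integral_subgraph (h := fun p : E2 × E2 => h p.2) (hh.comp measurable_snd)
    (fun p => hpos _) ((integrableOn_bulk_iff hh g).1 hg), ← h1]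
  rfl

theorem integrable_inner_bulk [NormedSpace ℝ F] (hh : Measurable h) (hpos : ∀ z, 0 < h z)
    {g : X → F} (hg : IntegrableOn g (bulk ω h)) :
    IntegrableOn (fun p => ∫ t in (0 : ℝ)..h p.2, g (p.1, p.2, t)) (ω ×ˢ Zp) :=
  integrable_inner_subgraph (h := fun p : E2 × E2 => h p.2) (hh.comp measurable_snd)
    (fun p => hpos _) ((integrableOn_bulk_iff hh g).1 hg)

theorem integrable_slice_bulk (hh : Measurable h) {g : X → F} (hg : IntegrableOn g (bulk ω h)) :
    ∀ᵐ p ∂volume.restrict (ω ×ˢ Zp), IntegrableOn (fun t => g (p.1, p.2, t)) (Ioo 0 (h p.2)) :=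
  integrable_slice_subgraph (h := fun p : E2 × E2 => h p.2) (hh.comp measurable_snd)
    ((integrableOn_bulk_iff hh g).1 hg)

theorem ae_slice_bulk (hh : Measurable h) {P : X → Prop}
    (hP : ∀ᵐ y ∂volume.restrict (bulk ω h), P y) :
    ∀ᵐ p ∂volume.restrict (ω ×ˢ Zp), ∀ᵐ t ∂volume.restrict (Ioo 0 (h p.2)), P (p.1, p.2, t) := by
  have h1 := ((restrict_bulk_map (ω := ω) hh).symm).quasiMeasurePreserving.ae hP
  exact ae_slice_subgraph (h := fun p : E2 × E2 => h p.2) (hh.comp measurable_snd) h1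

theorem ae_base_bulk (hh : Measurable h) {R : E2 × E2 → Prop}
    (hR : ∀ᵐ p ∂volume.restrict (ω ×ˢ Zp), R p) :
    ∀ᵐ y ∂volume.restrict (bulk ω h), R (y.1, y.2.1) :=
  (restrict_bulk_map (ω := ω) hh).quasiMeasurePreserving.ae (ae_base_subgraph hR)

theorem integrableOn_bulk_of_bound (hh : Measurable h) {B : ℝ} (hB : ∀ z, h z ≤ B) {g : X → F}
    (hg : AEStronglyMeasurable g (volume.restrict (bulk ω h))) {m : E2 × E2 → ℝ}
    (hm : IntegrableOn m (ω ×ˢ Zp))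
    (hb : ∀ᵐ y ∂volume.restrict (bulk ω h), ‖g y‖ ≤ m (y.1, y.2.1)) :
    IntegrableOn g (bulk ω h) := by
  rw [integrableOn_bulk_iff hh]
  refine integrableOn_subgraph_of_bound (h := fun p : E2 × E2 => h p.2) (hh.comp measurable_snd)
    (fun p => hB p.2) ?_ hm ?_
  · exact hg.comp_measurePreserving ((restrict_bulk_map hh).symm)
  · exact ((restrict_bulk_map (ω := ω) hh).symm).quasiMeasurePreserving.ae hb

theorem aestronglyMeasurable_base (hh : Measurable h) {m : E2 × E2 → F}
    (hm : AEStronglyMeasurable m (volume.restrict (ω ×ˢ Zp))) :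
    AEStronglyMeasurable (fun y : X => m (y.1, y.2.1)) (volume.restrict (bulk ω h)) := by
  have h1 : AEStronglyMeasurable (fun r : (E2 × E2) × ℝ => m r.1)
      (((volume.restrict (ω ×ˢ Zp)).prod volume).restrict (subgraph fun p => h p.2)) :=
    (hm.comp_fst).restrict
  exact h1.comp_measurePreserving (restrict_bulk_map hh)

theorem integrableOn_base (hh : Measurable h) {B : ℝ} (hB : ∀ z, h z ≤ B) {m : E2 × E2 → F}
    (hm : IntegrableOn m (ω ×ˢ Zp)) : IntegrableOn (fun y : X => m (y.1, y.2.1)) (bulk ω h) :=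
  integrableOn_bulk_of_bound hh hB (aestronglyMeasurable_base hh hm.1) hm.norm
    (Eventually.of_forall fun _ => le_rfl)

theorem restrict_bulk_prod : (volume.restrict (bulk ω h) : Measure X) =
    (volume.restrict ω).prod (volume.restrict (Zcell h)) := by
  rw [bulk, Measure.volume_eq_prod E2 (E2 × ℝ), Measure.prod_restrict]

end Bulk

/-! ### Test functions -/

section Test

variable {ω : Set E2} {h : E2 → ℝ} {φ ψ : X → ℝ}

theorem hasDerivAt_d3 (hφ : ContDiff ℝ ((⊤ : ℕ∞) : WithTop ℕ∞) φ) (x z : E2) (t : ℝ) :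
    HasDerivAt (fun s => φ (x, z, s)) (fderiv ℝ φ (x, z, t) (0, 0, 1)) t := by
  have h1 : HasFDerivAt φ (fderiv ℝ φ (x, z, t)) (x, z, t) :=
    (hφ.differentiable (by simp)).differentiableAt.hasFDerivAt
  have h2 : HasDerivAt (fun s : ℝ => ((x, z, s) : X)) (0, 0, 1) t :=
    (hasDerivAt_const t x).prodMk ((hasDerivAt_const t z).prodMk (hasDerivAt_id t))
  exact h1.comp_hasDerivAt t h2

theorem d3_eq (hφ : ContDiff ℝ ((⊤ : ℕ∞) : WithTop ℕ∞) φ) :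
    d3 φ = fun y => fderiv ℝ φ y (0, 0, 1) := by
  ext y
  exact (hasDerivAt_d3 hφ y.1 y.2.1 y.2.2).deriv

theorem hasDerivAt_d3' (hφ : ContDiff ℝ ((⊤ : ℕ∞) : WithTop ℕ∞) φ) (x z : E2) (t : ℝ) :
    HasDerivAt (fun s => φ (x, z, s)) (d3 φ (x, z, t)) t := by
  rw [d3_eq hφ]; exact hasDerivAt_d3 hφ x z t

theorem hasFDerivAt_dz (hφ : ContDiff ℝ ((⊤ : ℕ∞) : WithTop ℕ∞) φ) (x z : E2) (t : ℝ) :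
    HasFDerivAt (fun w => φ (x, w, t)) ((fderiv ℝ φ (x, z, t)).comp
      ((0 : E2 →L[ℝ] E2).prod ((ContinuousLinearMap.id ℝ E2).prod (0 : E2 →L[ℝ] ℝ)))) z := by
  have h1 : HasFDerivAt φ (fderiv ℝ φ (x, z, t)) (x, z, t) :=
    (hφ.differentiable (by simp)).differentiableAt.hasFDerivAt
  have h2 : HasFDerivAt (fun w : E2 => ((x, w, t) : X))
      ((0 : E2 →L[ℝ] E2).prod ((ContinuousLinearMap.id ℝ E2).prod (0 : E2 →L[ℝ] ℝ))) z :=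
    (hasFDerivAt_const x z).prodMk ((hasFDerivAt_id z).prodMk (hasFDerivAt_const t z))
  exact h1.comp z h2

theorem dz_eq (hφ : ContDiff ℝ ((⊤ : ℕ∞) : WithTop ℕ∞) φ) (j : Fin 2) :
    dz j φ = fun y => fderiv ℝ φ y (0, e j, 0) := by
  ext y
  rw [dz, pd, (hasFDerivAt_dz hφ y.1 y.2.1 y.2.2).fderiv]
  rfl

theorem contDiff_fderiv_apply {E : Type*} [NormedAddCommGroup E] [NormedSpace ℝ E] {φ : E → ℝ}
    (hφ : ContDiff ℝ ((⊤ : ℕ∞) : WithTop ℕ∞) φ) (v : E) :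
    ContDiff ℝ ((⊤ : ℕ∞) : WithTop ℕ∞) fun y => fderiv ℝ φ y v :=
  (hφ.fderiv_right (by simp)).clm_apply contDiff_const

theorem IsTest.fderiv_eq_zero (hφ : IsTest ω φ) :
    ∃ C, IsCompact C ∧ C ⊆ ω ∧ ∀ y : X, y.1 ∉ C → fderiv ℝ φ y = 0 := by
  obtain ⟨C, hC, hCω, h0⟩ := hφ.support
  refine ⟨C, hC, hCω, fun y hy => ?_⟩
  have : φ =ᶠ[nhds y] fun _ => (0 : ℝ) := by
    have ho : IsOpen {y : X | y.1 ∉ C} := hC.isClosed.isOpen_compl.preimage continuous_fst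
    filter_upwards [ho.mem_nhds hy] with w hw
    exact h0 w.1 w.2 hw
  rw [this.fderiv_eq]; simp

/-- Periodicity says that `φ` is invariant under the translation by `(0, e i, 0)`, and the
derivative commutes with translations. Together with the vanishing of the derivative off the
support, this makes test functions stable under `d3` and `dz`. -/
theorem IsTest.fderiv_periodic (hφ : IsTest ω φ) (x z : E2) (t : ℝ) (i : Fin 2) :
    fderiv ℝ φ (x, z + e i, t) = fderiv ℝ φ (x, z, t) := by
  have h1 : (fun y : X => φ (y + (0, e i, 0))) = φ := by
    ext y
    have := hφ.periodic y.1 y.2.2 y.2.1 i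
    simp only at this
    rw [← this]
    congr 1
    ext <;> simp
  have h2 := fderiv_comp_add_right (𝕜 := ℝ) (f := φ) (x := (x, z, t)) ((0, e i, 0) : X)
  rw [h1] at h2
  rw [h2]
  congr 1
  simp

theorem IsTest.d3 (hφ : IsTest ω φ) : IsTest ω (ThinFilm.d3 φ) := by
  rw [d3_eq hφ.smooth]
  refine ⟨contDiff_fderiv_apply hφ.smooth _, ?_, fun x t z i => ?_⟩
  · obtain ⟨C, hC, hCω, h0⟩ := hφ.fderiv_eq_zero
    exact ⟨C, hC, hCω, fun x z hx => by rw [h0 (x, z) hx]; rfl⟩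
  · simp only [hφ.fderiv_periodic]

theorem IsTest.dz (hφ : IsTest ω φ) (j : Fin 2) : IsTest ω (ThinFilm.dz j φ) := by
  rw [dz_eq hφ.smooth]
  refine ⟨contDiff_fderiv_apply hφ.smooth _, ?_, fun x t z i => ?_⟩
  · obtain ⟨C, hC, hCω, h0⟩ := hφ.fderiv_eq_zero
    exact ⟨C, hC, hCω, fun x z hx => by rw [h0 (x, z) hx]; rfl⟩
  · simp only [hφ.fderiv_periodic]

theorem IsTest.sub (hφ : IsTest ω φ) (hψ : IsTest ω ψ) : IsTest ω fun y => φ y - ψ y := by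
  refine ⟨hφ.smooth.sub hψ.smooth, ?_, fun x t z i => ?_⟩
  · obtain ⟨C, hC, hCω, h0⟩ := hφ.support
    obtain ⟨D, hD, hDω, h1⟩ := hψ.support
    refine ⟨C ∪ D, hC.union hD, union_subset hCω hDω, fun x z hx => ?_⟩
    rw [h0 x z fun h => hx (Or.inl h), h1 x z fun h => hx (Or.inr h), sub_zero]
  · simp only [hφ.periodic x t z i, hψ.periodic x t z i]

theorem IsTest.mul_vertical (hφ : IsTest ω φ) {χ : ℝ → ℝ}
    (hχ : ContDiff ℝ ((⊤ : ℕ∞) : WithTop ℕ∞) χ) : IsTest ω fun y => φ y * χ y.2.2 := by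
  refine ⟨hφ.smooth.mul (hχ.comp (contDiff_snd.comp contDiff_snd)), ?_, fun x t z i => ?_⟩
  · obtain ⟨C, hC, hCω, h0⟩ := hφ.support
    exact ⟨C, hC, hCω, fun x z hx => by rw [h0 x z hx, zero_mul]⟩
  · simp only [hφ.periodic x t z i]

theorem IsTest.freeze (hφ : IsTest ω φ) (s : ℝ) : IsTest ω fun y => φ (y.1, y.2.1, s) := by
  refine ⟨hφ.smooth.comp (contDiff_fst.prodMk ((contDiff_fst.comp contDiff_snd).prodMk
    contDiff_const)), ?_, fun x t z i => ?_⟩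
  · obtain ⟨C, hC, hCω, h0⟩ := hφ.support
    exact ⟨C, hC, hCω, fun x z hx => h0 x _ hx⟩
  · exact hφ.periodic x s z i

theorem isTest_tensor {a : E2 → ℝ} (ha : ContDiff ℝ ((⊤ : ℕ∞) : WithTop ℕ∞) a)
    (hc : HasCompactSupport a) (hs : tsupport a ⊆ ω) {τ : E2 → ℝ}
    (hτ : ContDiff ℝ ((⊤ : ℕ∞) : WithTop ℕ∞) τ) (hp : Periodic τ) :
    IsTest ω fun y => a y.1 * τ y.2.1 := by
  refine ⟨(ha.comp contDiff_fst).mul (hτ.comp (contDiff_fst.comp contDiff_snd)), ?_,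
    fun x t z i => ?_⟩
  · exact ⟨tsupport a, hc, hs, fun x z hx => by rw [image_eq_zero_of_notMem_tsupport hx, zero_mul]⟩
  · simp only [hp z i]

/-- A test function has no compact support in `z'` or `z₃`. Periodicity reduces `z'` to a compact
ball, so a bound holds on each slab `|t| ≤ R`, which is enough because `h` is bounded. -/
theorem IsTest.bounded (hφ : IsTest ω φ) (R : ℝ) :
    ∃ C, 0 ≤ C ∧ ∀ x z t, |t| ≤ R → |φ (x, z, t)| ≤ C := by
  obtain ⟨K, hK, -, h0⟩ := hφ.support
  have hc : IsCompact (K ×ˢ (Metric.closedBall (0 : E2) 1 ×ˢ Icc (-R) R)) :=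
    hK.prod ((isCompact_closedBall _ _).prod isCompact_Icc)
  obtain ⟨C, hC⟩ := hc.exists_bound_of_continuousOn hφ.smooth.continuous.continuousOn
  refine ⟨max C 0, le_max_right _ _, fun x z t ht => ?_⟩
  by_cases hx : x ∈ K
  · have h1 : φ (x, z, t) = φ (x, cellRep z, t) := ((hφ.periodic x t).cellRep z).symm
    rw [h1]
    refine le_trans ?_ (le_max_left _ _)
    refine hC _ ⟨hx, ?_, abs_le.1 ht⟩
    simpa using cellRep_norm_le z
  · rw [h0 x _ hx]; simp

theorem IsTest.bounded_bulk (hφ : IsTest ω φ) (hh : IsProfile h) :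
    ∃ C, 0 ≤ C ∧ ∀ y ∈ bulk ω h, ‖φ y‖ ≤ C := by
  obtain ⟨H, B, -, hb⟩ := hh.exists_bounds
  obtain ⟨C, hC0, hC⟩ := hφ.bounded B
  refine ⟨C, hC0, fun y hy => hC _ _ _ (abs_le.2 ⟨?_, ?_⟩)⟩
  · have := hy.2.2.1; have := hy.2.2.2; have := (hb y.2.1).2; linarith
  · have := hy.2.2.2; have := (hb y.2.1).2; linarith

theorem measurableSet_bulk (hω : IsOpen ω) (hh : IsProfile h) : MeasurableSet (bulk ω h) :=
  (isOpen_bulk hω hh.continuous).measurableSet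

theorem IsTest.integrable_mul (hφ : IsTest ω φ) (hω : IsOpen ω) (hh : IsProfile h) {v : X → ℝ}
    (hv : IntegrableOn v (bulk ω h)) : IntegrableOn (fun y => v y * φ y) (bulk ω h) := by
  obtain ⟨C, -, hC⟩ := hφ.bounded_bulk hh
  exact Integrable.mul_bdd (c := C) hv hφ.smooth.continuous.aestronglyMeasurable
    (ae_restrict_of_forall_mem (measurableSet_bulk hω hh) hC)

theorem ZeroNearTop.sub (hφ : ZeroNearTop h φ) (hψ : ZeroNearTop h ψ) :
    ZeroNearTop h fun y => φ y - ψ y := by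
  obtain ⟨δ, hδ, h0⟩ := hφ
  obtain ⟨ε, hε, h1⟩ := hψ
  refine ⟨min δ ε, lt_min hδ hε, fun x z t ht => ?_⟩
  simp only [h0 x z t (by linarith [min_le_left δ ε]), h1 x z t (by linarith [min_le_right δ ε]),
    sub_zero]

theorem ZeroNearBottom.sub (hφ : ZeroNearBottom φ) (hψ : ZeroNearBottom ψ) :
    ZeroNearBottom fun y => φ y - ψ y := by
  obtain ⟨δ, hδ, h0⟩ := hφ
  obtain ⟨ε, hε, h1⟩ := hψ
  refine ⟨min δ ε, lt_min hδ hε, fun x z t ht => ?_⟩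
  simp only [h0 x z t (by linarith [min_le_left δ ε]), h1 x z t (by linarith [min_le_right δ ε]),
    sub_zero]

theorem ZeroNearTop.mul_vertical (hφ : ZeroNearTop h φ) (χ : ℝ → ℝ) :
    ZeroNearTop h fun y => φ y * χ y.2.2 := by
  obtain ⟨δ, hδ, h0⟩ := hφ
  exact ⟨δ, hδ, fun x z t ht => by simp only [h0 x z t ht, zero_mul]⟩

theorem ZeroNearBottom.mul_vertical (hφ : ZeroNearBottom φ) (χ : ℝ → ℝ) :
    ZeroNearBottom fun y => φ y * χ y.2.2 := by
  obtain ⟨δ, hδ, h0⟩ := hφ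
  exact ⟨δ, hδ, fun x z t ht => by simp only [h0 x z t ht, zero_mul]⟩

end Test

/-! ### Periodization -/

/-- The sum of the lattice translates of a function on the plane. -/
noncomputable def periodize (g : E2 → ℝ) (z : E2) : ℝ := ∑ᶠ k, g (z + lat k)

/-- The lattice points with coordinates of modulus at most `r`. -/
noncomputable def box (r : ℝ) : Finset (Fin 2 → ℤ) :=
  Fintype.piFinset fun _ => Finset.Icc (-⌈r⌉) ⌈r⌉

theorem mem_box_of_norm_le {k : Fin 2 → ℤ} {r : ℝ} (hk : ‖lat k‖ ≤ r) : k ∈ box r := by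
  rw [box, Fintype.mem_piFinset]
  intro i
  have h1 : |(k i : ℝ)| ≤ r := by
    have := PiLp.norm_apply_le (lat k) i
    simp only [lat_apply, Real.norm_eq_abs] at this
    exact this.trans hk
  have h2 : ((|k i| : ℤ) : ℝ) ≤ (⌈r⌉ : ℤ) := by
    push_cast; exact h1.trans (Int.le_ceil r)
  rw [Finset.mem_Icc]
  exact abs_le.1 (by exact_mod_cast h2)

/-- The index set is the same for all `z` in a ball. The periodization is thus locally a fixed
finite sum, so that smoothness and derivatives can be computed termwise. -/
theorem periodize_eq_sum {g : E2 → ℝ} {R N : ℝ} (hg : ∀ z, R < ‖z‖ → g z = 0) {z : E2}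
    (hz : ‖z‖ ≤ N) : periodize g z = ∑ k ∈ box (R + N), g (z + lat k) := by
  refine finsum_eq_sum_of_support_subset _ fun k hk => ?_
  refine mem_box_of_norm_le ?_
  by_contra! hlt
  refine hk (hg _ ?_)
  have h1 : ‖lat k‖ ≤ ‖z + lat k‖ + ‖z‖ := by
    have := norm_sub_le (z + lat k) z
    simpa using this
  linarith

theorem periodic_periodize (g : E2 → ℝ) : Periodic (periodize g) := by
  intro z i
  have h1 : ∀ k : Fin 2 → ℤ, g (z + e i + lat k) = g (z + lat (k + Pi.single i 1)) := by
    intro k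
    congr 1
    ext j
    simp only [PiLp.add_apply, e_apply, lat_apply, Pi.add_apply, Pi.single_apply]
    split_ifs <;> push_cast <;> ring
  simp only [periodize, h1]
  exact finsum_comp_equiv (Equiv.addRight (Pi.single i 1 : Fin 2 → ℤ)) (f := fun k => g (z + lat k))

/-- The parameter space `W` carries the variables `x'` and `z₃`, in which a function of `(x', z',
z₃)` must remain jointly smooth when it is periodized in `z'` only. -/
theorem contDiff_periodize {W : Type*} [NormedAddCommGroup W] [NormedSpace ℝ W]
    {g : W → E2 → ℝ} (hg : ContDiff ℝ ((⊤ : ℕ∞) : WithTop ℕ∞) (fun p : W × E2 => g p.1 p.2)) {R : ℝ}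
    (hR : ∀ w z, R < ‖z‖ → g w z = 0) :
    ContDiff ℝ ((⊤ : ℕ∞) : WithTop ℕ∞) (fun p : W × E2 => periodize (g p.1) p.2) := by
  rw [contDiff_iff_contDiffAt]
  intro p
  have h1 : (fun p : W × E2 => periodize (g p.1) p.2) =ᶠ[nhds p]
      fun q => ∑ k ∈ box (R + (‖p.2‖ + 1)), g q.1 (q.2 + lat k) := by
    have ho : IsOpen {q : W × E2 | ‖q.2‖ < ‖p.2‖ + 1} :=
      isOpen_lt (continuous_norm.comp continuous_snd) continuous_const
    filter_upwards [ho.mem_nhds (by simp : p ∈ {q : W × E2 | ‖q.2‖ < ‖p.2‖ + 1})] with q hq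
    exact periodize_eq_sum (N := ‖p.2‖ + 1) (hR q.1) (le_of_lt hq)
  have h2 : ContDiff ℝ ((⊤ : ℕ∞) : WithTop ℕ∞)
      fun q : W × E2 => ∑ k ∈ box (R + (‖p.2‖ + 1)), g q.1 (q.2 + lat k) := by
    refine ContDiff.sum fun k _ => ?_
    have h3 : ContDiff ℝ ((⊤ : ℕ∞) : WithTop ℕ∞) fun q : W × E2 => ((q.1, q.2 + lat k) : W × E2) :=
      contDiff_fst.prodMk (contDiff_snd.add contDiff_const)
    exact hg.comp h3
  exact ContDiffAt.congr_of_eventuallyEq h2.contDiffAt h1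

theorem lat_zero : lat 0 = 0 := by ext i; simp

theorem periodize_eq_self {g : E2 → ℝ} (hg : ∀ z ∉ Zp, g z = 0) {z : E2} (hz : z ∈ Zp) :
    periodize g z = g z := by
  rw [periodize, finsum_eq_single _ (0 : Fin 2 → ℤ), lat_zero, add_zero]
  intro k hk
  refine hg _ fun hmem => hk ?_
  funext i
  have h1 := hmem i
  have h2 := hz i
  simp only [PiLp.add_apply, lat_apply] at h1
  have h3 : (k i : ℝ) < 1 := by linarith [h1.2, h2.1]
  have h4 : (-1 : ℝ) < k i := by linarith [h1.1, h2.2]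
  have h5 : k i < 1 := by exact_mod_cast h3
  have h6 : -1 < k i := by exact_mod_cast h4
  simp only [Pi.zero_apply]; omega

/-- Functions of `ω × Z` that are orthogonal to all test functions vanish. -/
theorem ae_eq_zero_of_forall_test {ω : Set E2} {h : E2 → ℝ} (hω : IsOpen ω) (hh : IsProfile h)
    {v : X → ℝ} (hv : IntegrableOn v (bulk ω h))
    (H : ∀ φ, IsTest ω φ → ZeroNearTop h φ → ZeroNearBottom φ → ∫ y in bulk ω h, v y * φ y = 0) :
    ∀ᵐ y ∂volume.restrict (bulk ω h), v y = 0 := by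
  rw [ae_restrict_iff' (measurableSet_bulk hω hh)]
  refine (isOpen_bulk hω hh.continuous).ae_eq_zero_of_integral_contDiff_smul_eq_zero
    hv.locallyIntegrableOn fun g hg hgc hgs => ?_
  -- A smooth function supported in `ω × Z` is not periodic, hence not a test function. Its
  -- periodization in `z'` is one, and agrees with it on `ω × Z`.
  set P : X → ℝ := fun y => periodize (fun z => g (y.1, z, y.2.2)) y.2.1 with hP
  have hgz : ∀ x z t, z ∉ Zp → g (x, z, t) = 0 := fun x z t hz =>
    image_eq_zero_of_notMem_tsupport fun hm => hz (hgs hm).2.1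
  have hPg : ∀ y ∈ bulk ω h, P y = g y := fun y hy =>
    periodize_eq_self (fun z hz => hgz _ _ _ hz) hy.2.1
  have hPne : ∀ x z t, P (x, z, t) ≠ 0 → ∃ k, g (x, z + lat k, t) ≠ 0 := by
    intro x z t hne
    by_contra! hall
    exact hne (by simp only [hP, periodize, hall, finsum_zero])
  have hPt : IsTest ω P := by
    refine ⟨?_, ⟨Prod.fst '' tsupport g, hgc.isCompact.image continuous_fst, ?_, ?_⟩, ?_⟩
    · have h1 : ContDiff ℝ ((⊤ : ℕ∞) : WithTop ℕ∞)
          (fun p : (E2 × ℝ) × E2 => periodize (fun z => g (p.1.1, z, p.1.2)) p.2) := by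
        refine contDiff_periodize (W := E2 × ℝ) (g := fun w z => g (w.1, z, w.2)) (R := 1) ?_ ?_
        · exact hg.comp ((contDiff_fst.comp contDiff_fst).prodMk
            (contDiff_snd.prodMk (contDiff_snd.comp contDiff_fst)))
        · intro w z hz
          refine hgz _ _ _ fun hmem => ?_
          exact absurd (norm_le_of_coord fun i => abs_le.2 ⟨(hmem i).1.le, (hmem i).2.le⟩)
            (not_le.2 hz)
      exact h1.comp ((contDiff_fst.prodMk (contDiff_snd.comp contDiff_snd)).prodMk
        (contDiff_fst.comp contDiff_snd))
    · rintro _ ⟨y, hy, rfl⟩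
      exact (hgs hy).1
    · intro x z hx
      by_contra hne
      obtain ⟨k, hk⟩ := hPne x z.1 z.2 hne
      exact hx ⟨_, subset_tsupport _ hk, rfl⟩
    · intro x t
      exact periodic_periodize fun z => g (x, z, t)
  -- Compactness keeps the support at a positive distance from top and bottom. Half the minimum of
  -- `min z₃ (h - z₃)` gives strict inequalities, and the periodicity of `h` carries them over to
  -- the translates.
  obtain ⟨δ, hδ, hδ1⟩ : ∃ δ > 0, ∀ y ∈ tsupport g, δ < y.2.2 ∧ y.2.2 < h y.2.1 - δ := by
    rcases (tsupport g).eq_empty_or_nonempty with he | hne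
    · exact ⟨1, one_pos, fun y hy => by simp [he] at hy⟩
    have hc : Continuous fun y : X => min y.2.2 (h y.2.1 - y.2.2) := by
      have := hh.continuous
      fun_prop
    obtain ⟨y0, hy0, hmin⟩ := hgc.isCompact.exists_isMinOn hne hc.continuousOn
    have hpos : 0 < min y0.2.2 (h y0.2.1 - y0.2.2) :=
      lt_min (hgs hy0).2.2.1 (by linarith [(hgs hy0).2.2.2])
    refine ⟨min y0.2.2 (h y0.2.1 - y0.2.2) / 2, by positivity, fun y hy => ?_⟩
    have h1 : min y0.2.2 (h y0.2.1 - y0.2.2) ≤ min y.2.2 (h y.2.1 - y.2.2) := hmin hy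
    have h2 := h1.trans (min_le_left _ _)
    have h3 := h1.trans (min_le_right _ _)
    constructor <;> linarith
  have hPtop : ZeroNearTop h P := by
    refine ⟨δ, hδ, fun x z t ht => ?_⟩
    by_contra hne
    obtain ⟨k, hk⟩ := hPne x z t hne
    have h1 := (hδ1 _ (subset_tsupport _ hk)).2
    simp only [hh.periodic.add_lat] at h1
    linarith
  have hPbot : ZeroNearBottom P := by
    refine ⟨δ, hδ, fun x z t ht => ?_⟩
    by_contra hne
    obtain ⟨k, hk⟩ := hPne x z t hne
    have h1 := (hδ1 _ (subset_tsupport _ hk)).1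
    simp only at h1
    linarith
  rw [← H P hPt hPtop hPbot, ← setIntegral_eq_integral_of_forall_compl_eq_zero (s := bulk ω h)]
  · refine setIntegral_congr_fun (measurableSet_bulk hω hh) fun y hy => ?_
    simp only [hPg y hy, smul_eq_mul, mul_comm]
  · intro y hy
    rw [image_eq_zero_of_notMem_tsupport fun hm => hy (hgs hm), zero_smul]

/-! ### Vertical primitives -/

/-- The primitive `∫_{-∞}^{z₃} φ`. -/
noncomputable def prim (φ : X → ℝ) (y : X) : ℝ := ∫ s in Iic y.2.2, φ (y.1, y.2.1, s)

/-- The vertical integral `∫ φ dz₃`. -/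
noncomputable def total (φ : X → ℝ) (p : E2 × E2) : ℝ := ∫ s, φ (p.1, p.2, s)

section Prim

variable {ω : Set E2} {h : E2 → ℝ} {φ : X → ℝ}

/-- Convolution with the Heaviside function yields joint smoothness of the primitive in all
variables, from the smooth dependence of convolutions on parameters. -/
theorem prim_eq_convolution (φ : X → ℝ) (x z : E2) (t : ℝ) :
    prim φ (x, z, t) = (convolution ((Ici (0 : ℝ)).indicator fun _ => (1 : ℝ))
      (fun s => φ (x, z, s)) (ContinuousLinearMap.mul ℝ ℝ) volume) t := by
  rw [prim, ← integral_indicator measurableSet_Iic, convolution_def,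
    ← integral_sub_left_eq_self _ volume t]
  refine integral_congr_ae (Eventually.of_forall fun s => ?_)
  simp only [ContinuousLinearMap.mul_apply']
  by_cases hs : 0 ≤ s
  · rw [indicator_of_mem (show t - s ∈ Iic t by simpa using hs),
      indicator_of_mem (show s ∈ Ici (0 : ℝ) from hs), one_mul]
  · rw [indicator_of_notMem (show t - s ∉ Iic t by simpa using hs),
      indicator_of_notMem (show s ∉ Ici (0 : ℝ) from hs), zero_mul]

theorem exists_vertical_support (hh : IsProfile h) (ht : ZeroNearTop h φ) (hb : ZeroNearBottom φ) :
    ∃ B, 0 < B ∧ ∀ x z t, t ∉ Icc 0 B → φ (x, z, t) = 0 := by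
  obtain ⟨H, B, hH, hB⟩ := hh.exists_bounds
  obtain ⟨δ, hδ, h0⟩ := ht
  obtain ⟨ε, hε, h1⟩ := hb
  refine ⟨B, by linarith [(hB 0).1, (hB 0).2], fun x z t ht => ?_⟩
  by_cases h : t < 0
  · exact h1 x z t (by linarith)
  · have : B < t := by
      by_contra! hle
      exact ht ⟨not_lt.1 h, hle⟩
    exact h0 x z t (by linarith [(hB z).2])

theorem contDiff_prim (hφ : ContDiff ℝ ((⊤ : ℕ∞) : WithTop ℕ∞) φ) {B : ℝ}
    (hB : ∀ x z t, t ∉ Icc 0 B → φ (x, z, t) = 0) :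
    ContDiff ℝ ((⊤ : ℕ∞) : WithTop ℕ∞) (prim φ) := by
  have h1 : ContDiffOn ℝ ((⊤ : ℕ∞) : WithTop ℕ∞) (fun q : (E2 × E2) × ℝ =>
      (convolution ((Ici (0 : ℝ)).indicator fun _ => (1 : ℝ))
      (fun s => φ (q.1.1, q.1.2, s)) (ContinuousLinearMap.mul ℝ ℝ) volume) q.2) (univ ×ˢ univ) := by
    refine contDiffOn_convolution_right_with_param (n := ⊤) (ContinuousLinearMap.mul ℝ ℝ)
      (g := fun (p : E2 × E2) s => φ (p.1, p.2, s)) isOpen_univ (isCompact_Icc (a := 0) (b := B))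
      (fun p x _ hx => hB _ _ _ hx) ?_ ?_
    · exact (locallyIntegrable_const 1).indicator measurableSet_Ici
    · refine ContDiff.contDiffOn ?_
      exact hφ.comp ((contDiff_fst.comp contDiff_fst).prodMk
        ((contDiff_snd.comp contDiff_fst).prodMk contDiff_snd))
  rw [univ_prod_univ, contDiffOn_univ] at h1
  have h2 : prim φ = fun y : X => (convolution ((Ici (0 : ℝ)).indicator fun _ => (1 : ℝ))
      (fun s => φ (y.1, y.2.1, s)) (ContinuousLinearMap.mul ℝ ℝ) volume) y.2.2 :=
    funext fun y => prim_eq_convolution φ y.1 y.2.1 y.2.2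
  rw [h2]
  exact h1.comp ((contDiff_fst.prodMk (contDiff_fst.comp contDiff_snd)).prodMk
    (contDiff_snd.comp contDiff_snd))

theorem continuous_vertical (hφ : ContDiff ℝ ((⊤ : ℕ∞) : WithTop ℕ∞) φ) (x z : E2) :
    Continuous fun t : ℝ => φ (x, z, t) :=
  hφ.continuous.comp (by fun_prop)

theorem integrable_vertical (hφ : ContDiff ℝ ((⊤ : ℕ∞) : WithTop ℕ∞) φ) {B : ℝ}
    (hB : ∀ x z t, t ∉ Icc 0 B → φ (x, z, t) = 0) (x z : E2) :
    Integrable fun t : ℝ => φ (x, z, t) :=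
  (continuous_vertical hφ x z).integrable_of_hasCompactSupport
    (HasCompactSupport.intro isCompact_Icc fun t ht => hB x z t ht)

theorem prim_eq_interval {B : ℝ} (hB : ∀ x z t, t ∉ Icc 0 B → φ (x, z, t) = 0) 
    (hφ : ContDiff ℝ ((⊤ : ℕ∞) : WithTop ℕ∞) φ) (x z : E2) (t : ℝ) :
    prim φ (x, z, t) = ∫ s in (0 : ℝ)..t, φ (x, z, s) := by
  have hi := integrable_vertical hφ hB x z
  have h1 := intervalIntegral.integral_Iic_sub_Iic (a := 0) (b := t) hi.integrableOn hi.integrableOn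
  rw [← h1, prim]
  have h2 : ∫ s in Iic (0 : ℝ), φ (x, z, s) = 0 := by
    rw [integral_Iic_eq_integral_Iio]
    refine setIntegral_eq_zero_of_forall_eq_zero fun s hs => hB _ _ _ fun hmem => ?_
    exact absurd hmem.1 (not_le.2 hs)
  rw [h2, sub_zero]

theorem hasDerivAt_prim (hφ : ContDiff ℝ ((⊤ : ℕ∞) : WithTop ℕ∞) φ) {B : ℝ}
    (hB : ∀ x z t, t ∉ Icc 0 B → φ (x, z, t) = 0) (x z : E2) (t : ℝ) :
    HasDerivAt (fun s => prim φ (x, z, s)) (φ (x, z, t)) t := by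
  simp only [prim_eq_interval hB hφ]
  have hc := continuous_vertical hφ x z
  exact intervalIntegral.integral_hasDerivAt_right (hc.intervalIntegrable _ _)
    (hc.stronglyMeasurableAtFilter _ _) hc.continuousAt

theorem d3_prim (hφ : ContDiff ℝ ((⊤ : ℕ∞) : WithTop ℕ∞) φ) {B : ℝ}
    (hB : ∀ x z t, t ∉ Icc 0 B → φ (x, z, t) = 0) : d3 (prim φ) = φ := by
  ext y
  exact (hasDerivAt_prim hφ hB y.1 y.2.1 y.2.2).deriv

/-- Above its support the primitive is constant in `z₃`. It vanishes there exactly when the vertical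
integral is zero, which is the only obstruction to its being a test function that vanishes near the
top. -/
theorem prim_eq_total {s : ℝ} {x z : E2} (h0 : ∀ t, s < t → φ (x, z, t) = 0) :
    prim φ (x, z, s) = total φ (x, z) := by
  rw [prim, total]
  refine setIntegral_eq_integral_of_forall_compl_eq_zero fun t ht => h0 t ?_
  simpa using ht

theorem IsTest.prim (hφ : IsTest ω φ) {B : ℝ}
    (hB : ∀ x z t, t ∉ Icc 0 B → φ (x, z, t) = 0) : IsTest ω (prim φ) := by
  refine ⟨contDiff_prim hφ.smooth hB, ?_, fun x t z i => ?_⟩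
  · obtain ⟨C, hC, hCω, h0⟩ := hφ.support
    refine ⟨C, hC, hCω, fun x z hx => ?_⟩
    simp [ThinFilm.prim, h0 x _ hx]
  · simp only [ThinFilm.prim]
    congr 1; ext s; exact hφ.periodic x s z i

theorem IsTest.total (hφ : IsTest ω φ) {B : ℝ}
    (hB : ∀ x z t, t ∉ Icc 0 B → φ (x, z, t) = 0) :
    IsTest ω fun y => ThinFilm.total φ (y.1, y.2.1) := by
  have h1 := (hφ.prim hB).freeze B
  convert h1 using 2 with y
  refine (prim_eq_total fun t ht => hB _ _ _ fun hm => ?_).symm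
  exact absurd hm.2 (not_le.2 ht)

theorem zeroNearBottom_prim (hb : ZeroNearBottom φ) : ZeroNearBottom (prim φ) := by
  obtain ⟨δ, hδ, h0⟩ := hb
  refine ⟨δ, hδ, fun x z t ht => ?_⟩
  refine setIntegral_eq_zero_of_forall_eq_zero fun s hs => h0 x z s (le_trans hs ht)

theorem prim_eq_total_nearTop (ht : ZeroNearTop h φ) :
    ∃ δ > 0, ∀ x z t, h z - δ ≤ t → prim φ (x, z, t) = total φ (x, z) := by
  obtain ⟨δ, hδ, h0⟩ := ht
  exact ⟨δ, hδ, fun x z t ht => prim_eq_total fun s hs => h0 x z s (by linarith)⟩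

theorem interval_eq_total (ht : ZeroNearTop h φ) (hb : ZeroNearBottom φ) (hpos : ∀ z, 0 < h z)
    (x z : E2) : ∫ t in (0 : ℝ)..h z, φ (x, z, t) = total φ (x, z) := by
  obtain ⟨δ, hδ, h0⟩ := ht
  obtain ⟨ε, hε, h1⟩ := hb
  rw [intervalIntegral.integral_of_le (hpos z).le, total]
  refine setIntegral_eq_integral_of_forall_compl_eq_zero fun t ht => ?_
  by_cases h : t ≤ 0
  · exact h1 x z t (by linarith)
  · refine h0 x z t ?_
    by_contra! hlt
    exact ht ⟨not_le.1 h, by linarith⟩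

end Prim

/-! ### Functions with vanishing vertical derivative -/

section Vertical

variable {ω : Set E2} {h : E2 → ℝ}

/-- Every `ψ` vanishing near both boundaries is the `z₃`-derivative of its primitive minus its
vertical integral. That function vanishes near the top but not near the bottom, and this is all the
hypothesis asks for. -/
theorem ae_eq_zero_of_d3_top (hω : IsOpen ω) (hh : IsProfile h) {v : X → ℝ}
    (hv : IntegrableOn v (bulk ω h))
    (H : ∀ φ, IsTest ω φ → ZeroNearTop h φ → ∫ y in bulk ω h, v y * d3 φ y = 0) :
    ∀ᵐ y ∂volume.restrict (bulk ω h), v y = 0 := by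
  refine ae_eq_zero_of_forall_test hω hh hv fun ψ hψ ht hb => ?_
  obtain ⟨B, -, hB⟩ := exists_vertical_support hh ht hb
  have h1 : IsTest ω fun y => prim ψ y - total ψ (y.1, y.2.1) := (hψ.prim hB).sub (hψ.total hB)
  have h2 : ZeroNearTop h fun y => prim ψ y - total ψ (y.1, y.2.1) := by
    obtain ⟨δ, hδ, h0⟩ := prim_eq_total_nearTop ht
    exact ⟨δ, hδ, fun x z t ht => by simp only [h0 x z t ht, sub_self]⟩
  have h3 : d3 (fun y => prim ψ y - total ψ (y.1, y.2.1)) = ψ := by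
    ext y
    exact ((hasDerivAt_prim hψ.smooth hB y.1 y.2.1 y.2.2).sub_const (total ψ (y.1, y.2.1))).deriv
  have := H _ h1 h2
  rwa [h3] at this

/-- The mirror case: the primitive from below vanishes near the bottom without any correction. -/
theorem ae_eq_zero_of_d3_bottom (hω : IsOpen ω) (hh : IsProfile h) {v : X → ℝ}
    (hv : IntegrableOn v (bulk ω h))
    (H : ∀ φ, IsTest ω φ → ZeroNearBottom φ → ∫ y in bulk ω h, v y * d3 φ y = 0) :
    ∀ᵐ y ∂volume.restrict (bulk ω h), v y = 0 := by
  refine ae_eq_zero_of_forall_test hω hh hv fun ψ hψ ht hb => ?_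
  obtain ⟨B, -, hB⟩ := exists_vertical_support hh ht hb
  have := H _ (hψ.prim hB) (zeroNearBottom_prim hb)
  rwa [d3_prim hψ.smooth hB] at this

/-- A smooth function with unit integral, supported in `[δ, h - δ]` for every profile `h ≥ H`. -/
theorem exists_bump {H : ℝ} (hH : 0 < H) : ∃ (θ : ℝ → ℝ) (δ : ℝ), 0 < δ ∧
    ContDiff ℝ ((⊤ : ℕ∞) : WithTop ℕ∞) θ ∧ (∀ t, t ≤ δ → θ t = 0) ∧ (∀ t, H - δ ≤ t → θ t = 0) ∧
    ∫ t, θ t = 1 := by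
  -- With centre `H / 2` and outer radius `H / 4` the support stays between `H / 4` and `3 H / 4`,
  -- so `δ = H / 4` works at both ends.
  let b : ContDiffBump (H / 2) := ⟨H / 8, H / 4, by linarith, by linarith⟩
  refine ⟨b.normed volume, H / 4, by linarith, b.contDiff_normed, ?_, ?_, b.integral_normed⟩
  · intro t ht
    have : t ∉ Function.support (b.normed volume) := by
      rw [b.support_normed_eq, Metric.mem_ball, Real.dist_eq, not_lt]
      exact le_trans (show H / 4 ≤ -(t - H / 2) by linarith) (neg_le_abs _)
    simpa using this
  · intro t ht
    have : t ∉ Function.support (b.normed volume) := by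
      rw [b.support_normed_eq, Metric.mem_ball, Real.dist_eq, not_lt]
      exact le_trans (show H / 4 ≤ t - H / 2 by linarith) (le_abs_self _)
    simpa using this

theorem interval_eq_integral_of_support {θ : ℝ → ℝ} {δ H h : ℝ} (hδ : 0 < δ) (hH : H ≤ h)
    (hpos : 0 < h) (h0 : ∀ t, t ≤ δ → θ t = 0) (h1 : ∀ t, H - δ ≤ t → θ t = 0) :
    ∫ t in (0 : ℝ)..h, θ t = ∫ t, θ t := by
  rw [intervalIntegral.integral_of_le hpos.le]
  refine setIntegral_eq_integral_of_forall_compl_eq_zero fun t ht => ?_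
  by_cases h : t ≤ 0
  · exact h0 t (by linarith)
  · refine h1 t ?_
    by_contra! hlt
    exact ht ⟨not_le.1 h, by linarith⟩

theorem IsTest.tensor_both {φ : X → ℝ} {θ : ℝ → ℝ} {δ H : ℝ} (hδ : 0 < δ) (hH : ∀ z, H ≤ h z)
    (h0 : ∀ t, t ≤ δ → θ t = 0) (h1 : ∀ t, H - δ ≤ t → θ t = 0) (φ : X → ℝ) :
    ZeroNearTop h (fun y => φ y * θ y.2.2) ∧ ZeroNearBottom (fun y => φ y * θ y.2.2) :=
  ⟨⟨δ, hδ, fun x z t ht => by simp only [h1 t (by linarith [hH z]), mul_zero]⟩,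
    ⟨δ, hδ, fun x z t ht => by simp only [h0 t ht, mul_zero]⟩⟩

/-- A test function with vanishing vertical integral is the vertical derivative of a test
function. -/
theorem exists_d3_eq {ψ : X → ℝ} (hh : IsProfile h) (hψ : IsTest ω ψ) (ht : ZeroNearTop h ψ)
    (hb : ZeroNearBottom ψ) (h0 : ∀ p, total ψ p = 0) :
    ∃ χ, IsTest ω χ ∧ ZeroNearTop h χ ∧ ZeroNearBottom χ ∧ d3 χ = ψ := by
  obtain ⟨B, -, hB⟩ := exists_vertical_support hh ht hb
  refine ⟨prim ψ, hψ.prim hB, ?_, zeroNearBottom_prim hb, d3_prim hψ.smooth hB⟩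
  obtain ⟨δ, hδ, h1⟩ := prim_eq_total_nearTop ht
  exact ⟨δ, hδ, fun x z t ht => by rw [h1 x z t ht, h0]⟩

/-- Subtracting its vertical integral times a bump makes the vertical integral vanish. -/
theorem total_sub_bump {ψ : X → ℝ} {θ : ℝ → ℝ} (hθi : Integrable θ) (hθ1 : ∫ t, θ t = 1) {B : ℝ}
    (hψ : IsTest ω ψ) (hB : ∀ x z t, t ∉ Icc 0 B → ψ (x, z, t) = 0) (p : E2 × E2) :
    total (fun y => ψ y - total ψ (y.1, y.2.1) * θ y.2.2) p = 0 := by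
  have : total (fun y => ψ y - total ψ (y.1, y.2.1) * θ y.2.2) p =
      ∫ s, (ψ (p.1, p.2, s) - total ψ p * θ s) := rfl
  rw [this, integral_sub (integrable_vertical hψ.smooth hB _ _) (hθi.const_mul _),
    integral_const_mul, hθ1, mul_one]
  exact sub_self _

theorem integral_base_mul_test (hω : IsOpen ω) (hh : IsProfile h) {m : E2 × E2 → ℝ}
    (hm : IntegrableOn m (ω ×ˢ Zp)) {ψ : X → ℝ} (hψ : IsTest ω ψ) :
    ∫ y in bulk ω h, m (y.1, y.2.1) * ψ y =
      ∫ p in ω ×ˢ Zp, m p * ∫ t in (0 : ℝ)..h p.2, ψ (p.1, p.2, t) := by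
  obtain ⟨H, B, hH, hB⟩ := hh.exists_bounds
  have hmeas := hh.continuous.measurable
  rw [integral_bulk hmeas hh.pos
    (hψ.integrable_mul hω hh (integrableOn_base hmeas (fun z => (hB z).2) hm))]
  refine integral_congr_ae (Eventually.of_forall fun p => ?_)
  simp only [Prod.mk.eta, intervalIntegral.integral_const_mul]

/-- A function whose weak vertical derivative vanishes does not depend on `z₃`. -/
theorem exists_ae_eq_base_of_d3 (hω : IsOpen ω) (hh : IsProfile h) {v : X → ℝ}
    (hv : IntegrableOn v (bulk ω h))
    (H : ∀ φ, IsTest ω φ → ZeroNearTop h φ → ZeroNearBottom φ → ∫ y in bulk ω h, v y * d3 φ y = 0) :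
    ∃ C : E2 × E2 → ℝ, ∀ᵐ y ∂volume.restrict (bulk ω h), v y = C (y.1, y.2.1) := by
  obtain ⟨H0, B0, hH0, hB0⟩ := hh.exists_bounds
  obtain ⟨θ, δ, hδ, hθ, hθ0, hθ1, hθint⟩ := exists_bump hH0
  have hmeas := hh.continuous.measurable
  have hθb : ∃ c, ∀ t, ‖θ t‖ ≤ c := by
    have hc : HasCompactSupport θ := HasCompactSupport.intro (isCompact_Icc (a := δ) (b := H0 - δ))
      fun t ht => by
        by_cases h : t ≤ δ
        · exact hθ0 t h
        · refine hθ1 t ?_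
          by_contra! hlt
          exact ht ⟨(not_le.1 h).le, hlt.le⟩
    exact hc.exists_bound_of_continuous hθ.continuous
  obtain ⟨c, hc⟩ := hθb
  have hθi : Integrable θ := by
    by_contra hne
    rw [integral_undef hne] at hθint
    exact zero_ne_one hθint
  have hvθ : IntegrableOn (fun y => v y * θ y.2.2) (bulk ω h) :=
    Integrable.mul_bdd (c := c) hv (hθ.continuous.comp (by fun_prop)).aestronglyMeasurable
      (Eventually.of_forall fun y => hc _)
  -- If `v` is constant in `z₃`, that constant is its vertical average with weight `θ`, because `∫ θ
  -- = 1`. This candidate is integrable by Fubini.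
  set C : E2 × E2 → ℝ := fun p => ∫ t in (0 : ℝ)..h p.2, v (p.1, p.2, t) * θ t with hC
  have hCi : IntegrableOn C (ω ×ˢ Zp) := integrable_inner_bulk hmeas hh.pos hvθ
  have hCb : IntegrableOn (fun y : X => C (y.1, y.2.1)) (bulk ω h) :=
    integrableOn_base hmeas (fun z => (hB0 z).2) hCi
  refine ⟨C, ?_⟩
  have key := ae_eq_zero_of_forall_test hω hh (v := fun y => v y - C (y.1, y.2.1)) (hv.sub hCb) ?_
  · filter_upwards [key] with y hy using sub_eq_zero.1 hy
  intro ψ hψ ht hb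
  obtain ⟨B, -, hB⟩ := exists_vertical_support hh ht hb
  have hTt : IsTest ω fun y => total ψ (y.1, y.2.1) := hψ.total hB
  have hm : IsTest ω fun y => total ψ (y.1, y.2.1) * θ y.2.2 := hTt.mul_vertical hθ
  obtain ⟨hm1, hm2⟩ := IsTest.tensor_both (φ := ψ) hδ (fun z => (hB0 z).1) hθ0 hθ1
    fun y => total ψ (y.1, y.2.1)
  -- Du Bois-Reymond's argument: after removal of its vertical integral times `θ`, the test function
  -- is an admissible `z₃`-derivative, so `v` cannot distinguish `ψ` from `total ψ · θ`.
  obtain ⟨χ, hχ, hχt, hχb, hχd⟩ := exists_d3_eq hh (hψ.sub hm) (ht.sub hm1) (hb.sub hm2)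
    fun p => total_sub_bump hθi hθint hψ hB p
  have h1 := H χ hχ hχt hχb
  rw [hχd] at h1
  simp only [mul_sub] at h1
  rw [integral_sub (hψ.integrable_mul hω hh hv) (hm.integrable_mul hω hh hv)] at h1
  have h2 : ∫ y in bulk ω h, v y * (total ψ (y.1, y.2.1) * θ y.2.2) =
      ∫ p in ω ×ˢ Zp, C p * total ψ p := by
    rw [integral_bulk hmeas hh.pos (hm.integrable_mul hω hh hv)]
    refine integral_congr_ae (Eventually.of_forall fun p => ?_)
    simp only [hC, Prod.mk.eta]
    rw [← intervalIntegral.integral_mul_const]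
    congr 1; ext t; ring
  have h3 : ∫ y in bulk ω h, C (y.1, y.2.1) * ψ y = ∫ p in ω ×ˢ Zp, C p * total ψ p := by
    rw [integral_base_mul_test hω hh hCi hψ]
    refine integral_congr_ae (Eventually.of_forall fun p => ?_)
    simp only [interval_eq_total ht hb hh.pos p.1 p.2]
  simp only [sub_mul]
  rw [integral_sub (hψ.integrable_mul hω hh hv) (hψ.integrable_mul hω hh hCb), h3, ← h2, h1]

/-! ### Integration by parts in the vertical variable -/

/-- Since `g` is merely integrable, its primitive is only absolutely continuous. Integration by
parts is applied in that class, and the derivative of the primitive is `g` almost everywhere. -/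
theorem integral_primitive_mul_deriv {g ψ ψ' : ℝ → ℝ} {a : ℝ}
    (hg : IntervalIntegrable g volume 0 a) (hψ : ∀ t, HasDerivAt ψ (ψ' t) t) (hc : Continuous ψ') :
    ∫ t in (0 : ℝ)..a, (∫ s in (0 : ℝ)..t, g s) * ψ' t =
      (∫ s in (0 : ℝ)..a, g s) * ψ a - ∫ t in (0 : ℝ)..a, g t * ψ t := by
  have h1 := hg.absolutelyContinuousOnInterval_intervalIntegral (c := 0) (by simp)
  have hd : deriv ψ = ψ' := funext fun t => (hψ t).deriv
  have h2 : AbsolutelyContinuousOnInterval ψ 0 a := by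
    refine ContDiffOn.absolutelyContinuousOnInterval (ContDiff.contDiffOn ?_)
    rw [contDiff_one_iff_deriv]
    exact ⟨fun t => (hψ t).differentiableAt, hd ▸ hc⟩
  have h3 := h1.integral_mul_deriv_eq_deriv_mul h2
  rw [hd] at h3
  rw [h3, intervalIntegral.integral_same, zero_mul, sub_zero]
  congr 1
  refine intervalIntegral.integral_congr_ae ?_
  filter_upwards [hg.ae_hasDerivAt_integral] with t ht hm
  rw [(ht (uIoc_subset_uIcc hm) 0 (by simp)).deriv]

theorem integral_tail_mul_deriv {g ψ ψ' : ℝ → ℝ} {a : ℝ}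
    (hg : IntervalIntegrable g volume 0 a) (hψ : ∀ t, HasDerivAt ψ (ψ' t) t) (hc : Continuous ψ') :
    ∫ t in (0 : ℝ)..a, (∫ s in t..a, g s) * ψ' t =
      -(∫ s in (0 : ℝ)..a, g s) * ψ 0 + ∫ t in (0 : ℝ)..a, g t * ψ t := by
  have h1 := integral_primitive_mul_deriv hg hψ hc
  have h2 : ∫ t in (0 : ℝ)..a, ψ' t = ψ a - ψ 0 :=
    intervalIntegral.integral_eq_sub_of_hasDerivAt (fun t _ => hψ t) (hc.intervalIntegrable _ _)
  have hP : ContinuousOn (fun t => ∫ s in (0 : ℝ)..t, g s) (uIcc 0 a) :=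
    intervalIntegral.continuousOn_primitive_interval ((intervalIntegrable_iff' (by simp)).1 hg)
  have h3 : ∫ t in (0 : ℝ)..a, (∫ s in t..a, g s) * ψ' t =
      ∫ t in (0 : ℝ)..a, ((∫ s in (0 : ℝ)..a, g s) * ψ' t - (∫ s in (0 : ℝ)..t, g s) * ψ' t) := by
    refine intervalIntegral.integral_congr fun t ht => ?_
    rw [← intervalIntegral.integral_interval_sub_left hg
      (hg.mono_set (uIcc_subset_uIcc_left ht)), sub_mul]
  have h4 : IntervalIntegrable (fun t => (∫ s in (0 : ℝ)..t, g s) * ψ' t) volume 0 a :=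
    (hP.mul hc.continuousOn).intervalIntegrable
  rw [h3, intervalIntegral.integral_sub ((hc.intervalIntegrable _ _).const_mul _) h4, intervalIntegral.integral_const_mul, h1, h2]
  ring

theorem intervalIntegrable_of_Ioo {g : ℝ → ℝ} {a : ℝ} (ha : 0 < a) (hg : IntegrableOn g (Ioo 0 a)) :
    IntervalIntegrable g volume 0 a := by
  rw [intervalIntegrable_iff_integrableOn_Ioc_of_le ha.le, integrableOn_Ioc_iff_integrableOn_Ioo]
  exact hg

theorem norm_primitive_le {g : ℝ → ℝ} {a t : ℝ} (hg : IntegrableOn g (Ioo 0 a)) (h0 : 0 < t)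
    (ht : t < a) : ‖∫ s in (0 : ℝ)..t, g s‖ ≤ ∫ s in (0 : ℝ)..a, ‖g s‖ := by
  have hg' := intervalIntegrable_of_Ioo (h0.trans ht) hg
  refine (intervalIntegral.norm_integral_le_integral_norm h0.le).trans ?_
  exact intervalIntegral.integral_mono_interval le_rfl h0.le ht.le
    (Eventually.of_forall fun _ => norm_nonneg _) hg'.norm

/-- A strongly measurable representative of `g` turns the primitive into a parameter integral of a
jointly measurable function. The representative may be used because it agrees with `g` almost
everywhere on almost every vertical slice. -/
theorem aestronglyMeasurable_primitive (hω : IsOpen ω) (hh : IsProfile h) {g : X → ℝ}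
    (hg : IntegrableOn g (bulk ω h)) :
    AEStronglyMeasurable (fun y : X => ∫ s in (0 : ℝ)..y.2.2, g (y.1, y.2.1, s))
      (volume.restrict (bulk ω h)) := by
  have hmeas := hh.continuous.measurable
  set g' := hg.1.mk g with hg'
  have hgm : StronglyMeasurable g' := hg.1.stronglyMeasurable_mk
  set G : X → ℝ → ℝ := fun y s =>
    {r : X × ℝ | 0 < r.2 ∧ r.2 ≤ r.1.2.2}.indicator (fun r => g' (r.1.1, r.1.2.1, r.2)) (y, s) with hG
  have hGm : StronglyMeasurable (Function.uncurry G) := by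
    refine StronglyMeasurable.indicator ?_ ?_
    · exact hgm.comp_measurable (by fun_prop)
    · exact (measurableSet_lt measurable_const measurable_snd).inter
        (measurableSet_le measurable_snd (by fun_prop))
  refine ⟨fun y => ∫ s, G y s, hGm.integral_prod_right, ?_⟩
  have h1 := ae_base_bulk (R := fun p => ∀ᵐ t ∂volume.restrict (Ioo 0 (h p.2)),
    g (p.1, p.2, t) = g' (p.1, p.2, t)) hmeas (ae_slice_bulk hmeas hg.1.ae_eq_mk)
  filter_upwards [h1, ae_restrict_mem (measurableSet_bulk hω hh)] with y hy hmem
  have h2 : ∫ s in (0 : ℝ)..y.2.2, g (y.1, y.2.1, s) = ∫ s in (0 : ℝ)..y.2.2, g' (y.1, y.2.1, s) := by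
    rw [ae_restrict_iff' measurableSet_Ioo] at hy
    refine intervalIntegral.integral_congr_ae ?_
    filter_upwards [hy] with t ht hm
    rw [uIoc_of_le hmem.2.2.1.le] at hm
    exact ht ⟨hm.1, hm.2.trans_lt hmem.2.2.2⟩
  rw [h2, intervalIntegral.integral_of_le hmem.2.2.1.le, ← integral_indicator measurableSet_Ioc]
  refine integral_congr_ae (Eventually.of_forall fun s => ?_)
  by_cases hs : 0 < s ∧ s ≤ y.2.2
  · simp only [hG]
    rw [indicator_of_mem (show s ∈ Ioc 0 y.2.2 from hs), indicator_of_mem (by exact hs)]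
  · simp only [hG]
    rw [indicator_of_notMem (show s ∉ Ioc 0 y.2.2 from hs), indicator_of_notMem (by exact hs)]

theorem ae_integrable_slice (hmeas : Measurable h) {g : X → ℝ} (hg : IntegrableOn g (bulk ω h)) :
    ∀ᵐ y ∂volume.restrict (bulk ω h),
      IntegrableOn (fun t => g (y.1, y.2.1, t)) (Ioo 0 (h y.2.1)) := by
  have h1 := ae_base_bulk hmeas (integrable_slice_bulk hmeas hg)
  filter_upwards [h1] with y hy
  exact hy

/-- On each slice the primitive is bounded by the full integral of `|g|`, an integrable function of
the base point, and the region has bounded height. -/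
theorem integrableOn_primitive (hω : IsOpen ω) (hh : IsProfile h) {g : X → ℝ}
    (hg : IntegrableOn g (bulk ω h)) :
    IntegrableOn (fun y : X => ∫ s in (0 : ℝ)..y.2.2, g (y.1, y.2.1, s)) (bulk ω h) := by
  obtain ⟨H, B, hH, hB⟩ := hh.exists_bounds
  have hmeas := hh.continuous.measurable
  refine integrableOn_bulk_of_bound hmeas (fun z => (hB z).2)
    (aestronglyMeasurable_primitive hω hh hg) (integrable_inner_bulk hmeas hh.pos hg.norm) ?_
  filter_upwards [ae_integrable_slice hmeas hg, ae_restrict_mem (measurableSet_bulk hω hh)] with y hy hm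
  exact norm_primitive_le hy hm.2.2.1 hm.2.2.2

theorem primitive_add_tail {g : ℝ → ℝ} {a t : ℝ} (hg : IntegrableOn g (Ioo 0 a)) (h0 : 0 < t)
    (ht : t < a) : ∫ s in t..a, g s = (∫ s in (0 : ℝ)..a, g s) - ∫ s in (0 : ℝ)..t, g s := by
  have hg' := intervalIntegrable_of_Ioo (h0.trans ht) hg
  rw [← intervalIntegral.integral_interval_sub_left hg' (hg'.mono_set (uIcc_subset_uIcc_left _))]
  rw [uIcc_of_le (h0.trans ht).le]
  exact ⟨h0.le, ht.le⟩

theorem integrableOn_tail (hω : IsOpen ω) (hh : IsProfile h) {g : X → ℝ}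
    (hg : IntegrableOn g (bulk ω h)) :
    IntegrableOn (fun y : X => ∫ s in y.2.2..h y.2.1, g (y.1, y.2.1, s)) (bulk ω h) := by
  obtain ⟨H, B, hH, hB⟩ := hh.exists_bounds
  have hmeas := hh.continuous.measurable
  have h1 := integrableOn_base hmeas (fun z => (hB z).2) (integrable_inner_bulk hmeas hh.pos hg)
  refine (h1.sub (integrableOn_primitive hω hh hg)).congr ?_
  filter_upwards [ae_integrable_slice hmeas hg, ae_restrict_mem (measurableSet_bulk hω hh)] with y hy hm
  exact (primitive_add_tail hy hm.2.2.1 hm.2.2.2).symm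

theorem integral_primitive_mul_d3 (hω : IsOpen ω) (hh : IsProfile h) {g : X → ℝ}
    (hg : IntegrableOn g (bulk ω h)) {φ : X → ℝ} (hφ : IsTest ω φ) (ht : ZeroNearTop h φ) :
    ∫ y in bulk ω h, (∫ s in (0 : ℝ)..y.2.2, g (y.1, y.2.1, s)) * d3 φ y =
      -∫ y in bulk ω h, g y * φ y := by
  have hmeas := hh.continuous.measurable
  obtain ⟨δ, hδ, h0⟩ := ht
  rw [integral_bulk hmeas hh.pos (hφ.d3.integrable_mul hω hh (integrableOn_primitive hω hh hg)),
    integral_bulk hmeas hh.pos (hφ.integrable_mul hω hh hg), ← integral_neg]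
  refine integral_congr_ae ?_
  filter_upwards [integrable_slice_bulk hmeas hg] with p hp
  have := integral_primitive_mul_deriv (intervalIntegrable_of_Ioo (hh.pos p.2) hp)
    (hasDerivAt_d3' hφ.smooth p.1 p.2) (continuous_vertical hφ.d3.smooth p.1 p.2)
  rw [this, h0 p.1 p.2 (h p.2) (by linarith), mul_zero, zero_sub]

theorem integral_tail_mul_d3 (hω : IsOpen ω) (hh : IsProfile h) {g : X → ℝ}
    (hg : IntegrableOn g (bulk ω h)) {φ : X → ℝ} (hφ : IsTest ω φ) (hb : ZeroNearBottom φ) :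
    ∫ y in bulk ω h, (∫ s in y.2.2..h y.2.1, g (y.1, y.2.1, s)) * d3 φ y =
      ∫ y in bulk ω h, g y * φ y := by
  have hmeas := hh.continuous.measurable
  obtain ⟨δ, hδ, h0⟩ := hb
  rw [integral_bulk hmeas hh.pos (hφ.d3.integrable_mul hω hh (integrableOn_tail hω hh hg)),
    integral_bulk hmeas hh.pos (hφ.integrable_mul hω hh hg)]
  refine integral_congr_ae ?_
  filter_upwards [integrable_slice_bulk hmeas hg] with p hp
  have := integral_tail_mul_deriv (intervalIntegrable_of_Ioo (hh.pos p.2) hp)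
    (hasDerivAt_d3' hφ.smooth p.1 p.2) (continuous_vertical hφ.d3.smooth p.1 p.2)
  rw [this, h0 p.1 p.2 0 hδ.le, mul_zero, zero_add]

/-- A function with zero trace at the top is the integral of its derivative from the top. -/
theorem ae_eq_tail (hω : IsOpen ω) (hh : IsProfile h) {v g : X → ℝ}
    (hv : IntegrableOn v (bulk ω h)) (hg : IntegrableOn g (bulk ω h)) (H : ZeroOnTop ω h v g) :
    ∀ᵐ y ∂volume.restrict (bulk ω h), v y = -∫ s in y.2.2..h y.2.1, g (y.1, y.2.1, s) := by
  have hT := integrableOn_tail hω hh hg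
  have key := ae_eq_zero_of_d3_bottom hω hh (hv.add hT) fun φ hφ hb => ?_
  · filter_upwards [key] with y hy using eq_neg_of_add_eq_zero_left hy
  simp only [Pi.add_apply, add_mul]
  rw [integral_add (hφ.d3.integrable_mul hω hh hv) (hφ.d3.integrable_mul hω hh hT),
    integral_tail_mul_d3 hω hh hg hφ hb, show ∫ y in bulk ω h, v y * d3 φ y = _ from H φ hφ hb]
  ring

/-- A function with zero trace at the bottom is the integral of its derivative from the bottom. -/
theorem ae_eq_primitive (hω : IsOpen ω) (hh : IsProfile h) {v g : X → ℝ}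
    (hv : IntegrableOn v (bulk ω h)) (hg : IntegrableOn g (bulk ω h)) (H : ZeroOnBottom ω h v g) :
    ∀ᵐ y ∂volume.restrict (bulk ω h), v y = ∫ s in (0 : ℝ)..y.2.2, g (y.1, y.2.1, s) := by
  have hT := integrableOn_primitive hω hh hg
  have key := ae_eq_zero_of_d3_top hω hh (hv.sub hT) fun φ hφ ht => ?_
  · filter_upwards [key] with y hy using sub_eq_zero.1 hy
  simp only [Pi.sub_apply, sub_mul]
  rw [integral_sub (hφ.d3.integrable_mul hω hh hv) (hφ.d3.integrable_mul hω hh hT),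
    integral_primitive_mul_d3 hω hh hg hφ ht, show ∫ y in bulk ω h, v y * d3 φ y = _ from H φ hφ ht]
  ring

end Vertical

/-! ### The heat equation, integrated twice in `z₃` -/

section Heat

variable {ω : Set E2} {h : E2 → ℝ}

theorem volume_bulk_lt_top (hωb : Bornology.IsBounded ω) (hh : IsProfile h) :
    volume (bulk ω h) < ⊤ := by
  obtain ⟨H, B, hH, hB⟩ := hh.exists_bounds
  have h1 : bulk ω h ⊆ ω ×ˢ (Zp ×ˢ Ioo 0 B) := by
    intro y hy
    exact ⟨hy.1, hy.2.1, hy.2.2.1, hy.2.2.2.trans_le (hB _).2⟩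
  have h2 : Bornology.IsBounded (ω ×ˢ (Zp ×ˢ Ioo 0 B)) :=
    hωb.prod (isBounded_Zp.prod (Metric.isBounded_Ioo _ _))
  exact (h2.subset h1).measure_lt_top

theorem isFiniteMeasure_bulk (hωb : Bornology.IsBounded ω) (hh : IsProfile h) :
    IsFiniteMeasure (volume.restrict (bulk ω h)) :=
  ⟨by rw [Measure.restrict_apply_univ]; exact volume_bulk_lt_top hωb hh⟩

theorem integrableOn_fst {b : E2 → ℝ} (hb : IntegrableOn b ω) :
    IntegrableOn (fun p : E2 × E2 => b p.1) (ω ×ˢ Zp) := by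
  have h1 : Integrable (fun p : E2 × E2 => b p.1 * (1 : ℝ))
      ((volume.restrict ω).prod (volume.restrict Zp)) := hb.mul_prod (integrable_const 1)
  rw [IntegrableOn, Measure.volume_eq_prod, ← Measure.prod_restrict]
  simpa using h1

/-- The sum `dT + b/k + (1/k) ∫₀ F` annihilates `∂ζ/∂z₃` for every `ζ` that vanishes near the top,
hence is zero. Freedom of `ζ` at the bottom is what encodes the flux condition and fixes the
constant of integration. -/
theorem ae_heat_flux (hω : IsOpen ω) (hh : IsProfile h) {dT F : X → ℝ} {b : E2 → ℝ} {k : ℝ}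
    (hk : 0 < k) (hdT : IntegrableOn dT (bulk ω h)) (hF : IntegrableOn F (bulk ω h))
    (hb : IntegrableOn b ω)
    (H : ∀ ζ, IsTest ω ζ → ZeroNearTop h ζ → k * (∫ y in bulk ω h, dT y * d3 ζ y)
      = (∫ y in bulk ω h, F y * ζ y) + ∫ y in ω ×ˢ Zp, b y.1 * ζ (y.1, y.2, 0)) :
    ∀ᵐ y ∂volume.restrict (bulk ω h),
      dT y = -(b y.1 / k) - 1 / k * ∫ s in (0 : ℝ)..y.2.2, F (y.1, y.2.1, s) := by
  obtain ⟨H0, B, hH, hB⟩ := hh.exists_bounds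
  have hmeas := hh.continuous.measurable
  have hP := integrableOn_primitive hω hh hF
  have hbb : IntegrableOn (fun y : X => b y.1) (bulk ω h) :=
    integrableOn_base hmeas (fun z => (hB z).2) (integrableOn_fst hb)
  have hPk := hP.const_mul k⁻¹
  have hbk := hbb.const_mul k⁻¹
  have key := ae_eq_zero_of_d3_top hω hh ((hdT.add hbk).add hPk) fun ζ hζ ht => ?_
  · filter_upwards [key] with y hy
    simp only [Pi.add_apply] at hy
    rw [div_eq_inv_mul, one_div]
    linarith
  simp only [Pi.add_apply, add_mul]
  have i1 := hζ.d3.integrable_mul hω hh hdT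
  have i2 := hζ.d3.integrable_mul hω hh hbk
  have i3 := hζ.d3.integrable_mul hω hh hPk
  -- As `b` does not depend on `z₃`, the vertical integral telescopes to `-ζ` at `z₃ = 0`, which
  -- cancels the boundary term of the weak equation.
  have e1 : ∫ y in bulk ω h, k⁻¹ * b y.1 * d3 ζ y =
      -(k⁻¹ * ∫ y in ω ×ˢ Zp, b y.1 * ζ (y.1, y.2, 0)) := by
    rw [integral_base_mul_test hω hh (m := fun p => k⁻¹ * b p.1)
      ((integrableOn_fst hb).const_mul k⁻¹) hζ.d3, ← integral_const_mul, ← integral_neg]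
    refine integral_congr_ae (Eventually.of_forall fun p => ?_)
    simp only
    rw [intervalIntegral.integral_eq_sub_of_hasDerivAt
      (fun t _ => hasDerivAt_d3' hζ.smooth p.1 p.2 t)
      ((continuous_vertical hζ.d3.smooth p.1 p.2).intervalIntegrable _ _)]
    obtain ⟨δ, hδ, h0⟩ := ht
    rw [h0 p.1 p.2 (h p.2) (by linarith)]
    ring
  have e2 : ∫ y in bulk ω h, k⁻¹ * (∫ s in (0 : ℝ)..y.2.2, F (y.1, y.2.1, s)) * d3 ζ y =
      -(k⁻¹ * ∫ y in bulk ω h, F y * ζ y) := by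
    simp only [mul_assoc]
    rw [integral_const_mul, integral_primitive_mul_d3 hω hh hF hζ ht]
    ring
  have i12 : Integrable (fun y => dT y * d3 ζ y + k⁻¹ * b y.1 * d3 ζ y)
    (volume.restrict (bulk ω h)) := i1.add i2
  rw [integral_add i12 i3, integral_add i1 i2, e1, e2]
  have := H ζ hζ ht
  field_simp
  linarith

/-- The inner tail integral is the full integral minus the primitive. The full integral contributes
`(a - t) ∫₀ᵃ F`, which the second term of `doubleInt` removes. -/
theorem doubleInt_eq {F : ℝ → ℝ} {a t : ℝ} (hF : IntegrableOn F (Ioo 0 a)) (h0 : 0 < t)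
    (ht : t < a) : doubleInt F a t = -∫ s in t..a, ∫ r in (0 : ℝ)..s, F r := by
  have hF' := intervalIntegrable_of_Ioo (h0.trans ht) hF
  have hc : ContinuousOn (fun s => ∫ r in (0 : ℝ)..s, F r) (uIcc 0 a) :=
    intervalIntegral.continuousOn_primitive_interval ((intervalIntegrable_iff' (by simp)).1 hF')
  have hsub : uIcc t a ⊆ uIcc 0 a := by
    rw [uIcc_of_le ht.le, uIcc_of_le (h0.trans ht).le]
    exact Icc_subset_Icc_left h0.le
  have h1 : ∫ s in t..a, ∫ r in s..a, F r =
      ∫ s in t..a, ((∫ r in (0 : ℝ)..a, F r) - ∫ r in (0 : ℝ)..s, F r) := by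
    refine intervalIntegral.integral_congr fun s hs => ?_
    rw [← intervalIntegral.integral_interval_sub_left hF'
      (hF'.mono_set (uIcc_subset_uIcc_left (hsub hs)))]
  rw [doubleInt, h1, intervalIntegral.integral_sub (by simp) ((hc.mono hsub).intervalIntegrable),
    intervalIntegral.integral_const, smul_eq_mul]
  ring

theorem ae_temperature (hω : IsOpen ω) (hh : IsProfile h) {T dT F G : X → ℝ} {b : E2 → ℝ}
    {k α β : ℝ} (hk : 0 < k) (hT : IntegrableOn T (bulk ω h)) (hdT : IntegrableOn dT (bulk ω h))
    (hF : IntegrableOn F (bulk ω h)) (hG : IntegrableOn G (bulk ω h)) (hb : IntegrableOn b ω)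
    (htop : ZeroOnTop ω h T dT)
    (H : ∀ ζ, IsTest ω ζ → ZeroNearTop h ζ → k * (∫ y in bulk ω h, dT y * d3 ζ y)
      = α * (∫ y in bulk ω h, F y * ζ y) + β * (∫ y in bulk ω h, G y * ζ y)
        + ∫ y in ω ×ˢ Zp, b y.1 * ζ (y.1, y.2, 0)) :
    ∀ᵐ y ∂volume.restrict (bulk ω h), T y = b y.1 / k * (h y.2.1 - y.2.2)
      - α / k * doubleInt (fun τ => F (y.1, y.2.1, τ)) (h y.2.1) y.2.2
      - β / k * doubleInt (fun τ => G (y.1, y.2.1, τ)) (h y.2.1) y.2.2 := by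
  have hmeas := hh.continuous.measurable
  have hFG : IntegrableOn (fun y => α * F y + β * G y) (bulk ω h) :=
    (hF.const_mul α).add (hG.const_mul β)
  have h1 := ae_heat_flux hω hh hk hdT hFG hb fun ζ hζ ht => by
    rw [H ζ hζ ht]
    have i1 : Integrable (fun y => α * (F y * ζ y)) (volume.restrict (bulk ω h)) :=
      (hζ.integrable_mul hω hh hF).const_mul α
    have i2 : Integrable (fun y => β * (G y * ζ y)) (volume.restrict (bulk ω h)) :=
      (hζ.integrable_mul hω hh hG).const_mul β
    rw [← integral_const_mul, ← integral_const_mul, ← integral_add i1 i2]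
    congr 2
    ext y; ring
  -- The flux formula has to be inserted under a vertical integral, so it is needed almost
  -- everywhere on the whole slice through a point, not only at the point.
  have h2 := ae_base_bulk hmeas (ae_slice_bulk hmeas h1)
  filter_upwards [ae_eq_tail hω hh hT hdT htop, h2, ae_integrable_slice hmeas hF,
    ae_integrable_slice hmeas hG, ae_restrict_mem (measurableSet_bulk hω hh)] with y hy hs hf hg hm
  obtain ⟨x, z, t⟩ := y
  simp only at hy hs hf hg
  have h0 : 0 < t := hm.2.2.1
  have ht : t < h z := hm.2.2.2
  rw [hy, doubleInt_eq hf h0 ht, doubleInt_eq hg h0 ht]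
  have hsub : uIcc t (h z) ⊆ uIcc 0 (h z) := by
    rw [uIcc_of_le ht.le, uIcc_of_le (h0.trans ht).le]
    exact Icc_subset_Icc_left h0.le
  have hf' := intervalIntegrable_of_Ioo (h0.trans ht) hf
  have hg' := intervalIntegrable_of_Ioo (h0.trans ht) hg
  have cf : IntervalIntegrable (fun s => ∫ r in (0 : ℝ)..s, F (x, z, r)) volume t (h z) :=
    ((intervalIntegral.continuousOn_primitive_interval
      ((intervalIntegrable_iff' (by simp)).1 hf')).mono hsub).intervalIntegrable
  have cg : IntervalIntegrable (fun s => ∫ r in (0 : ℝ)..s, G (x, z, r)) volume t (h z) :=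
    ((intervalIntegral.continuousOn_primitive_interval
      ((intervalIntegrable_iff' (by simp)).1 hg')).mono hsub).intervalIntegrable
  have e1 : ∫ s in t..h z, dT (x, z, s) = ∫ s in t..h z, (-(b x / k)
      - (α / k * (∫ r in (0 : ℝ)..s, F (x, z, r)) + β / k * ∫ r in (0 : ℝ)..s, G (x, z, r))) := by
    rw [ae_restrict_iff' measurableSet_Ioo] at hs
    refine intervalIntegral.integral_congr_ae ?_
    filter_upwards [hs, Measure.ae_ne volume (h z)] with s hs hne hmem
    rw [uIoc_of_le ht.le] at hmem
    have hlt := lt_of_le_of_ne hmem.2 hne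
    rw [hs ⟨h0.trans hmem.1, hlt⟩]
    have hss : uIcc 0 s ⊆ uIcc 0 (h z) := by
      rw [uIcc_of_le (h0.trans hmem.1).le, uIcc_of_le (h0.trans ht).le]
      exact Icc_subset_Icc_right hmem.2
    rw [intervalIntegral.integral_add ((hf'.mono_set hss).const_mul α)
      ((hg'.mono_set hss).const_mul β), intervalIntegral.integral_const_mul,
      intervalIntegral.integral_const_mul]
    ring
  rw [e1, intervalIntegral.integral_sub (by simp) ((cf.const_mul _).add (cg.const_mul _)),
    intervalIntegral.integral_add (cf.const_mul _) (cg.const_mul _),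
    intervalIntegral.integral_const_mul, intervalIntegral.integral_const_mul,
    intervalIntegral.integral_const, smul_eq_mul]
  ring

end Heat

/-! ### Elimination of the microscopic pressure -/

section Momentum

variable {ω : Set E2} {h : E2 → ℝ}

/-- A horizontal derivative looks at nearby `z'`, where `h` is slightly different. Halving `δ`
leaves room for this by continuity. -/
theorem ZeroNearTop.dz {φ : X → ℝ} (hc : Continuous h) (hφ : ZeroNearTop h φ) (j : Fin 2) :
    ZeroNearTop h (ThinFilm.dz j φ) := by
  obtain ⟨δ, hδ, h0⟩ := hφ
  refine ⟨δ / 2, by positivity, fun x z t ht => ?_⟩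
  have h1 : (fun w => φ (x, w, t)) =ᶠ[nhds z] fun _ => (0 : ℝ) := by
    have ho : IsOpen {w | h w - δ < t} := isOpen_lt (hc.sub continuous_const) continuous_const
    filter_upwards [ho.mem_nhds (show h z - δ < t by linarith)] with w hw
    exact h0 x w t (le_of_lt hw)
  simp only [ThinFilm.dz, pd]
  rw [h1.fderiv_eq]
  simp

theorem ZeroNearBottom.dz {φ : X → ℝ} (hφ : ZeroNearBottom φ) (j : Fin 2) :
    ZeroNearBottom (ThinFilm.dz j φ) := by
  obtain ⟨δ, hδ, h0⟩ := hφ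
  refine ⟨δ, hδ, fun x z t ht => ?_⟩
  simp only [ThinFilm.dz, pd, h0 x _ t ht]
  simp

/-- If the vertical integral of a test function vanishes, so does that of its horizontal
derivatives. -/
theorem total_dz_eq_zero {φ : X → ℝ} (hh : IsProfile h) (hφ : IsTest ω φ) (ht : ZeroNearTop h φ)
    (hb : ZeroNearBottom φ) (h0 : ∀ p, total φ p = 0) (j : Fin 2) (p : E2 × E2) :
    total (dz j φ) p = 0 := by
  obtain ⟨B, hB0, hB⟩ := exists_vertical_support hh ht hb
  obtain ⟨B', hB0', hB'⟩ := exists_vertical_support hh (ht.dz hh.continuous j) (hb.dz j)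
  set R := max B B' with hR
  have hRpos : 0 < R := lt_max_of_lt_left hB0
  have conv : ∀ {ψ : X → ℝ} {b : ℝ}, b ≤ R → (∀ x z t, t ∉ Icc 0 b → ψ (x, z, t) = 0) → ∀ z,
      ∫ t in (0 : ℝ)..R, ψ (p.1, z, t) = total ψ (p.1, z) := by
    intro ψ b hbR hψ z
    rw [intervalIntegral.integral_of_le hRpos.le, ← integral_Icc_eq_integral_Ioc, total]
    refine setIntegral_eq_integral_of_forall_compl_eq_zero fun t ht => hψ _ _ _ fun hm => ht ?_
    exact ⟨hm.1, hm.2.trans hbR⟩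
  obtain ⟨C, hC0, hC⟩ := (hφ.dz j).bounded R
  have key := intervalIntegral.hasDerivAt_integral_of_dominated_loc_of_deriv_le (𝕜 := ℝ)
    (μ := volume) (a := 0) (b := R)
    (F := fun (s : ℝ) t => φ (p.1, p.2 + s • e j, t))
    (F' := fun (s : ℝ) t => dz j φ (p.1, p.2 + s • e j, t)) (x₀ := 0) (s := univ)
    (bound := fun _ => C) univ_mem
    (Eventually.of_forall fun s => (continuous_vertical hφ.smooth _ _).aestronglyMeasurable)
    ((continuous_vertical hφ.smooth _ _).intervalIntegrable _ _)
    (continuous_vertical (hφ.dz j).smooth _ _).aestronglyMeasurable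
    (Eventually.of_forall fun t hm s _ => by
      rw [uIoc_of_le hRpos.le] at hm
      exact hC _ _ _ (abs_le.2 ⟨by linarith [hm.1], hm.2⟩))
    (by simp)
    (Eventually.of_forall fun t hm s _ => by
      have h1 := (hasFDerivAt_dz hφ.smooth p.1 (p.2 + s • e j) t)
      have h2 : HasDerivAt (fun s : ℝ => p.2 + s • e j) (e j) s := by
        simpa using ((hasDerivAt_id s).smul_const (e j)).const_add p.2
      have h3 := h1.comp_hasDerivAt s h2
      rw [dz_eq hφ.smooth]
      exact h3)
  have h2 := key.2
  simp only [conv (le_max_left _ _) hB, h0, zero_smul, add_zero] at h2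
  rw [conv (le_max_right _ _) hB'] at h2
  exact h2.unique (hasDerivAt_const _ _)

/-- The pressure does not depend on `z₃`, so it only sees the vertical integral of `∂φ/∂z_j`.
Differentiation under the integral makes that zero when `φ` has zero vertical integral, and the
pressure term disappears. -/
theorem integral_base_mul_dz (hω : IsOpen ω) {φ : X → ℝ} (hh : IsProfile h) (hφ : IsTest ω φ)
    (ht : ZeroNearTop h φ) (hb : ZeroNearBottom φ) (h0 : ∀ p, total φ p = 0) (j : Fin 2)
    {m : E2 × E2 → ℝ} (hm : IntegrableOn m (ω ×ˢ Zp)) :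
    ∫ y in bulk ω h, m (y.1, y.2.1) * dz j φ y = 0 := by
  rw [integral_base_mul_test hω hh hm (hφ.dz j)]
  simp only [interval_eq_total (ht.dz hh.continuous j) (hb.dz j) hh.pos,
    total_dz_eq_zero hh hφ ht hb h0 j, mul_zero, integral_zero]

/-- The Cauchy–Schwarz inequality, obtained by expanding `0 ≤ ∫ (a f - I)²` with `I = ∫ f`. -/
theorem sq_integral_le {f : ℝ → ℝ} {a : ℝ} (ha : 0 < a) (hf : IntegrableOn f (Ioo 0 a))
    (hf2 : IntegrableOn (fun t => f t ^ 2) (Ioo 0 a)) :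
    (∫ t in (0 : ℝ)..a, f t) ^ 2 ≤ a * ∫ t in (0 : ℝ)..a, f t ^ 2 := by
  have i1 := intervalIntegrable_of_Ioo ha hf
  have i2 := intervalIntegrable_of_Ioo ha hf2
  set I := ∫ t in (0 : ℝ)..a, f t with hI
  have h1 : 0 ≤ ∫ t in (0 : ℝ)..a, (a * f t - I) ^ 2 :=
    intervalIntegral.integral_nonneg ha.le fun t _ => sq_nonneg _
  have h2 : ∫ t in (0 : ℝ)..a, (a * f t - I) ^ 2 =
      ∫ t in (0 : ℝ)..a, ((a ^ 2 * f t ^ 2 - 2 * a * I * f t) + I ^ 2) := by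
    congr 1; ext t; ring
  rw [h2, intervalIntegral.integral_add ((i2.const_mul _).sub (i1.const_mul _)) (by simp),
    intervalIntegral.integral_sub (i2.const_mul _) (i1.const_mul _),
    intervalIntegral.integral_const_mul, intervalIntegral.integral_const_mul,
    intervalIntegral.integral_const, ← hI, smul_eq_mul] at h1
  have h3 : 0 ≤ a * (a * (∫ t in (0 : ℝ)..a, f t ^ 2) - I ^ 2) := by linarith
  have := nonneg_of_mul_nonneg_right h3 ha
  linarith

theorem memLp_inner_bulk (hωb : Bornology.IsBounded ω) (hh : IsProfile h) {f : X → ℝ}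
    (hf : MemLp f 2 (volume.restrict (bulk ω h))) :
    MemLp (fun p => ∫ t in (0 : ℝ)..h p.2, f (p.1, p.2, t)) 2 (volume.restrict (ω ×ˢ Zp)) := by
  have := isFiniteMeasure_bulk hωb hh
  obtain ⟨H, B, hH, hB⟩ := hh.exists_bounds
  have hmeas := hh.continuous.measurable
  have hf1 : IntegrableOn f (bulk ω h) := hf.integrable one_le_two
  have hf2 : IntegrableOn (fun y => f y ^ 2) (bulk ω h) := hf.integrable_sq
  have h1 := integrable_inner_bulk hmeas hh.pos hf1
  rw [memLp_two_iff_integrable_sq h1.1]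
  refine ((integrable_inner_bulk hmeas hh.pos hf2).const_mul B).mono' (h1.1.pow 2) ?_
  filter_upwards [integrable_slice_bulk hmeas hf1, integrable_slice_bulk hmeas hf2] with p hp hp2
  rw [Real.norm_eq_abs, abs_of_nonneg (sq_nonneg _)]
  refine (sq_integral_le (hh.pos p.2) hp hp2).trans ?_
  refine mul_le_mul_of_nonneg_right (hB p.2).2 ?_
  exact intervalIntegral.integral_nonneg (hh.pos p.2).le fun t _ => sq_nonneg _

/-- The hypotheses on the `j`-th component `v` of the horizontal velocity, with vertical
derivative `dv`, right-hand side `r` and microscopic pressure `ϖ`. -/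
structure IsMomentumComponent (ω : Set E2) (h : E2 → ℝ) (μ μeff K : ℝ) (j : Fin 2) (v dv : X → ℝ)
    (r : E2 → ℝ) (ϖ : E2 × E2 → ℝ) : Prop where
  memLp : MemLp v 2 (volume.restrict (bulk ω h))
  memLp_deriv : MemLp dv 2 (volume.restrict (bulk ω h))
  deriv : IsWeakD3 ω h v dv
  top : ZeroOnTop ω h v dv
  bottom : ZeroOnBottom ω h v dv
  rhs : IntegrableOn r ω
  pressure : IntegrableOn ϖ (ω ×ˢ Zp)
  momentum : ∀ φ, IsTest ω φ → ZeroNearTop h φ → ZeroNearBottom φ →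
    μeff * (∫ y in bulk ω h, dv y * d3 φ y) + μ / K * (∫ y in bulk ω h, v y * φ y)
        - (∫ y in bulk ω h, ϖ (y.1, y.2.1) * dz j φ y) = ∫ y in bulk ω h, r y.1 * φ y

theorem exists_bound_of_support {θ : ℝ → ℝ} {δ H : ℝ} (hθ : Continuous θ)
    (h0 : ∀ t, t ≤ δ → θ t = 0) (h1 : ∀ t, H - δ ≤ t → θ t = 0) : ∃ c, ∀ t, ‖θ t‖ ≤ c := by
  have hc : HasCompactSupport θ := HasCompactSupport.intro (isCompact_Icc (a := δ) (b := H - δ))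
    fun t ht => by
      by_cases h : t ≤ δ
      · exact h0 t h
      · refine h1 t ?_
        by_contra! hlt
        exact ht ⟨(not_le.1 h).le, hlt.le⟩
  exact hc.exists_bound_of_continuous hθ

theorem memLp_mul_vertical {f : X → ℝ} (hf : MemLp f 2 (volume.restrict (bulk ω h))) {θ : ℝ → ℝ}
    (hθ : Continuous θ) {c : ℝ} (hc : ∀ t, ‖θ t‖ ≤ c) :
    MemLp (fun y => f y * θ y.2.2) 2 (volume.restrict (bulk ω h)) := by
  refine hf.of_le_mul (c := c)
    (hf.1.mul (hθ.comp (by fun_prop : Continuous fun y : X => y.2.2)).aestronglyMeasurable)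
    (Eventually.of_forall fun y => ?_)
  rw [norm_mul, mul_comm]
  exact mul_le_mul_of_nonneg_right (hc _) (norm_nonneg _)

/-- The momentum equation determines a square integrable function `g = r - ∂ϖ/∂z_j` of `(x', z')`,
and the pressure can be eliminated. -/
theorem IsMomentumComponent.exists_forcing (hω : IsOpen ω) (hωb : Bornology.IsBounded ω)
    (hh : IsProfile h) {μ μeff K : ℝ} {j : Fin 2} {v dv : X → ℝ} {r : E2 → ℝ} {ϖ : E2 × E2 → ℝ}
    (H : IsMomentumComponent ω h μ μeff K j v dv r ϖ) :
    ∃ g : E2 × E2 → ℝ, MemLp g 2 (volume.restrict (ω ×ˢ Zp)) ∧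
      (∀ φ, IsTest ω φ → ZeroNearTop h φ → ZeroNearBottom φ →
        μeff * (∫ y in bulk ω h, dv y * d3 φ y) + μ / K * (∫ y in bulk ω h, v y * φ y) =
          ∫ y in bulk ω h, g (y.1, y.2.1) * φ y) ∧
      ∀ a, IsTest ω a → (∀ x z t, a (x, z, t) = a (x, z, 0)) →
        (∫ p in ω ×ˢ Zp, g p * a (p.1, p.2, 0)) - (∫ p in ω ×ˢ Zp, ϖ p * dz j a (p.1, p.2, 0)) =
          ∫ p in ω ×ˢ Zp, r p.1 * a (p.1, p.2, 0) := by
  have := isFiniteMeasure_bulk hωb hh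
  obtain ⟨H0, B0, hH0, hB0⟩ := hh.exists_bounds
  obtain ⟨θ, δ, hδ, hθ, hθ0, hθ1, hθint⟩ := exists_bump hH0
  have hmeas := hh.continuous.measurable
  have hv1 : IntegrableOn v (bulk ω h) := H.memLp.integrable one_le_two
  have hdv1 : IntegrableOn dv (bulk ω h) := H.memLp_deriv.integrable one_le_two
  have hθd : ContDiff ℝ ((⊤ : ℕ∞) : WithTop ℕ∞) (_root_.deriv θ) :=
    ((contDiff_infty_iff_deriv (𝕜 := ℝ)).1 hθ).2
  have hθd0 : ∀ t, t ≤ δ / 2 → _root_.deriv θ t = 0 := by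
    intro t ht
    have : θ =ᶠ[nhds t] fun _ => 0 := by
      filter_upwards [Iio_mem_nhds (show t < δ by linarith)] with s hs using hθ0 s (le_of_lt hs)
    rw [this.deriv_eq]; simp
  have hθd1 : ∀ t, H0 - δ / 2 ≤ t → _root_.deriv θ t = 0 := by
    intro t ht
    have : θ =ᶠ[nhds t] fun _ => 0 := by
      filter_upwards [Ioi_mem_nhds (show H0 - δ < t by linarith)] with s hs using hθ1 s (le_of_lt hs)
    rw [this.deriv_eq]; simp
  obtain ⟨c, hc⟩ := exists_bound_of_support hθ.continuous hθ0 hθ1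
  obtain ⟨c', hc'⟩ := exists_bound_of_support hθd.continuous hθd0 hθd1
  have hθi : Integrable θ := by
    by_contra hne
    rw [integral_undef hne] at hθint
    exact zero_ne_one hθint
  have hG : MemLp (fun y : X => μeff * (dv y * _root_.deriv θ y.2.2) + μ / K * (v y * θ y.2.2)) 2
      (volume.restrict (bulk ω h)) :=
    ((memLp_mul_vertical H.memLp_deriv hθd.continuous hc').const_mul _).add
      ((memLp_mul_vertical H.memLp hθ.continuous hc).const_mul _)
  have hG1 : IntegrableOn (fun y : X => μeff * (dv y * _root_.deriv θ y.2.2)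
      + μ / K * (v y * θ y.2.2)) (bulk ω h) := hG.integrable one_le_two
  -- This value is forced by testing the equation with products `a(x', z') θ(z₃)`. Only `v` and `dv`
  -- enter it, which gives square integrability although `∂ϖ/∂z_j` is a priori a distribution.
  set g : E2 × E2 → ℝ := fun p => ∫ t in (0 : ℝ)..h p.2,
    (μeff * (dv (p.1, p.2, t) * _root_.deriv θ t) + μ / K * (v (p.1, p.2, t) * θ t)) with hg
  have hgL : MemLp g 2 (volume.restrict (ω ×ˢ Zp)) := memLp_inner_bulk hωb hh hG
  have hg1 : IntegrableOn g (ω ×ˢ Zp) := integrable_inner_bulk hmeas hh.pos hG1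
  -- the equation for products of the bump with functions of `(x', z')`
  have hprod : ∀ a, IsTest ω a → (∀ x z t, a (x, z, t) = a (x, z, 0)) →
      μeff * (∫ y in bulk ω h, dv y * d3 (fun y => a y * θ y.2.2) y)
        + μ / K * (∫ y in bulk ω h, v y * (a y * θ y.2.2)) =
      ∫ p in ω ×ˢ Zp, g p * a (p.1, p.2, 0) := by
    intro a ha ha0
    have hd : d3 (fun y => a y * θ y.2.2) = fun y => a y * _root_.deriv θ y.2.2 := by
      ext y
      have h1 : (fun t => a (y.1, y.2.1, t) * θ t) = fun t => a (y.1, y.2.1, 0) * θ t := by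
        ext t; rw [ha0]
      simp only [d3, h1]
      rw [deriv_const_mul _ (hθ.differentiable (by simp)).differentiableAt, ← ha0 y.1 y.2.1 y.2.2]
    rw [hd]
    have j1 := (ha.mul_vertical hθd).integrable_mul hω hh hdv1
    have j2 := (ha.mul_vertical hθ).integrable_mul hω hh hv1
    have j3 := ha.integrable_mul hω hh hG1
    rw [← integral_const_mul, ← integral_const_mul, ← integral_add (j1.const_mul _) (j2.const_mul _)]
    have e1 : ∫ y in bulk ω h, (μeff * (dv y * (a y * _root_.deriv θ y.2.2))
        + μ / K * (v y * (a y * θ y.2.2))) =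
        ∫ y in bulk ω h, (μeff * (dv y * _root_.deriv θ y.2.2) + μ / K * (v y * θ y.2.2)) * a y := by
      congr 1; ext y; ring
    rw [e1, integral_bulk hmeas hh.pos j3]
    refine integral_congr_ae (Eventually.of_forall fun p => ?_)
    simp only [hg]
    rw [← intervalIntegral.integral_mul_const]
    congr 1; ext t; rw [ha0 p.1 p.2 t]
  refine ⟨g, hgL, fun φ hφ ht hb => ?_, fun a ha ha0 => ?_⟩
  -- Splitting `φ` as `(φ - total φ · θ) + total φ · θ`: the first part has zero vertical integral,
  -- so pressure and right-hand side drop out, and the second part is covered by the definition of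
  -- `g`.
  · obtain ⟨B, -, hB⟩ := exists_vertical_support hh ht hb
    have hTt : IsTest ω fun y => total φ (y.1, y.2.1) := hφ.total hB
    have hm : IsTest ω fun y => total φ (y.1, y.2.1) * θ y.2.2 := hTt.mul_vertical hθ
    obtain ⟨hm1, hm2⟩ := IsTest.tensor_both (φ := φ) hδ (fun z => (hB0 z).1) hθ0 hθ1
      fun y => total φ (y.1, y.2.1)
    have hz : ∀ p, total (fun y => φ y - total φ (y.1, y.2.1) * θ y.2.2) p = 0 :=
      fun p => total_sub_bump hθi hθint hφ hB p
    have hψ : IsTest ω fun y => φ y - total φ (y.1, y.2.1) * θ y.2.2 := hφ.sub hm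
    have hψt : ZeroNearTop h fun y => φ y - total φ (y.1, y.2.1) * θ y.2.2 := ht.sub hm1
    have hψb : ZeroNearBottom fun y => φ y - total φ (y.1, y.2.1) * θ y.2.2 := hb.sub hm2
    have h1 := H.momentum _ hψ hψt hψb
    have hrI : IntegrableOn (fun p : E2 × E2 => r p.1) (ω ×ˢ Zp) := integrableOn_fst H.rhs
    rw [integral_base_mul_dz hω hh hψ hψt hψb hz j H.pressure,
      integral_base_mul_test hω hh (m := fun p => r p.1) hrI hψ] at h1
    simp only [interval_eq_total hψt hψb hh.pos, hz, mul_zero, integral_zero, sub_zero] at h1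
    have hd : d3 (fun y => φ y - total φ (y.1, y.2.1) * θ y.2.2) =
        fun y => d3 φ y - d3 (fun y => total φ (y.1, y.2.1) * θ y.2.2) y := by
      ext y
      exact ((hasDerivAt_d3' hφ.smooth y.1 y.2.1 y.2.2).sub
        (hasDerivAt_d3' hm.smooth y.1 y.2.1 y.2.2)).deriv
    rw [hd] at h1
    simp only [mul_sub] at h1
    rw [integral_sub (hφ.d3.integrable_mul hω hh hdv1) (hm.d3.integrable_mul hω hh hdv1),
      integral_sub (hφ.integrable_mul hω hh hv1) (hm.integrable_mul hω hh hv1)] at h1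
    have h2 := hprod (fun y => total φ (y.1, y.2.1)) hTt fun x z t => rfl
    rw [integral_base_mul_test hω hh hg1 hφ]
    simp only [interval_eq_total ht hb hh.pos]
    rw [← h2]
    linarith
  -- Testing the full equation with `a θ` and using `∫ θ = 1` gives the weak form of `g + ∂ϖ/∂z_j =
  -- r` on the base.
  · obtain ⟨hm1, hm2⟩ := IsTest.tensor_both (φ := a) hδ (fun z => (hB0 z).1) hθ0 hθ1 a
    have h1 := H.momentum _ (ha.mul_vertical hθ) hm1 hm2
    rw [hprod a ha ha0] at h1
    have hd : dz j (fun y => a y * θ y.2.2) = fun y => dz j a (y.1, y.2.1, 0) * θ y.2.2 := by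
      ext y
      simp only [dz, pd]
      simp only [ha0 y.1 _ y.2.2]
      rw [fderiv_mul_const (hasFDerivAt_dz ha.smooth y.1 y.2.1 0).differentiableAt]
      simp [mul_comm]
    have ht : ∀ {m : E2 × E2 → ℝ} {b : X → ℝ}, IntegrableOn m (ω ×ˢ Zp) → IsTest ω b →
        ∫ y in bulk ω h, m (y.1, y.2.1) * (b (y.1, y.2.1, 0) * θ y.2.2) =
          ∫ p in ω ×ˢ Zp, m p * b (p.1, p.2, 0) := by
      intro m b hm hb
      rw [integral_base_mul_test hω hh hm ((hb.freeze 0).mul_vertical hθ)]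
      simp only [intervalIntegral.integral_const_mul,
        interval_eq_integral_of_support hδ (hB0 _).1 (hh.pos _) hθ0 hθ1, hθint, mul_one]
    rw [hd, ht H.pressure (ha.dz j)] at h1
    rw [h1, ← ht (m := fun p => r p.1) (integrableOn_fst H.rhs) ha]
    congr 1; ext y; rw [← ha0]

end Momentum

/-! ### The vertical boundary value problem -/

section Velocity

variable {ω : Set E2} {h : E2 → ℝ}

/-- The vertical profile `A₁* e^{M z₃} + A₂* e^{-M z₃} + 1` of the velocity. -/
noncomputable def shape (M : ℝ) (h : E2 → ℝ) (z : E2) (t : ℝ) : ℝ :=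
  A1 M h z * Real.exp (M * t) + A2 M h z * Real.exp (-(M * t)) + 1

/-- With `w = v - (K/μ) g` the equation is `w'' = N² w`, so `w' + N w` satisfies `s' = N s` and `s
e^{-N z₃}` is constant in `z₃`. Both signs of `N` are admissible, which supplies two first integrals
and no second derivative has to be taken. -/
theorem exists_exp_combination (hω : IsOpen ω) (hωb : Bornology.IsBounded ω)
    (hh : IsProfile h) {μ μeff K : ℝ} (hμ : 0 < μ) (hμeff : 0 < μeff) (hK : 0 < K) {v dv : X → ℝ}
    {g : E2 × E2 → ℝ} (hv : IntegrableOn v (bulk ω h)) (hdv : IntegrableOn dv (bulk ω h))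
    (hg : IntegrableOn g (ω ×ˢ Zp)) (hD : IsWeakD3 ω h v dv)
    (H : ∀ φ, IsTest ω φ → ZeroNearTop h φ → ZeroNearBottom φ →
        μeff * (∫ y in bulk ω h, dv y * d3 φ y) + μ / K * (∫ y in bulk ω h, v y * φ y) =
          ∫ y in bulk ω h, g (y.1, y.2.1) * φ y) {N : ℝ} (hN : N ^ 2 = μ / (K * μeff)) :
    ∃ C : E2 × E2 → ℝ, ∀ᵐ y ∂volume.restrict (bulk ω h),
      (dv y + N * (v y - K / μ * g (y.1, y.2.1))) * Real.exp (-(N * y.2.2)) = C (y.1, y.2.1) := by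
  obtain ⟨H0, B, hH, hB⟩ := hh.exists_bounds
  have hmeas := hh.continuous.measurable
  have hgb : IntegrableOn (fun y : X => g (y.1, y.2.1)) (bulk ω h) :=
    integrableOn_base hmeas (fun z => (hB z).2) hg
  have hw : IntegrableOn (fun y => v y - K / μ * g (y.1, y.2.1)) (bulk ω h) :=
    hv.sub (hgb.const_mul _)
  have hs : IntegrableOn (fun y => dv y + N * (v y - K / μ * g (y.1, y.2.1))) (bulk ω h) :=
    hdv.add (hw.const_mul N)
  set χ : ℝ → ℝ := fun t => Real.exp (-(N * t)) with hχ
  have hχs : ContDiff ℝ ((⊤ : ℕ∞) : WithTop ℕ∞) χ := by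
    simp only [hχ]; fun_prop
  have hE : IntegrableOn (fun y => (dv y + N * (v y - K / μ * g (y.1, y.2.1))) * χ y.2.2)
      (bulk ω h) := by
    refine Integrable.mul_bdd (c := Real.exp (|N| * B)) hs
      (hχs.continuous.comp (by fun_prop : Continuous fun y : X => y.2.2)).aestronglyMeasurable ?_
    refine ae_restrict_of_forall_mem (measurableSet_bulk hω hh) fun y hy => ?_
    rw [Real.norm_eq_abs, Real.abs_exp, Real.exp_le_exp]
    have h1 : 0 ≤ y.2.2 := hy.2.2.1.le
    have h2 : y.2.2 ≤ B := hy.2.2.2.le.trans (hB _).2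
    calc -(N * y.2.2) ≤ |N| * y.2.2 := by nlinarith [neg_abs_le N]
      _ ≤ |N| * B := mul_le_mul_of_nonneg_left h2 (abs_nonneg _)
  refine exists_ae_eq_base_of_d3 hω hh hE fun φ hφ ht hb => ?_
  have hψ : IsTest ω fun y => φ y * χ y.2.2 := hφ.mul_vertical hχs
  have hψt : ZeroNearTop h fun y => φ y * χ y.2.2 := ht.mul_vertical χ
  have hψb : ZeroNearBottom fun y => φ y * χ y.2.2 := hb.mul_vertical χ
  set ψ : X → ℝ := fun y => φ y * χ y.2.2 with hψdef
  -- Moving the exponential weight into the test function leaves only pairings that the weak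
  -- equations know: `v` and `dv` against `ψ` and its `z₃`-derivative.
  have hd : ∀ y, χ y.2.2 * d3 φ y = d3 ψ y + N * ψ y := by
    intro y
    have h1 : HasDerivAt χ (χ y.2.2 * (-(N * 1))) y.2.2 :=
      (((hasDerivAt_id y.2.2).const_mul N).neg).exp
    have h2 := ((hasDerivAt_d3' hφ.smooth y.1 y.2.1 y.2.2).mul h1).deriv
    have h3 : d3 ψ y = d3 φ y * χ y.2.2 + φ y * (χ y.2.2 * (-(N * 1))) := h2
    rw [h3, hψdef]; ring
  have e1 : ∫ y in bulk ω h, (dv y + N * (v y - K / μ * g (y.1, y.2.1))) * χ y.2.2 * d3 φ y =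
      ∫ y in bulk ω h, (((dv y * d3 ψ y + N * (v y * d3 ψ y)) + N * (dv y * ψ y))
        + N ^ 2 * (v y * ψ y)) -
        (N * (K / μ) * (g (y.1, y.2.1) * d3 ψ y) + N ^ 2 * (K / μ) * (g (y.1, y.2.1) * ψ y)) := by
    congr 1; ext y
    rw [mul_assoc, hd y]; ring
  have i1 := hψ.d3.integrable_mul hω hh hdv
  have i2 := (hψ.d3.integrable_mul hω hh hv).const_mul N
  have i3 := (hψ.integrable_mul hω hh hdv).const_mul N
  have i4 := (hψ.integrable_mul hω hh hv).const_mul (N ^ 2)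
  have i5 := (hψ.d3.integrable_mul hω hh hgb).const_mul (N * (K / μ))
  have i6 := (hψ.integrable_mul hω hh hgb).const_mul (N ^ 2 * (K / μ))
  have i12 : Integrable (fun y => dv y * d3 ψ y + N * (v y * d3 ψ y))
    (volume.restrict (bulk ω h)) := i1.add i2
  have i123 : Integrable (fun y => dv y * d3 ψ y + N * (v y * d3 ψ y) + N * (dv y * ψ y))
    (volume.restrict (bulk ω h)) := i12.add i3
  have hg0 : ∫ y in bulk ω h, g (y.1, y.2.1) * d3 ψ y = 0 := by
    rw [integral_base_mul_test hω hh hg hψ.d3]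
    obtain ⟨δ, hδ, h0⟩ := hψt
    obtain ⟨ε, hε, h1⟩ := hψb
    have : ∀ p : E2 × E2, ∫ t in (0 : ℝ)..h p.2, d3 ψ (p.1, p.2, t) = 0 := by
      intro p
      rw [intervalIntegral.integral_eq_sub_of_hasDerivAt
        (fun t _ => hasDerivAt_d3' hψ.smooth p.1 p.2 t)
        ((continuous_vertical hψ.d3.smooth p.1 p.2).intervalIntegrable _ _),
        h0 p.1 p.2 (h p.2) (by linarith), h1 p.1 p.2 0 hε.le, sub_zero]
    simp [this]
  have hgr : ∫ y in bulk ω h, v y * d3 ψ y = -∫ y in bulk ω h, dv y * ψ y := hD ψ hψ hψt hψb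
  have hmom := H ψ hψ hψt hψb
  have i1234 : Integrable (fun y => dv y * d3 ψ y + N * (v y * d3 ψ y) + N * (dv y * ψ y)
    + N ^ 2 * (v y * ψ y)) (volume.restrict (bulk ω h)) := i123.add i4
  have i56 : Integrable (fun y => N * (K / μ) * (g (y.1, y.2.1) * d3 ψ y)
    + N ^ 2 * (K / μ) * (g (y.1, y.2.1) * ψ y)) (volume.restrict (bulk ω h)) := i5.add i6
  rw [e1, integral_sub i1234 i56, integral_add i123 i4, integral_add i12 i3,
    integral_add i1 i2, integral_add i5 i6]
  simp only [integral_const_mul]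
  rw [hg0, hgr, hN]
  have h1 : μ / (K * μeff) * (K / μ) = 1 / μeff := by field_simp
  rw [h1]
  have h2 : ∫ y in bulk ω h, dv y * d3 ψ y = 1 / μeff * (∫ y in bulk ω h, g (y.1, y.2.1) * ψ y)
      - μ / (K * μeff) * ∫ y in bulk ω h, v y * ψ y := by
    have h3 : μ / (K * μeff) = 1 / μeff * (μ / K) := by rw [div_mul_div_comm, one_mul, mul_comm K]
    have h4 : 1 / μeff * μeff = 1 := one_div_mul_cancel hμeff.ne'
    rw [← hmom, h3]
    linear_combination (-∫ y in bulk ω h, dv y * d3 ψ y) * h4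
  rw [h2]; ring

theorem integral_exp_combination {M a b s t : ℝ} (hM : M ≠ 0) :
    ∫ τ in s..t, (a * Real.exp (M * τ) + b * Real.exp (-(M * τ))) =
      (a * Real.exp (M * t) - b * Real.exp (-(M * t))) / M -
        (a * Real.exp (M * s) - b * Real.exp (-(M * s))) / M := by
  refine intervalIntegral.integral_eq_sub_of_hasDerivAt
    (f := fun τ => (a * Real.exp (M * τ) - b * Real.exp (-(M * τ))) / M) (fun τ _ => ?_)
    (Continuous.intervalIntegrable (by fun_prop) _ _)
  have h1 : HasDerivAt (fun τ => Real.exp (M * τ)) (Real.exp (M * τ) * (M * 1)) τ :=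
    ((hasDerivAt_id τ).const_mul M).exp
  have h2 : HasDerivAt (fun τ => Real.exp (-(M * τ))) (Real.exp (-(M * τ)) * (-(M * 1))) τ :=
    (((hasDerivAt_id τ).const_mul M).neg).exp
  have h3 := ((h1.const_mul a).sub (h2.const_mul b)).div_const M
  have h4 : (a * (Real.exp (M * τ) * (M * 1)) - b * (Real.exp (-(M * τ)) * -(M * 1))) / M =
      a * Real.exp (M * τ) + b * Real.exp (-(M * τ)) := by field_simp; ring
  rw [h4] at h3
  exact h3

theorem exp_sub_exp_neg_pos {s : ℝ} (hs : 0 < s) : 0 < Real.exp s - Real.exp (-s) := by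
  rw [sub_pos, Real.exp_lt_exp]; linarith

/-- The boundary values determine the coefficients of the vertical profile. -/
theorem slice_coefficients {M w C₁ C₂ : ℝ} (hM : 0 < M) (z : E2) (hpos : 0 < h z) {v dv : ℝ → ℝ}
    (h1 : ∀ᵐ t ∂volume.restrict (Ioo 0 (h z)),
      (dv t + M * (v t - w)) * Real.exp (-(M * t)) = C₁)
    (h2 : ∀ᵐ t ∂volume.restrict (Ioo 0 (h z)),
      (dv t + -M * (v t - w)) * Real.exp (-(-M * t)) = C₂)
    (h3 : ∀ᵐ t ∂volume.restrict (Ioo 0 (h z)), v t = ∫ s in (0 : ℝ)..t, dv s)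
    (h4 : ∀ᵐ t ∂volume.restrict (Ioo 0 (h z)), v t = -∫ s in t..h z, dv s) :
    C₁ = 2 * M * w * A1 M h z ∧ C₂ = -(2 * M * w * A2 M h z) := by
  -- Half the sum of the two first integrals isolates `dv`. Their difference isolates `v - w`, which
  -- is used below.
  have hdv : ∀ᵐ t ∂volume.restrict (Ioo 0 (h z)),
      dv t = C₁ / 2 * Real.exp (M * t) + C₂ / 2 * Real.exp (-(M * t)) := by
    filter_upwards [h1, h2] with t e1 e2
    have hx : Real.exp (-(M * t)) * Real.exp (M * t) = 1 := by rw [← Real.exp_add]; simp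
    rw [← e1, ← e2, show -(-M * t) = M * t by ring]
    linear_combination (-dv t) * hx
  have hdv' : ∀ᵐ t, t ∈ Ioo 0 (h z) →
      dv t = C₁ / 2 * Real.exp (M * t) + C₂ / 2 * Real.exp (-(M * t)) := by
    rwa [ae_restrict_iff' measurableSet_Ioo] at hdv
  have hint : ∀ s t, 0 ≤ s → s ≤ t → t ≤ h z → ∫ τ in s..t, dv τ =
      (C₁ / 2 * Real.exp (M * t) - C₂ / 2 * Real.exp (-(M * t))) / M -
        (C₁ / 2 * Real.exp (M * s) - C₂ / 2 * Real.exp (-(M * s))) / M := by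
    intro s t hs hst ht
    rw [← integral_exp_combination hM.ne']
    refine intervalIntegral.integral_congr_ae ?_
    filter_upwards [hdv', Measure.ae_ne volume (h z)] with τ hτ hne hm
    rw [uIoc_of_le hst] at hm
    exact hτ ⟨hs.trans_lt hm.1, lt_of_le_of_ne (hm.2.trans ht) hne⟩
  have hw : ∀ᵐ t ∂volume.restrict (Ioo 0 (h z)),
      v t = w + (C₁ / 2 * Real.exp (M * t) - C₂ / 2 * Real.exp (-(M * t))) / M := by
    filter_upwards [h1, h2] with t e1 e2
    have hx : Real.exp (-(M * t)) * Real.exp (M * t) = 1 := by rw [← Real.exp_add]; simp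
    rw [← e1, ← e2, show -(-M * t) = M * t by ring]
    field_simp
    linear_combination (-2 * M * (v t - w)) * hx
  -- A single height at which all almost-everywhere identities hold suffices: comparison with the
  -- integral of `dv` from the bottom gives the condition at `0`, and comparison with the integral
  -- to the top gives the one at `h`.
  obtain ⟨hc1, hc2⟩ : C₁ - C₂ = -(2 * M * w) ∧
      C₁ * Real.exp (M * h z) - C₂ * Real.exp (-(M * h z)) = -(2 * M * w) := by
    have hne : (ae (volume.restrict (Ioo 0 (h z)))).NeBot := by
      rw [ae_neBot, Ne, Measure.restrict_eq_zero, Real.volume_Ioo]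
      simpa using hpos
    obtain ⟨t, ⟨⟨e1, e2⟩, e3⟩, e4⟩ :=
      (((hw.and h3).and h4).and (ae_restrict_mem measurableSet_Ioo)).exists
    rw [hint 0 t le_rfl e4.1.le e4.2.le] at e2
    rw [hint t (h z) e4.1.le e4.2.le le_rfl] at e3
    simp only [mul_zero, neg_zero, Real.exp_zero, mul_one] at e2
    rw [e1] at e2 e3
    field_simp at e2 e3
    constructor <;> linarith
  have hD := exp_sub_exp_neg_pos (mul_pos hM hpos)
  constructor
  · rw [A1]; field_simp
    linear_combination hc2 - Real.exp (-(M * h z)) * hc1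
  · rw [A2]; field_simp
    linear_combination hc2 - Real.exp (M * h z) * hc1

theorem velocity_eq_of_coefficients {M w v dv t : ℝ} (hM : 0 < M) (z : E2)
    (h1 : (dv + M * (v - w)) * Real.exp (-(M * t)) = 2 * M * w * A1 M h z)
    (h2 : (dv + -M * (v - w)) * Real.exp (-(-M * t)) = -(2 * M * w * A2 M h z)) :
    v = w * shape M h z t := by
  have hx : Real.exp (-(M * t)) * Real.exp (M * t) = 1 := by rw [← Real.exp_add]; simp
  rw [show -(-M * t) = M * t by ring] at h2
  have h3 : 2 * M * (v - w * shape M h z t) = 0 := by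
    rw [shape]
    linear_combination Real.exp (M * t) * h1 - Real.exp (-(M * t)) * h2
      + (-(dv + M * (v - w)) + (dv - M * (v - w))) * hx
  have := (mul_eq_zero.1 h3).resolve_left (by positivity)
  linarith

/-- This is where the coefficient of the cell problem comes from: it is minus the mobility of a
vertical column. -/
theorem integral_shape {M : ℝ} (hM : 0 < M) (z : E2) (hpos : 0 < h z) :
    ∫ t in (0 : ℝ)..h z, shape M h z t = -cellCoeff M h z := by
  have hD := exp_sub_exp_neg_pos (mul_pos hM hpos)
  have h1 : ∫ t in (0 : ℝ)..h z, shape M h z t =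
      (∫ t in (0 : ℝ)..h z, (A1 M h z * Real.exp (M * t) + A2 M h z * Real.exp (-(M * t)))) +
        ∫ t in (0 : ℝ)..h z, (1 : ℝ) := by
    rw [← intervalIntegral.integral_add
      (Continuous.intervalIntegrable (by fun_prop) _ _) (by simp)]
    rfl
  rw [h1, integral_exp_combination hM.ne']
  simp only [A1, A2, cellCoeff, mul_zero, neg_zero, Real.exp_zero, mul_one,
    intervalIntegral.integral_const, smul_eq_mul, sub_zero]
  have hx : Real.exp (-(M * h z)) * Real.exp (M * h z) = 1 := by rw [← Real.exp_add]; simp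
  field_simp
  linear_combination 2 * hx

theorem IsMomentumComponent.exists_velocity (hω : IsOpen ω) (hωb : Bornology.IsBounded ω)
    (hh : IsProfile h) {μ μeff K M : ℝ} (hμ : 0 < μ) (hμeff : 0 < μeff) (hK : 0 < K)
    (hM : M = Real.sqrt (μ / (K * μeff))) {j : Fin 2} {v dv : X → ℝ} {r : E2 → ℝ} {ϖ : E2 × E2 → ℝ}
    (H : IsMomentumComponent ω h μ μeff K j v dv r ϖ) :
    ∃ g : E2 × E2 → ℝ, MemLp g 2 (volume.restrict (ω ×ˢ Zp)) ∧
      (∀ᵐ y ∂volume.restrict (bulk ω h), v y = K / μ * g (y.1, y.2.1) * shape M h y.2.1 y.2.2) ∧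
      ∀ a, IsTest ω a → (∀ x z t, a (x, z, t) = a (x, z, 0)) →
        (∫ p in ω ×ˢ Zp, g p * a (p.1, p.2, 0)) - (∫ p in ω ×ˢ Zp, ϖ p * dz j a (p.1, p.2, 0)) =
          ∫ p in ω ×ˢ Zp, r p.1 * a (p.1, p.2, 0) := by
  obtain ⟨g, hg, hgm, hga⟩ := H.exists_forcing hω hωb hh
  have := isFiniteMeasure_bulk hωb hh
  have hmeas := hh.continuous.measurable
  have hfin : IsFiniteMeasure (volume.restrict (ω ×ˢ Zp)) :=
    ⟨by rw [Measure.restrict_apply_univ]; exact (hωb.prod isBounded_Zp).measure_lt_top⟩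
  have hv1 : IntegrableOn v (bulk ω h) := H.memLp.integrable one_le_two
  have hdv1 : IntegrableOn dv (bulk ω h) := H.memLp_deriv.integrable one_le_two
  have hg1 : IntegrableOn g (ω ×ˢ Zp) := hg.integrable one_le_two
  have hMpos : 0 < M := by rw [hM]; positivity
  have hM2 : M ^ 2 = μ / (K * μeff) := by rw [hM]; exact Real.sq_sqrt (by positivity)
  obtain ⟨C₁, hC₁⟩ := exists_exp_combination hω hωb hh hμ hμeff hK hv1 hdv1 hg1 H.deriv hgm hM2
  obtain ⟨C₂, hC₂⟩ := exists_exp_combination hω hωb hh hμ hμeff hK hv1 hdv1 hg1 H.deriv hgm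
    (N := -M) (by rw [neg_sq, hM2])
  have hbot := ae_eq_primitive hω hh hv1 hdv1 H.bottom
  have htop := ae_eq_tail hω hh hv1 hdv1 H.top
  have hs : ∀ᵐ p ∂volume.restrict (ω ×ˢ Zp), C₁ p = 2 * M * (K / μ * g p) * A1 M h p.2 ∧
      C₂ p = -(2 * M * (K / μ * g p) * A2 M h p.2) := by
    filter_upwards [ae_slice_bulk hmeas hC₁, ae_slice_bulk hmeas hC₂, ae_slice_bulk hmeas hbot,
      ae_slice_bulk hmeas htop] with p e1 e2 e3 e4
    exact slice_coefficients (v := fun t => v (p.1, p.2, t)) (dv := fun t => dv (p.1, p.2, t))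
      hMpos p.2 (hh.pos _) e1 e2 e3 e4
  refine ⟨g, hg, ?_, hga⟩
  filter_upwards [hC₁, hC₂, ae_base_bulk hmeas hs] with y e1 e2 e3
  rw [e3.1] at e1
  rw [e3.2] at e2
  exact velocity_eq_of_coefficients hMpos _ e1 e2

end Velocity

/-! ### Fourier coefficients on the cell -/

section Fourier

attribute [local instance] instMeasureSpaceUnitAddCircle

/-- The phase `2π k · z`. -/
noncomputable def phase (k : Fin 2 → ℤ) (z : E2) : ℝ := 2 * Real.pi * ∑ i, (k i : ℝ) * z i

/-- The section of `ℝ² → ℝ²/ℤ²` with values in the cell. -/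
noncomputable def torusSection (x : UnitAddTorus (Fin 2)) : E2 :=
  WithLp.toLp 2 fun i => (UnitAddTorus.measurableEquivPiIoc (fun _ => -(1 / 2 : ℝ)) x).1 i

/-- The torus is parametrized by a half-open cube and the cell is open. Both agree with the closed
cube up to a null set. -/
theorem Zp_ae_eq :
    (WithLp.toLp 2 ⁻¹' Zp : Set (Fin 2 → ℝ)) =ᵐ[volume]
      {x : Fin 2 → ℝ | ∀ i, x i ∈ Ioc (-(1 / 2 : ℝ)) (-(1 / 2) + 1)} := by
  have h1 : (WithLp.toLp 2 ⁻¹' Zp : Set (Fin 2 → ℝ)) =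
      Set.pi univ fun _ => Ioo (-(1 / 2 : ℝ)) (-(1 / 2) + 1) := by
    ext x; norm_num [Zp, Set.mem_pi]
  have h2 : {x : Fin 2 → ℝ | ∀ i, x i ∈ Ioc (-(1 / 2 : ℝ)) (-(1 / 2) + 1)} =
      Set.pi univ fun _ => Ioc (-(1 / 2 : ℝ)) (-(1 / 2) + 1) := by
    ext x; simp [Set.mem_pi]
  rw [h1, h2]
  exact Measure.univ_pi_Ioo_ae_eq_Icc.trans Measure.univ_pi_Ioc_ae_eq_Icc.symm

theorem measurePreserving_torusSection :
    MeasurePreserving torusSection volume (volume.restrict Zp) := by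
  have h1 := UnitAddTorus.measurePreserving_equivPiIoc (fun _ : Fin 2 => -(1 / 2 : ℝ))
  have hm : MeasurableSet {x : Fin 2 → ℝ | ∀ i, x i ∈ Ioc (-(1 / 2 : ℝ)) (-(1 / 2) + 1)} :=
    MeasurableSet.univ_pi' fun _ => measurableSet_Ioc
  have h2 := (measurePreserving_subtype_coe (μa := (volume : Measure (Fin 2 → ℝ))) hm).comp h1
  have h3 := (PiLp.volume_preserving_toLp (Fin 2)).restrict_preimage measurableSet_Zp
  rw [Measure.restrict_congr_set Zp_ae_eq] at h3
  exact h3.comp h2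

theorem mFourier_torusSection (k : Fin 2 → ℤ) (x : UnitAddTorus (Fin 2)) :
    UnitAddTorus.mFourier (-k) x =
      Real.cos (phase k (torusSection x)) - Complex.I * Real.sin (phase k (torusSection x)) := by
  have h1 : ∀ i, ((torusSection x i : ℝ) : UnitAddCircle) = x i := fun i => AddCircle.coe_equivIoc
  have h2 : ∀ i, fourier ((-k) i) (x i) =
      Complex.exp (-(2 * Real.pi * Complex.I * (k i) * (torusSection x i))) := by
    intro i
    rw [← h1 i, fourier_coe_apply]
    congr 1
    push_cast [Pi.neg_apply]
    ring
  have h3 : UnitAddTorus.mFourier (-k) x = ∏ i, fourier ((-k) i) (x i) := rfl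
  rw [h3]
  simp only [h2]
  rw [← Complex.exp_sum]
  have h4 : ∑ i, -(2 * Real.pi * Complex.I * (k i) * (torusSection x i : ℂ)) =
      ((-phase k (torusSection x) : ℝ) : ℂ) * Complex.I := by
    simp only [phase, Fin.sum_univ_two]
    push_cast
    ring
  rw [h4, Complex.exp_mul_I, ← Complex.ofReal_cos, ← Complex.ofReal_sin, Real.cos_neg, Real.sin_neg]
  push_cast
  ring

/-- The cosine coefficient of a function on the cell. -/
noncomputable def cosCoeff (F : E2 → ℝ) (k : Fin 2 → ℤ) : ℝ := ∫ z in Zp, F z * Real.cos (phase k z)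

/-- The sine coefficient of a function on the cell. -/
noncomputable def sinCoeff (F : E2 → ℝ) (k : Fin 2 → ℤ) : ℝ := ∫ z in Zp, F z * Real.sin (phase k z)

theorem continuous_phase (k : Fin 2 → ℤ) : Continuous (phase k) := by
  unfold phase; fun_prop

theorem integrable_mul_cos {F : E2 → ℝ} (hF : IntegrableOn F Zp) (k : Fin 2 → ℤ) :
    IntegrableOn (fun z => F z * Real.cos (phase k z)) Zp :=
  Integrable.mul_bdd (c := 1) hF
    (Real.continuous_cos.comp (continuous_phase k)).aestronglyMeasurable
    (Eventually.of_forall fun z => Real.abs_cos_le_one _)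

theorem integrable_mul_sin {F : E2 → ℝ} (hF : IntegrableOn F Zp) (k : Fin 2 → ℤ) :
    IntegrableOn (fun z => F z * Real.sin (phase k z)) Zp :=
  Integrable.mul_bdd (c := 1) hF
    (Real.continuous_sin.comp (continuous_phase k)).aestronglyMeasurable
    (Eventually.of_forall fun z => Real.abs_sin_le_one _)

theorem integral_torusSection {E : Type*} [NormedAddCommGroup E] [NormedSpace ℝ E] {f : E2 → E}
    (hf : AEStronglyMeasurable f (volume.restrict Zp)) :
    ∫ x, f (torusSection x) = ∫ z in Zp, f z := by
  have h1 := measurePreserving_torusSection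
  rw [← h1.map_eq] at hf ⊢
  exact (integral_map h1.measurable.aemeasurable hf).symm

theorem memLp_torus {F : E2 → ℝ} (hF : MemLp F 2 (volume.restrict Zp)) :
    MemLp (fun x => (F (torusSection x) : ℂ)) 2 volume :=
  (hF.comp_measurePreserving measurePreserving_torusSection).ofReal

/-- For real functions the complex coefficient is encoded by its real cosine and sine parts.
Parseval's identity on the torus can then be read off by taking real parts. -/
theorem mFourierCoeff_torus {F : E2 → ℝ} (hF : MemLp F 2 (volume.restrict Zp)) (k : Fin 2 → ℤ) :
    UnitAddTorus.mFourierCoeff ((memLp_torus hF).toLp _) k =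
      cosCoeff F k - Complex.I * sinCoeff F k := by
  have hF1 : IntegrableOn F Zp := hF.integrable one_le_two
  have h1 : UnitAddTorus.mFourierCoeff ((memLp_torus hF).toLp _) k =
      ∫ x, (fun z : E2 => (((F z * Real.cos (phase k z) : ℝ) : ℂ)
        - Complex.I * ((F z * Real.sin (phase k z) : ℝ) : ℂ))) (torusSection x) := by
    rw [UnitAddTorus.mFourierCoeff]
    refine integral_congr_ae ?_
    filter_upwards [(memLp_torus hF).coeFn_toLp] with x hx
    rw [hx, mFourier_torusSection, smul_eq_mul]
    push_cast
    ring
  have i1 := (integrable_mul_cos hF1 k).ofReal (𝕜 := ℂ)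
  have i2 := ((integrable_mul_sin hF1 k).ofReal (𝕜 := ℂ)).const_mul Complex.I
  have hm : AEStronglyMeasurable (fun z : E2 => (((F z * Real.cos (phase k z) : ℝ) : ℂ)
        - Complex.I * ((F z * Real.sin (phase k z) : ℝ) : ℂ))) (volume.restrict Zp) := (i1.sub i2).1
  rw [h1, integral_torusSection hm, cosCoeff, sinCoeff, ← integral_complex_ofReal,
    ← integral_complex_ofReal, ← integral_const_mul]
  exact integral_sub i1 i2

/-- **Parseval's identity** for real functions on the cell. -/
theorem hasSum_parseval {F G : E2 → ℝ} (hF : MemLp F 2 (volume.restrict Zp))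
    (hG : MemLp G 2 (volume.restrict Zp)) :
    HasSum (fun k => cosCoeff F k * cosCoeff G k + sinCoeff F k * sinCoeff G k)
      (∫ z in Zp, F z * G z) := by
  have h1 := RCLike.hasSum_re ℂ (UnitAddTorus.hasSum_prod_mFourierCoeff
    ((memLp_torus hF).toLp _) ((memLp_torus hG).toLp _))
  simp only [mFourierCoeff_torus hF, mFourierCoeff_torus hG] at h1
  have h2 : ∫ t, (starRingEnd ℂ) ((memLp_torus hF).toLp _ t) * ((memLp_torus hG).toLp _ t) =
      ((∫ z in Zp, F z * G z : ℝ) : ℂ) := by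
    rw [← integral_torusSection (f := fun z => F z * G z) (hF.1.mul hG.1), ← integral_complex_ofReal]
    refine integral_congr_ae ?_
    filter_upwards [(memLp_torus hF).coeFn_toLp, (memLp_torus hG).coeFn_toLp] with x hx hy
    rw [hx, hy]
    simp
  rw [h2] at h1
  convert h1 using 1
  · ext k
    simp [Complex.mul_re]
  · exact (Complex.ofReal_re _).symm

end Fourier

/-! ### Periodic functions on the plane and on the cell -/

section Unfold

/-- The half-open cell contains the open one and both have measure one. The half-open cells
partition the plane exactly, which the open ones do not. -/
theorem volume_cell_zero : {z : E2 | cellIdx z = 0} =ᵐ[volume] Zp := by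
  have hD : {z : E2 | cellIdx z = 0} = {z : E2 | ∀ i, -(1 / 2 : ℝ) ≤ z i ∧ z i < 1 / 2} := by
    ext z
    simp only [mem_ofPred_eq, funext_iff, cellIdx, Pi.zero_apply, Int.floor_eq_zero_iff, mem_Ico]
    refine forall_congr' fun i => ?_
    constructor <;> rintro ⟨h1, h2⟩ <;> constructor <;> linarith
  have hv : volume {z : E2 | ∀ i, -(1 / 2 : ℝ) ≤ z i ∧ z i < 1 / 2} = 1 := by
    have := (EuclideanSpace.volume_preserving_symm_measurableEquiv_toLp
      (Fin 2)).measure_preimage_equiv (Set.pi univ fun _ => Ico (-(1 / 2 : ℝ)) (1 / 2))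
    rw [Real.volume_pi_Ico] at this
    convert this using 1
    · congr 1; ext z; simp [Set.mem_pi]
    · norm_num
  rw [hD]
  refine (ae_eq_of_subset_of_measure_ge ?_ ?_ measurableSet_Zp.nullMeasurableSet ?_).symm
  · exact fun z hz i => ⟨(hz i).1.le, (hz i).2⟩
  · rw [hv, volume_Zp]
  · rw [hv]; exact ENNReal.one_ne_top

theorem measurableSet_cellIdx (k : Fin 2 → ℤ) : MeasurableSet {z : E2 | cellIdx z = k} := by
  have : {z : E2 | cellIdx z = k} = ⋂ i, {z : E2 | ⌊z i + 1 / 2⌋ = k i} := by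
    ext z; simp [cellIdx, funext_iff]
  rw [this]
  refine MeasurableSet.iInter fun i => ?_
  have h1 : Measurable fun z : E2 => ⌊z i + 1 / 2⌋ :=
    Int.measurable_floor.comp ((by fun_prop : Measurable fun z : E2 => z i).add_const _)
  exact h1 (measurableSet_singleton (k i))

theorem cellIdx_add_lat (z : E2) (k : Fin 2 → ℤ) : cellIdx (z + lat k) = cellIdx z + k := by
  funext i
  simp only [cellIdx, PiLp.add_apply, lat_apply, Pi.add_apply]
  rw [show z i + (k i : ℝ) + 1 / 2 = z i + 1 / 2 + (k i : ℝ) by ring, Int.floor_add_intCast]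

theorem lat_neg (k : Fin 2 → ℤ) : lat (-k) = -lat k := by ext i; simp

theorem cellIdx_mem_box {R : ℝ} {z : E2} (hz : ‖z‖ ≤ R) : cellIdx z ∈ box (R + 1) := by
  refine mem_box_of_norm_le ?_
  have h1 : lat (cellIdx z) = z - cellRep z := by
    rw [cellRep, lat_neg]; abel
  rw [h1]
  exact (norm_sub_le _ _).trans (add_le_add hz (cellRep_norm_le z))

/-- Unfolding the integral over the plane of a periodic function times a compactly supported one. -/
theorem integral_unfold {F φ : E2 → ℝ} (hF : Periodic F) (hFi : IntegrableOn F Zp)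
    (hφ : Continuous φ) {R : ℝ} (hR : ∀ z, R < ‖z‖ → φ z = 0) :
    Integrable (fun z => F z * φ z) ∧
      ∫ z, F z * φ z = ∫ z in Zp, F z * periodize φ z := by
  have hφb : ∃ c, ∀ z, ‖φ z‖ ≤ c := by
    have hc : HasCompactSupport φ := HasCompactSupport.intro (isCompact_closedBall (0 : E2) R)
      fun z hz => hR z (by simpa using hz)
    exact hc.exists_bound_of_continuous hφ
  obtain ⟨c, hc⟩ := hφb
  set D : (Fin 2 → ℤ) → Set E2 := fun k => {z | cellIdx z = k} with hD
  set G : (Fin 2 → ℤ) → E2 → ℝ := fun k => (D 0).indicator fun z => F z * φ (z + lat k) with hG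
  have hGZ : ∀ k, IntegrableOn (fun z => F z * φ (z + lat k)) Zp := fun k =>
    Integrable.mul_bdd (c := c) hFi (by fun_prop : Continuous fun z => φ (z + lat k)).aestronglyMeasurable
      (Eventually.of_forall fun z => hc _)
  have hGi : ∀ k, Integrable (G k) := fun k => by
    rw [hG, integrable_indicator_iff (measurableSet_cellIdx 0), IntegrableOn,
      Measure.restrict_congr_set volume_cell_zero]
    exact hGZ k
  have hGint : ∀ k, ∫ z, G k z = ∫ z in Zp, F z * φ (z + lat k) := fun k => by
    rw [hG, integral_indicator (measurableSet_cellIdx 0),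
      Measure.restrict_congr_set volume_cell_zero]
  -- Each point lies in exactly one translate of the half-open cell, and translates outside the box
  -- do not meet the region where `φ` can be nonzero. The sum is finite, so no interchange with a
  -- limit is needed.
  have hsum : ∀ z, F z * φ z = ∑ k ∈ box (R + 1), G k (z + lat (-k)) := by
    intro z
    have h1 : ∀ k, G k (z + lat (-k)) = if cellIdx z = k then F z * φ z else 0 := by
      intro k
      simp only [hG, indicator, hD, mem_ofPred_eq, cellIdx_add_lat, hF.add_lat]
      rw [show z + lat (-k) + lat k = z by rw [lat_neg]; abel, ← sub_eq_add_neg]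
      simp only [sub_eq_zero]
    simp only [h1, Finset.sum_ite_eq]
    split_ifs with h
    · rfl
    · rw [hR z, mul_zero]
      by_contra! hle
      exact h (cellIdx_mem_box hle)
  have hi : ∀ k ∈ box (R + 1), Integrable fun z => G k (z + lat (-k)) := fun k _ =>
    (hGi k).comp_add_right _
  constructor
  · simp only [hsum]
    exact integrable_finsetSum _ hi
  · simp only [hsum]
    rw [integral_finsetSum _ hi]
    simp only [integral_add_right_eq_self (G _), hGint]
    rw [← integral_finsetSum _ fun k _ => hGZ k]
    refine setIntegral_congr_fun measurableSet_Zp fun z hz => ?_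
    rw [periodize_eq_sum (N := 1) hR (norm_le_of_coord fun i => abs_le.2 ⟨(hz i).1.le, (hz i).2.le⟩),
      Finset.mul_sum]

theorem contDiff_periodize' {g : E2 → ℝ} (hg : ContDiff ℝ ((⊤ : ℕ∞) : WithTop ℕ∞) g) {R : ℝ}
    (hR : ∀ z, R < ‖z‖ → g z = 0) : ContDiff ℝ ((⊤ : ℕ∞) : WithTop ℕ∞) (periodize g) := by
  have h1 := contDiff_periodize (W := ℝ) (g := fun _ => g) (hg.comp contDiff_snd) fun _ => hR
  exact h1.comp ((contDiff_const (c := (0 : ℝ))).prodMk contDiff_id)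

theorem pd_periodize {g : E2 → ℝ} (hg : ContDiff ℝ ((⊤ : ℕ∞) : WithTop ℕ∞) g) {R : ℝ}
    (hR : ∀ z, R < ‖z‖ → g z = 0) (j : Fin 2) (z : E2) :
    pd j (periodize g) z = periodize (pd j g) z := by
  have hR' : ∀ z, R < ‖z‖ → pd j g z = 0 := by
    intro z hz
    have : g =ᶠ[nhds z] fun _ => 0 := by
      filter_upwards [(isOpen_lt continuous_const continuous_norm).mem_nhds hz] with w hw using hR w hw
    rw [pd, this.fderiv_eq]; simp
  have h1 : periodize g =ᶠ[nhds z] fun w => ∑ k ∈ box (R + (‖z‖ + 1)), g (w + lat k) := by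
    filter_upwards [(isOpen_lt continuous_norm continuous_const).mem_nhds
      (by simp : z ∈ {w : E2 | ‖w‖ < ‖z‖ + 1})] with w hw
    exact periodize_eq_sum hR (le_of_lt hw)
  have hd : ∀ w, DifferentiableAt ℝ g w := fun w => hg.differentiable (by simp) w
  rw [pd, h1.fderiv_eq, periodize_eq_sum (N := ‖z‖ + 1) hR' (by linarith), fderiv_fun_sum]
  · simp only [sum_apply, fderiv_comp_add_right, pd]
  · intro k _
    exact (hd _).comp z (differentiableAt_id.add_const _)

/-- A smooth partition of unity subordinate to the lattice translates. -/
theorem exists_partition : ∃ w : E2 → ℝ, ContDiff ℝ ((⊤ : ℕ∞) : WithTop ℕ∞) w ∧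
    (∀ z, 2 < ‖z‖ → w z = 0) ∧ ∀ z, periodize w z = 1 := by
  let b : ContDiffBump (0 : E2) := ⟨1, 2, one_pos, one_lt_two⟩
  have hb0 : ∀ z : E2, 2 < ‖z‖ → b z = 0 := fun z hz => b.zero_of_le_dist (by simpa using hz.le)
  have hP : ContDiff ℝ ((⊤ : ℕ∞) : WithTop ℕ∞) (periodize b) := contDiff_periodize' b.contDiff hb0
  -- The representative of `z` in the cell lies in the unit ball, where the bump equals one, so the
  -- term with zero lattice vector is already positive.
  have hpos : ∀ z, 0 < periodize b z := by
    intro z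
    rw [← (periodic_periodize b).cellRep z, periodize_eq_sum hb0 (cellRep_norm_le z)]
    refine Finset.sum_pos' (fun k _ => b.nonneg) ⟨0, mem_box_of_norm_le ?_, ?_⟩
    · rw [lat_zero, norm_zero]; norm_num
    · rw [lat_zero, add_zero, b.one_of_mem_closedBall (by simpa using cellRep_norm_le z)]
      exact one_pos
  refine ⟨fun z => b z / periodize b z, b.contDiff.div hP fun z => (hpos z).ne', ?_, ?_⟩
  · intro z hz
    simp only [hb0 z hz, zero_div]
  · intro z
    have hw0 : ∀ z : E2, 2 < ‖z‖ → b z / periodize b z = 0 := fun z hz => by rw [hb0 z hz, zero_div]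
    rw [periodize_eq_sum (N := ‖z‖) hw0 le_rfl]
    simp only [(periodic_periodize b).add_lat]
    rw [← Finset.sum_div, ← periodize_eq_sum hb0 le_rfl, div_self (hpos z).ne']

theorem exists_radius {φ : E2 → ℝ} (hφ : HasCompactSupport φ) : ∃ R, ∀ z, R < ‖z‖ → φ z = 0 := by
  obtain ⟨R, hR⟩ := hφ.isCompact.isBounded.subset_closedBall 0
  refine ⟨R, fun z hz => image_eq_zero_of_notMem_tsupport fun hm => ?_⟩
  have := hR hm
  rw [mem_closedBall_zero_iff] at this
  linarith

theorem pd_eq_zero_of_lt {φ : E2 → ℝ} {R : ℝ} (hR : ∀ z, R < ‖z‖ → φ z = 0) (j : Fin 2) (z : E2)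
    (hz : R < ‖z‖) : pd j φ z = 0 := by
  have : φ =ᶠ[nhds z] fun _ => 0 := by
    filter_upwards [(isOpen_lt continuous_const continuous_norm).mem_nhds hz] with w hw using hR w hw
  rw [pd, this.fderiv_eq]; simp

theorem Periodic.pd {φ : E2 → ℝ} (hφ : Periodic φ) (j : Fin 2) : Periodic (ThinFilm.pd j φ) := by
  intro z i
  have h2 := fderiv_comp_add_right (𝕜 := ℝ) (f := φ) (x := z) (e i)
  rw [show (fun x => φ (x + e i)) = φ from funext fun x => hφ x i] at h2
  simp only [ThinFilm.pd, h2]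

theorem integrableOn_mul_continuous {F τ : E2 → ℝ} (hF : IntegrableOn F Zp) (hτ : Continuous τ) :
    IntegrableOn (fun z => F z * τ z) Zp := by
  obtain ⟨c, hc⟩ := (isCompact_closedBall (0 : E2) 1).exists_bound_of_continuousOn hτ.continuousOn
  refine Integrable.mul_bdd (c := c) hF hτ.aestronglyMeasurable
    (ae_restrict_of_forall_mem measurableSet_Zp fun z hz => hc z ?_)
  rw [mem_closedBall_zero_iff]
  exact norm_le_of_coord fun i => abs_le.2 ⟨(hz i).1.le, (hz i).2.le⟩

/-- A weak gradient in the plane of a periodic function can be tested with periodic functions on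
the cell. -/
theorem cell_integral_by_parts {ψ : E2 → ℝ} {η : E2 → E2} (hψ : Periodic ψ) (hη : Periodic η)
    (hψi : IntegrableOn ψ Zp) (j : Fin 2) (hηi : IntegrableOn (fun z => η z j) Zp)
    (H : IsWeakGrad univ ψ η) {τ : E2 → ℝ} (hτ : ContDiff ℝ ((⊤ : ℕ∞) : WithTop ℕ∞) τ)
    (hτp : Periodic τ) : ∫ z in Zp, ψ z * pd j τ z = -∫ z in Zp, η z j * τ z := by
  obtain ⟨w, hw, hw0, hw1⟩ := exists_partition
  have hpτ : Continuous (pd j τ) := (contDiff_fderiv_apply hτ _).continuous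
  have hpw : Continuous (pd j w) := (contDiff_fderiv_apply hw _).continuous
  have hper : ∀ {a b : E2 → ℝ}, Periodic a → Periodic b → Periodic fun z => a z * b z :=
    fun ha hb z i => by simp only [ha z i, hb z i]
  have hηp : Periodic fun z => η z j := fun z i => by simp only [hη z i]
  have hcs : HasCompactSupport fun z => τ z * w z :=
    HasCompactSupport.intro (isCompact_closedBall (0 : E2) 2) fun z hz => by
      rw [hw0 z (by simpa using hz), mul_zero]
  -- A periodic `τ` is not compactly supported, so it is cut off by the partition of unity.
  -- Unfolding restores the factor `1` in the main terms, and the term with `∂w` vanishes because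
  -- the translates of `w` sum to a constant.
  have h1 := H (fun z => τ z * w z) (hτ.mul hw) hcs (subset_univ _) j
  simp only [Measure.restrict_univ] at h1
  have hpd : ∀ z, pd j (fun z => τ z * w z) z = pd j τ z * w z + τ z * pd j w z := by
    intro z
    rw [pd, fderiv_fun_mul (hτ.differentiable (by simp) z) (hw.differentiable (by simp) z)]
    simp [pd]
    ring
  obtain ⟨i1, e1⟩ := integral_unfold (hper hψ (hτp.pd j)) (integrableOn_mul_continuous hψi hpτ)
    hw.continuous hw0
  obtain ⟨i2, e2⟩ := integral_unfold (hper hψ hτp) (integrableOn_mul_continuous hψi hτ.continuous)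
    hpw (pd_eq_zero_of_lt hw0 j)
  obtain ⟨i3, e3⟩ := integral_unfold (hper hηp hτp) (integrableOn_mul_continuous hηi hτ.continuous)
    hw.continuous hw0
  have h2 : ∫ z, ψ z * pd j (fun z => τ z * w z) z =
      (∫ z, ψ z * pd j τ z * w z) + ∫ z, ψ z * τ z * pd j w z := by
    rw [← integral_add i1 i2]
    congr 1; ext z; rw [hpd]; ring
  have h3 : ∀ z, periodize (pd j w) z = 0 := by
    intro z
    rw [← pd_periodize hw hw0, show periodize w = fun _ => (1 : ℝ) from funext hw1, pd]
    simp
  rw [h2, e1, e2] at h1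
  simp only [hw1, h3, mul_one, mul_zero, integral_zero, add_zero] at h1
  rw [h1, ← neg_inj, neg_neg, neg_neg]
  simp only [hw1, mul_one] at e3
  rw [← e3]
  congr 1; ext z; ring

end Unfold

/-! ### Weak gradients in terms of Fourier coefficients -/

section TrigGrad

theorem contDiff_cos_phase (k : Fin 2 → ℤ) :
    ContDiff ℝ ((⊤ : ℕ∞) : WithTop ℕ∞) fun z => Real.cos (phase k z) := by
  unfold phase; fun_prop

theorem contDiff_sin_phase (k : Fin 2 → ℤ) :
    ContDiff ℝ ((⊤ : ℕ∞) : WithTop ℕ∞) fun z => Real.sin (phase k z) := by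
  unfold phase; fun_prop

theorem phase_add_e (k : Fin 2 → ℤ) (z : E2) (i : Fin 2) :
    phase k (z + e i) = phase k z + k i * (2 * Real.pi) := by
  fin_cases i <;> simp [phase, Fin.sum_univ_two] <;> ring

theorem periodic_cos_phase (k : Fin 2 → ℤ) : Periodic fun z => Real.cos (phase k z) := by
  intro z i
  simp only [phase_add_e, Real.cos_add_int_mul_two_pi]

theorem periodic_sin_phase (k : Fin 2 → ℤ) : Periodic fun z => Real.sin (phase k z) := by
  intro z i
  simp only [phase_add_e, Real.sin_add_int_mul_two_pi]

theorem hasFDerivAt_phase (k : Fin 2 → ℤ) (z : E2) :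
    ∃ L : E2 →L[ℝ] ℝ, HasFDerivAt (phase k) L z ∧ ∀ j, L (e j) = 2 * Real.pi * k j := by
  have hd : Differentiable ℝ (phase k) := by unfold phase; fun_prop
  refine ⟨fderiv ℝ (phase k) z, (hd z).hasFDerivAt, fun j => ?_⟩
  have h1 : HasDerivAt (fun s : ℝ => z + s • e j) (e j) 0 := by
    simpa using ((hasDerivAt_id (0 : ℝ)).smul_const (e j)).const_add z
  have h2 : HasFDerivAt (phase k) (fderiv ℝ (phase k) z) (z + (0 : ℝ) • e j) := by
    simpa using (hd z).hasFDerivAt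
  have h3 := h2.comp_hasDerivAt (0 : ℝ) h1
  have h4 : (phase k ∘ fun s : ℝ => z + s • e j) = fun s => phase k z + s * (2 * Real.pi * k j) := by
    ext s
    fin_cases j <;> simp [phase, Fin.sum_univ_two] <;> ring
  rw [h4] at h3
  have h5 : HasDerivAt (fun s : ℝ => phase k z + s * (2 * Real.pi * k j)) (2 * Real.pi * k j) 0 := by
    simpa using ((hasDerivAt_id (0 : ℝ)).mul_const (2 * Real.pi * (k j : ℝ))).const_add (phase k z)
  exact h3.unique h5

theorem pd_cos_phase (k : Fin 2 → ℤ) (j : Fin 2) (z : E2) :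
    pd j (fun z => Real.cos (phase k z)) z = -(2 * Real.pi * k j * Real.sin (phase k z)) := by
  obtain ⟨L, hL, hLj⟩ := hasFDerivAt_phase k z
  rw [pd, hL.cos.fderiv]
  simp [hLj]; ring

theorem pd_sin_phase (k : Fin 2 → ℤ) (j : Fin 2) (z : E2) :
    pd j (fun z => Real.sin (phase k z)) z = 2 * Real.pi * k j * Real.cos (phase k z) := by
  obtain ⟨L, hL, hLj⟩ := hasFDerivAt_phase k z
  rw [pd, hL.sin.fderiv]
  simp [hLj]; ring

/-- `η` is the gradient of `ψ` on the periodic cell, in terms of Fourier coefficients. -/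
def TrigGrad (ψ : E2 → ℝ) (η : E2 → E2) : Prop :=
  ∀ k j, cosCoeff (fun z => η z j) k = 2 * Real.pi * k j * sinCoeff ψ k ∧
    sinCoeff (fun z => η z j) k = -(2 * Real.pi * k j * cosCoeff ψ k)

/-- Only sines and cosines are tested. This lets `TrigGrad` be verified for almost every slice of a
function on `ω × Z'`, where every new test function costs a null set. -/
theorem trigGrad_of_forall {ψ : E2 → ℝ} {η : E2 → E2}
    (H : ∀ k j, (∫ z in Zp, ψ z * pd j (fun z => Real.cos (phase k z)) z =
        -∫ z in Zp, η z j * Real.cos (phase k z)) ∧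
      ∫ z in Zp, ψ z * pd j (fun z => Real.sin (phase k z)) z =
        -∫ z in Zp, η z j * Real.sin (phase k z)) : TrigGrad ψ η := by
  intro k j
  obtain ⟨h1, h2⟩ := H k j
  simp only [pd_cos_phase, pd_sin_phase] at h1 h2
  constructor
  · rw [cosCoeff, ← neg_inj, ← h1, sinCoeff, ← integral_const_mul, ← integral_neg]
    congr 1; ext z; ring
  · rw [sinCoeff, ← neg_inj, ← h2, cosCoeff, neg_neg, ← integral_const_mul]
    congr 1; ext z; ring

theorem memLp_coord {μ : Measure E2} {η : E2 → E2} (hη : MemLp η 2 μ) (j : Fin 2) :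
    MemLp (fun z => η z j) 2 μ :=
  hη.of_le (by have := hη.1; fun_prop) (Eventually.of_forall fun z => PiLp.norm_apply_le _ _)

theorem memLp_of_coord {α : Type*} [MeasurableSpace α] {μ : Measure α} {η : α → E2}
    (hη : ∀ j, MemLp (fun z => η z j) 2 μ) : MemLp η 2 μ := by
  have h1 : η = fun z => η z 0 • e 0 + η z 1 • e 1 := by
    ext z i; fin_cases i <;> simp
  rw [h1]
  have h2 : ∀ j, MemLp (fun z => η z j • e j) 2 μ := fun j => by
    refine (hη j).of_le ((hη j).1.smul_const (e j)) (Eventually.of_forall fun z => ?_)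
    rw [norm_smul]
    simp [e]
  exact (h2 0).add (h2 1)

theorem trigGrad_of_isWeakGrad {ψ : E2 → ℝ} {η : E2 → E2} (hψ : Periodic ψ) (hη : Periodic η)
    (hψL : MemLp ψ 2 (volume.restrict Zp)) (hηL : MemLp η 2 (volume.restrict Zp))
    (H : IsWeakGrad univ ψ η) : TrigGrad ψ η := by
  have h1 : IntegrableOn ψ Zp := hψL.integrable one_le_two
  have h2 : ∀ j, IntegrableOn (fun z => η z j) Zp := fun j =>
    (memLp_coord hηL j).integrable one_le_two
  exact trigGrad_of_forall fun k j =>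
    ⟨cell_integral_by_parts hψ hη h1 j (h2 j) H (contDiff_cos_phase k) (periodic_cos_phase k),
      cell_integral_by_parts hψ hη h1 j (h2 j) H (contDiff_sin_phase k) (periodic_sin_phase k)⟩

theorem IsPerH1.trigGrad {ψ : E2 → ℝ} {η : E2 → E2} (H : IsPerH1 ψ η) : TrigGrad ψ η :=
  trigGrad_of_isWeakGrad H.periodic H.periodic_grad H.memLp H.memLp_grad H.weakGrad

/-- The classical gradient, as a vector field. -/
noncomputable def grad (φ : E2 → ℝ) (z : E2) : E2 := WithLp.toLp 2 fun j => pd j φ z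

theorem isWeakGrad_grad {φ : E2 → ℝ} (hφ : ContDiff ℝ ((⊤ : ℕ∞) : WithTop ℕ∞) φ) :
    IsWeakGrad univ φ (grad φ) := by
  intro χ hχ hc _ j
  simp only [Measure.restrict_univ]
  have hc' : HasCompactSupport (pd j χ) := by
    refine (hc.fderiv (𝕜 := ℝ)).mono fun z hz => ?_
    contrapose! hz
    simp only [Function.mem_support, not_not] at hz ⊢
    rw [pd, hz]; rfl
  have c1 := (contDiff_fderiv_apply hφ (e j)).continuous
  have c2 := (contDiff_fderiv_apply hχ (e j)).continuous
  refine integral_mul_fderiv_eq_neg_fderiv_mul_of_integrable (v := e j) ?_ ?_ ?_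
    (fun x _ => hφ.differentiable (by simp) x) (fun x _ => hχ.differentiable (by simp) x)
  · exact (c1.mul hχ.continuous).integrable_of_hasCompactSupport hc.mul_left
  · exact (hφ.continuous.mul c2).integrable_of_hasCompactSupport hc'.mul_left
  · exact (hφ.continuous.mul hχ.continuous).integrable_of_hasCompactSupport hc.mul_left

theorem memLp_Zp_of_continuous {F : Type*} [NormedAddCommGroup F] {φ : E2 → F} (hφ : Continuous φ)
    {p : ENNReal} : MemLp φ p (volume.restrict Zp) := by
  obtain ⟨c, hc⟩ := (isCompact_closedBall (0 : E2) 1).exists_bound_of_continuousOn hφ.continuousOn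
  refine MemLp.of_bound hφ.aestronglyMeasurable c
    (ae_restrict_of_forall_mem measurableSet_Zp fun z hz => hc z ?_)
  rw [mem_closedBall_zero_iff]
  exact norm_le_of_coord fun i => abs_le.2 ⟨(hz i).1.le, (hz i).2.le⟩

theorem trigGrad_grad {φ : E2 → ℝ} (hφ : ContDiff ℝ ((⊤ : ℕ∞) : WithTop ℕ∞) φ)
    (hp : Periodic φ) : TrigGrad φ (grad φ) := by
  have hc : Continuous (grad φ) := by
    refine (PiLp.continuous_toLp 2 _).comp (continuous_pi fun j => ?_)
    exact (contDiff_fderiv_apply hφ (e j)).continuous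
  refine trigGrad_of_isWeakGrad hp (fun z i => ?_) (memLp_Zp_of_continuous hφ.continuous)
    (memLp_Zp_of_continuous hc) (isWeakGrad_grad hφ)
  ext j
  exact hp.pd j z i

/-- Gradients in the sense of Fourier coefficients can be tested with each other. -/
theorem TrigGrad.integral_eq {ψ φ : E2 → ℝ} {η θ : E2 → E2} (h1 : TrigGrad ψ η) (h2 : TrigGrad φ θ)
    (hψ : MemLp ψ 2 (volume.restrict Zp)) (hη : MemLp η 2 (volume.restrict Zp))
    (hφ : MemLp φ 2 (volume.restrict Zp)) (hθ : MemLp θ 2 (volume.restrict Zp)) (j : Fin 2) :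
    ∫ z in Zp, ψ z * θ z j = -∫ z in Zp, η z j * φ z := by
  have a1 := hasSum_parseval hψ (memLp_coord hθ j)
  have a2 := (hasSum_parseval (memLp_coord hη j) hφ).neg
  refine a1.unique (Eq.subst (motive := fun F => HasSum F _) (funext fun k => ?_) a2)
  rw [(h1 k j).1, (h1 k j).2, (h2 k j).1, (h2 k j).2]
  ring

/-- Unfolding replaces a compactly supported test function on the plane by its smooth periodization
on the cell. That function also satisfies `TrigGrad` with its classical gradient, and Parseval's
identity transfers the derivative. -/
theorem TrigGrad.isWeakGrad {ψ : E2 → ℝ} {η : E2 → E2} (h1 : TrigGrad ψ η) (hp : Periodic ψ)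
    (hp' : Periodic η) (hψ : MemLp ψ 2 (volume.restrict Zp))
    (hη : MemLp η 2 (volume.restrict Zp)) : IsWeakGrad univ ψ η := by
  intro φ hφ hc _ j
  simp only [Measure.restrict_univ]
  obtain ⟨R, hR⟩ := exists_radius hc
  have hP := contDiff_periodize' hφ hR
  have hPp := periodic_periodize φ
  have hcg : Continuous (grad (periodize φ)) := by
    refine (PiLp.continuous_toLp 2 _).comp (continuous_pi fun j => ?_)
    exact (contDiff_fderiv_apply hP (e j)).continuous
  rw [(integral_unfold (φ := pd j φ) hp (hψ.integrable one_le_two)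
      (contDiff_fderiv_apply hφ (e j)).continuous (pd_eq_zero_of_lt hR j)).2,
    (integral_unfold (F := fun z => η z j) (fun z i => by simp only [hp' z i])
      ((memLp_coord hη j).integrable one_le_two) hφ.continuous hR).2,
    ← h1.integral_eq (trigGrad_grad hP hPp) hψ hη (memLp_Zp_of_continuous hP.continuous)
      (memLp_Zp_of_continuous hcg) j]
  congr 1; ext z
  exact congrArg (ψ z * ·) (pd_periodize hφ hR j z).symm

/-- The Poincaré inequality on the periodic cell. -/
theorem TrigGrad.poincare {ψ : E2 → ℝ} {η : E2 → E2} (h : TrigGrad ψ η)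
    (hψ : MemLp ψ 2 (volume.restrict Zp)) (hη : MemLp η 2 (volume.restrict Zp))
    (h0 : ∫ z in Zp, ψ z = 0) : ∫ z in Zp, ψ z ^ 2 ≤ ∫ z in Zp, ‖η z‖ ^ 2 := by
  have a1 := hasSum_parseval hψ hψ
  have a2 := (hasSum_parseval (memLp_coord hη 0) (memLp_coord hη 0)).add
    (hasSum_parseval (memLp_coord hη 1) (memLp_coord hη 1))
  have e1 : ∫ z in Zp, ψ z * ψ z = ∫ z in Zp, ψ z ^ 2 := by simp only [sq]
  have i0 : ∀ j, IntegrableOn (fun z => η z j * η z j) Zp := fun j =>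
    (memLp_coord hη j).integrable_mul (memLp_coord hη j)
  have e2 : (∫ z in Zp, η z 0 * η z 0) + ∫ z in Zp, η z 1 * η z 1 = ∫ z in Zp, ‖η z‖ ^ 2 := by
    rw [← integral_add (i0 0) (i0 1)]
    congr 1; ext z
    rw [EuclideanSpace.norm_sq_eq, Fin.sum_univ_two]
    simp only [Real.norm_eq_abs, sq_abs]; ring
  rw [e1] at a1
  rw [e2] at a2
  refine hasSum_le (fun k => ?_) a1 a2
  rw [(h k 0).1, (h k 0).2, (h k 1).1, (h k 1).2]
  -- The zero mode is absent by the mean condition. For every other integer mode the factor `(2π)²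
  -- |k|²` is at least one.
  by_cases hk : k = 0
  · have hp : ∀ z, phase k z = 0 := fun z => by simp [phase, hk]
    have hc : cosCoeff ψ k = 0 := by simp [cosCoeff, hp, h0]
    have hs : sinCoeff ψ k = 0 := by simp [sinCoeff, hp]
    rw [hc, hs]; simp
  · have hk2 : (1 : ℝ) ≤ (k 0 : ℝ) ^ 2 + (k 1 : ℝ) ^ 2 := by
      have : 1 ≤ k 0 ^ 2 + k 1 ^ 2 := by
        by_contra! hlt
        have z0 : k 0 = 0 := by nlinarith [sq_nonneg (k 0), sq_nonneg (k 1)]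
        have z1 : k 1 = 0 := by nlinarith [sq_nonneg (k 0), sq_nonneg (k 1)]
        exact hk (by funext i; fin_cases i <;> simp [z0, z1])
      exact_mod_cast this
    have hpi : (1 : ℝ) ≤ (2 * Real.pi) ^ 2 := by nlinarith [Real.pi_gt_three]
    have hP : (1 : ℝ) ≤ (2 * Real.pi) ^ 2 * ((k 0 : ℝ) ^ 2 + (k 1 : ℝ) ^ 2) := by nlinarith
    have hq : 0 ≤ cosCoeff ψ k ^ 2 + sinCoeff ψ k ^ 2 := by positivity
    nlinarith [mul_le_mul_of_nonneg_right hP hq]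

/-- A square integrable field that is orthogonal to the gradients of trigonometric polynomials is
orthogonal to all gradients. -/
theorem TrigGrad.integral_inner_eq_zero {ψ : E2 → ℝ} {η Q : E2 → E2} (h : TrigGrad ψ η)
    (hψ : MemLp ψ 2 (volume.restrict Zp)) (hη : MemLp η 2 (volume.restrict Zp))
    (hQ : MemLp Q 2 (volume.restrict Zp))
    (h1 : ∀ k, ∑ j, (k j : ℝ) * cosCoeff (fun z => Q z j) k = 0)
    (h2 : ∀ k, ∑ j, (k j : ℝ) * sinCoeff (fun z => Q z j) k = 0) :
    ∫ z in Zp, inner ℝ (Q z) (η z) = 0 := by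
  have a := (hasSum_parseval (memLp_coord hQ 0) (memLp_coord hη 0)).add
    (hasSum_parseval (memLp_coord hQ 1) (memLp_coord hη 1))
  have i0 : ∀ j, IntegrableOn (fun z => Q z j * η z j) Zp := fun j =>
    (memLp_coord hQ j).integrable_mul (memLp_coord hη j)
  have e2 : (∫ z in Zp, Q z 0 * η z 0) + ∫ z in Zp, Q z 1 * η z 1 =
      ∫ z in Zp, inner ℝ (Q z) (η z) := by
    rw [← integral_add (i0 0) (i0 1)]
    congr 1; ext z
    rw [PiLp.inner_apply, Fin.sum_univ_two]
    simp; ring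
  rw [e2] at a
  refine a.unique (Eq.subst (motive := fun F => HasSum F _) (funext fun k => ?_) hasSum_zero)
  rw [(h k 0).1, (h k 0).2, (h k 1).1, (h k 1).2]
  have b1 := h1 k
  have b2 := h2 k
  rw [Fin.sum_univ_two] at b1 b2
  linear_combination -(2 * Real.pi * sinCoeff ψ k) * b1 + (2 * Real.pi * cosCoeff ψ k) * b2

end TrigGrad

/-! ### The coefficient of the cell problem -/

section CellCoeff

variable {h : E2 → ℝ} {M : ℝ}

theorem sinh_lt_self_mul_cosh {y : ℝ} (hy : 0 < y) : Real.sinh y < y * Real.cosh y := by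
  have hd : ∀ x : ℝ, HasDerivAt (fun x => x * Real.cosh x - Real.sinh x) (x * Real.sinh x) x := by
    intro x
    have := ((hasDerivAt_id x).mul (Real.hasDerivAt_cosh x)).sub (Real.hasDerivAt_sinh x)
    exact this.congr_deriv (by simp)
  have hm : StrictMonoOn (fun x => x * Real.cosh x - Real.sinh x) (Ici 0) := by
    refine strictMonoOn_of_deriv_pos (convex_Ici 0)
      (fun x _ => (hd x).continuousAt.continuousWithinAt) fun x hx => ?_
    rw [interior_Ici] at hx
    rw [(hd x).deriv]
    exact mul_pos hx (Real.sinh_pos_iff.2 hx)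
  have := hm (mem_Ici.2 le_rfl) (mem_Ici.2 hy.le) hy
  simp at this
  linarith

/-- With `y = M h / 2` the coefficient equals `(2/M) (tanh y - y)`, which is negative for `y > 0`.
The cell problem is therefore elliptic with weight `-c`. -/
theorem cellCoeff_neg (hM : 0 < M) (z : E2) (hpos : 0 < h z) : cellCoeff M h z < 0 := by
  set y := M * h z / 2 with hy
  have hy0 : 0 < y := by positivity
  have hMh : M * h z = y + y := by rw [hy]; ring
  have h1 := sinh_lt_self_mul_cosh hy0
  have h2 : 0 < Real.cosh y := Real.cosh_pos y
  have h3 : 0 < Real.sinh y := Real.sinh_pos_iff.2 hy0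
  have e1 : Real.exp (M * h z) + Real.exp (-(M * h z)) - 2 = 4 * Real.sinh y ^ 2 := by
    rw [hMh, neg_add, Real.exp_add, Real.exp_add, Real.sinh_eq]
    have : Real.exp y * Real.exp (-y) = 1 := by rw [← Real.exp_add]; simp
    linear_combination (2 : ℝ) * this
  have e2 : Real.exp (M * h z) - Real.exp (-(M * h z)) = 4 * Real.sinh y * Real.cosh y := by
    rw [hMh, neg_add, Real.exp_add, Real.exp_add, Real.sinh_eq, Real.cosh_eq]; ring
  rw [cellCoeff, e1, e2]
  have e3 : h z = 2 / M * y := by rw [hy]; field_simp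
  rw [e3, ← mul_sub]
  refine mul_neg_of_pos_of_neg (by positivity) ?_
  have e4 : 4 * Real.sinh y ^ 2 / (4 * Real.sinh y * Real.cosh y) = Real.sinh y / Real.cosh y := by
    field_simp
  rw [e4, sub_neg, div_lt_iff₀ h2]
  exact h1

theorem continuous_cellCoeff (hM : 0 < M) (hh : IsProfile h) : Continuous (cellCoeff M h) := by
  have hc := hh.continuous
  unfold cellCoeff
  refine (continuous_const.mul (Continuous.div (by fun_prop) (by fun_prop) fun z => ?_)).sub hc
  exact (exp_sub_exp_neg_pos (mul_pos hM (hh.pos z))).ne'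

theorem periodic_cellCoeff (hh : IsProfile h) : Periodic (cellCoeff M h) := by
  intro z i
  simp only [cellCoeff, hh.periodic z i]

theorem exists_cellCoeff_bounds (hM : 0 < M) (hh : IsProfile h) :
    ∃ c C, 0 < c ∧ ∀ z, c ≤ -cellCoeff M h z ∧ -cellCoeff M h z ≤ C := by
  have hc := (continuous_cellCoeff hM hh).neg
  have hK := isCompact_closedBall (0 : E2) 1
  have hne : (Metric.closedBall (0 : E2) 1).Nonempty := ⟨0, by simp⟩
  obtain ⟨a, -, ha⟩ := hK.exists_isMinOn hne hc.continuousOn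
  obtain ⟨d, -, hd⟩ := hK.exists_isMaxOn hne hc.continuousOn
  refine ⟨-cellCoeff M h a, -cellCoeff M h d, neg_pos.2 (cellCoeff_neg hM a (hh.pos a)), fun z => ?_⟩
  have hz : ThinFilm.cellRep z ∈ Metric.closedBall (0 : E2) 1 := by
    simpa using cellRep_norm_le z
  rw [← (periodic_cellCoeff (M := M) hh).cellRep z]
  exact ⟨ha hz, hd hz⟩

end CellCoeff

/-! ### Linearity of weak gradients -/

section Linear

variable {ψ φ F G : E2 → ℝ} {η θ : E2 → E2}

theorem cosCoeff_add (hF : IntegrableOn F Zp) (hG : IntegrableOn G Zp) (k : Fin 2 → ℤ) :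
    cosCoeff (fun z => F z + G z) k = cosCoeff F k + cosCoeff G k := by
  simp only [cosCoeff, add_mul]
  exact integral_add (integrable_mul_cos hF k) (integrable_mul_cos hG k)

theorem sinCoeff_add (hF : IntegrableOn F Zp) (hG : IntegrableOn G Zp) (k : Fin 2 → ℤ) :
    sinCoeff (fun z => F z + G z) k = sinCoeff F k + sinCoeff G k := by
  simp only [sinCoeff, add_mul]
  exact integral_add (integrable_mul_sin hF k) (integrable_mul_sin hG k)

theorem cosCoeff_const_mul (a : ℝ) (F : E2 → ℝ) (k : Fin 2 → ℤ) :
    cosCoeff (fun z => a * F z) k = a * cosCoeff F k := by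
  simp only [cosCoeff, mul_assoc]
  exact integral_const_mul _ _

theorem sinCoeff_const_mul (a : ℝ) (F : E2 → ℝ) (k : Fin 2 → ℤ) :
    sinCoeff (fun z => a * F z) k = a * sinCoeff F k := by
  simp only [sinCoeff, mul_assoc]
  exact integral_const_mul _ _

theorem cosCoeff_congr (H : F =ᵐ[volume.restrict Zp] G) (k : Fin 2 → ℤ) :
    cosCoeff F k = cosCoeff G k :=
  integral_congr_ae (H.mono fun z hz => by simp only [hz])

theorem sinCoeff_congr (H : F =ᵐ[volume.restrict Zp] G) (k : Fin 2 → ℤ) :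
    sinCoeff F k = sinCoeff G k :=
  integral_congr_ae (H.mono fun z hz => by simp only [hz])

theorem TrigGrad.congr (H : TrigGrad ψ η) (h1 : ψ =ᵐ[volume.restrict Zp] φ)
    (h2 : η =ᵐ[volume.restrict Zp] θ) : TrigGrad φ θ := by
  intro k j
  have h3 : (fun z => η z j) =ᵐ[volume.restrict Zp] fun z => θ z j :=
    h2.mono fun z hz => by simp only [hz]
  rw [← cosCoeff_congr h3, ← sinCoeff_congr h3, ← cosCoeff_congr h1, ← sinCoeff_congr h1]
  exact H k j

theorem TrigGrad.add (H1 : TrigGrad ψ η) (H2 : TrigGrad φ θ) (hψ : IntegrableOn ψ Zp)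
    (hφ : IntegrableOn φ Zp) (hη : ∀ j, IntegrableOn (fun z => η z j) Zp)
    (hθ : ∀ j, IntegrableOn (fun z => θ z j) Zp) :
    TrigGrad (fun z => ψ z + φ z) fun z => η z + θ z := by
  intro k j
  simp only [PiLp.add_apply]
  rw [cosCoeff_add (hη j) (hθ j), sinCoeff_add (hη j) (hθ j), cosCoeff_add hψ hφ,
    sinCoeff_add hψ hφ, (H1 k j).1, (H1 k j).2, (H2 k j).1, (H2 k j).2]
  constructor <;> ring

theorem TrigGrad.const_smul (H : TrigGrad ψ η) (a : ℝ) :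
    TrigGrad (fun z => a * ψ z) fun z => a • η z := by
  intro k j
  simp only [PiLp.smul_apply, smul_eq_mul]
  rw [cosCoeff_const_mul, sinCoeff_const_mul, cosCoeff_const_mul, sinCoeff_const_mul, (H k j).1,
    (H k j).2]
  constructor <;> ring

theorem trigGrad_const (a : ℝ) : TrigGrad (fun _ => a) fun _ => 0 := by
  have h1 := trigGrad_grad (φ := fun _ => a) contDiff_const fun _ _ => rfl
  have h2 : grad (fun _ => a) = fun _ => 0 := by
    funext z; ext j; simp [grad, pd]
  rwa [h2] at h1

/-- Gradients have zero mean. -/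
theorem TrigGrad.integral_eq_zero (H : TrigGrad ψ η) (j : Fin 2) : ∫ z in Zp, η z j = 0 := by
  have := (H 0 j).1
  simpa [cosCoeff, phase] using this

end Linear

/-! ### Solvability of the cell problem -/

section Existence

variable {h : E2 → ℝ} {M : ℝ}

theorem memLp_smul_continuous {φ : E2 → ℝ} (hφ : Continuous φ) {η : E2 → E2}
    (hη : MemLp η 2 (volume.restrict Zp)) : MemLp (fun z => φ z • η z) 2 (volume.restrict Zp) := by
  obtain ⟨c, hc⟩ := (isCompact_closedBall (0 : E2) 1).exists_bound_of_continuousOn hφ.continuousOn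
  refine hη.of_le_mul (c := c) (hφ.aestronglyMeasurable.smul hη.1)
    (ae_restrict_of_forall_mem measurableSet_Zp fun z hz => ?_)
  rw [norm_smul]
  refine mul_le_mul_of_nonneg_right (hc z ?_) (norm_nonneg _)
  rw [mem_closedBall_zero_iff]
  exact norm_le_of_coord fun i => abs_le.2 ⟨(hz i).1.le, (hz i).2.le⟩

/-- Functions known only almost everywhere on the cell acquire a genuinely periodic extension. The
Fourier relation sees the cell as a torus, so the extended gradient has no singular part on the cell
sides. -/
theorem isPerH1_comp_cellRep {ψ : E2 → ℝ} {η : E2 → E2} (H : TrigGrad ψ η)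
    (hψ : MemLp ψ 2 (volume.restrict Zp)) (hη : MemLp η 2 (volume.restrict Zp)) :
    IsPerH1 (fun z => ψ (ThinFilm.cellRep z)) fun z => η (ThinFilm.cellRep z) := by
  have e1 : ψ =ᵐ[volume.restrict Zp] fun z => ψ (ThinFilm.cellRep z) :=
    ae_restrict_of_forall_mem measurableSet_Zp fun z hz => by simp only [cellRep_of_mem hz]
  have e2 : η =ᵐ[volume.restrict Zp] fun z => η (ThinFilm.cellRep z) :=
    ae_restrict_of_forall_mem measurableSet_Zp fun z hz => by simp only [cellRep_of_mem hz]
  have m1 := hψ.ae_eq e1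
  have m2 := hη.ae_eq e2
  exact ⟨periodic_comp_cellRep ψ, periodic_comp_cellRep η, m1, m2,
    (H.congr e1 e2).isWeakGrad (periodic_comp_cellRep ψ) (periodic_comp_cellRep η) m1 m2⟩

/-- Integration against a continuous function, as a functional on `L²(Z')`. -/
noncomputable def pairing (φ : E2 → ℝ) (hφ : Continuous φ) :
    Lp ℝ 2 (volume.restrict Zp) →L[ℝ] ℝ :=
  innerSL ℝ ((memLp_Zp_of_continuous hφ : MemLp φ 2 (volume.restrict Zp)).toLp φ)

theorem pairing_apply {φ : E2 → ℝ} (hφ : Continuous φ) (χ : Lp ℝ 2 (volume.restrict Zp)) :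
    pairing φ hφ χ = ∫ z in Zp, χ z * φ z := by
  rw [pairing, innerSL_apply_apply, L2.inner_def]
  refine integral_congr_ae ?_
  filter_upwards [(memLp_Zp_of_continuous hφ : MemLp φ 2 (volume.restrict Zp)).coeFn_toLp] with z hz
  rw [hz]; simp

/-- Integration of the `j`-th component against a continuous function, as a functional on
`L²(Z')²`. -/
noncomputable def vecPairing (φ : E2 → ℝ) (hφ : Continuous φ) (j : Fin 2) :
    Lp E2 2 (volume.restrict Zp) →L[ℝ] ℝ :=
  innerSL ℝ ((memLp_Zp_of_continuous (hφ.smul continuous_const) :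
    MemLp (fun z => φ z • e j) 2 (volume.restrict Zp)).toLp fun z => φ z • e j)

theorem vecPairing_apply {φ : E2 → ℝ} (hφ : Continuous φ) (j : Fin 2)
    (ξ : Lp E2 2 (volume.restrict Zp)) : vecPairing φ hφ j ξ = ∫ z in Zp, ξ z j * φ z := by
  rw [vecPairing, innerSL_apply_apply, L2.inner_def]
  refine integral_congr_ae ?_
  have hm : MemLp (fun z => φ z • e j) 2 (volume.restrict Zp) :=
    memLp_Zp_of_continuous (hφ.smul continuous_const)
  filter_upwards [hm.coeFn_toLp] with z hz
  rw [hz, inner_smul_left, e, EuclideanSpace.inner_single_left]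
  simp; ring

theorem continuous_inv_mul_cos {s : E2 → ℝ} (hs : Continuous s) (hs0 : ∀ z, s z ≠ 0)
    (k : Fin 2 → ℤ) : Continuous fun z => (s z)⁻¹ * Real.cos (phase k z) :=
  (hs.inv₀ hs0).mul (contDiff_cos_phase k).continuous

theorem continuous_inv_mul_sin {s : E2 → ℝ} (hs : Continuous s) (hs0 : ∀ z, s z ≠ 0)
    (k : Fin 2 → ℤ) : Continuous fun z => (s z)⁻¹ * Real.sin (phase k z) :=
  (hs.inv₀ hs0).mul (contDiff_sin_phase k).continuous

/-- Pairs `(χ, ξ)` such that `χ` has zero mean and gradient `ξ / s`. -/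
noncomputable def weightedGraph (s : E2 → ℝ) (hs : Continuous s) (hs0 : ∀ z, s z ≠ 0) :
    Submodule ℝ (Lp ℝ 2 (volume.restrict Zp) × Lp E2 2 (volume.restrict Zp)) :=
  LinearMap.ker ((pairing (fun _ => 1) continuous_const).comp
      (ContinuousLinearMap.fst ℝ _ _)).toLinearMap ⊓
    ⨅ l : (Fin 2 → ℤ) × Fin 2,
      LinearMap.ker ((vecPairing _ (continuous_inv_mul_cos hs hs0 l.1) l.2).comp
          (ContinuousLinearMap.snd ℝ _ _) - (2 * Real.pi * l.1 l.2) •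
          (pairing _ (contDiff_sin_phase l.1).continuous).comp
            (ContinuousLinearMap.fst ℝ _ _)).toLinearMap ⊓
        LinearMap.ker ((vecPairing _ (continuous_inv_mul_sin hs hs0 l.1) l.2).comp
          (ContinuousLinearMap.snd ℝ _ _) + (2 * Real.pi * l.1 l.2) •
          (pairing _ (contDiff_cos_phase l.1).continuous).comp
            (ContinuousLinearMap.fst ℝ _ _)).toLinearMap

/-- The space is cut out by countably many continuous linear functionals, one family for the
coefficients and one for the mean. This is the closedness of the weak gradient. -/
theorem isClosed_weightedGraph {s : E2 → ℝ} (hs : Continuous s) (hs0 : ∀ z, s z ≠ 0) :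
    IsClosed (weightedGraph s hs hs0 :
      Set (Lp ℝ 2 (volume.restrict Zp) × Lp E2 2 (volume.restrict Zp))) := by
  rw [weightedGraph, Submodule.coe_inf, Submodule.coe_iInf]
  refine IsClosed.inter (ContinuousLinearMap.isClosed_ker _) (isClosed_iInter fun l => ?_)
  rw [Submodule.coe_inf]
  exact IsClosed.inter (ContinuousLinearMap.isClosed_ker _) (ContinuousLinearMap.isClosed_ker _)

theorem mem_weightedGraph {s : E2 → ℝ} (hs : Continuous s) (hs0 : ∀ z, s z ≠ 0)
    (p : Lp ℝ 2 (volume.restrict Zp) × Lp E2 2 (volume.restrict Zp)) :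
    p ∈ weightedGraph s hs hs0 ↔
      ∫ z in Zp, p.1 z = 0 ∧ TrigGrad p.1 fun z => (s z)⁻¹ • p.2 z := by
  rw [weightedGraph, Submodule.mem_inf, Submodule.mem_iInf]
  simp only [Submodule.mem_inf, LinearMap.mem_ker, ContinuousLinearMap.coe_coe,
    ContinuousLinearMap.comp_apply, _root_.sub_apply, _root_.add_apply,
    _root_.smul_apply, ContinuousLinearMap.coe_fst', ContinuousLinearMap.coe_snd',
    pairing_apply, vecPairing_apply, mul_one, smul_eq_mul, sub_eq_zero, add_eq_zero_iff_eq_neg,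
    Prod.forall, TrigGrad, cosCoeff, sinCoeff, PiLp.smul_apply]
  have e1 : ∀ (k : Fin 2 → ℤ) (j : Fin 2),
      ∫ z in Zp, p.2 z j * ((s z)⁻¹ * Real.cos (phase k z)) =
      ∫ z in Zp, (s z)⁻¹ * p.2 z j * Real.cos (phase k z) := fun k j => by
    congr 1; ext z; ring
  have e2 : ∀ (k : Fin 2 → ℤ) (j : Fin 2),
      ∫ z in Zp, p.2 z j * ((s z)⁻¹ * Real.sin (phase k z)) =
      ∫ z in Zp, (s z)⁻¹ * p.2 z j * Real.sin (phase k z) := fun k j => by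
    congr 1; ext z; ring
  simp only [e1, e2]

theorem norm_sq_Lp {F : Type*} [NormedAddCommGroup F] [InnerProductSpace ℝ F] {μ : Measure E2}
    (ξ : Lp F 2 μ) : ‖ξ‖ ^ 2 = ∫ z, ‖ξ z‖ ^ 2 ∂μ := by
  rw [← real_inner_self_eq_norm_sq, L2.inner_def]
  simp only [real_inner_self_eq_norm_sq]

theorem integrable_norm_sq {μ : Measure E2} {η : E2 → E2} (hη : MemLp η 2 μ) :
    Integrable (fun z => ‖η z‖ ^ 2) μ := hη.integrable_norm_pow (by norm_num)

/-- Orthogonal projection onto the second components of a closed subspace of a product. -/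
theorem exists_projection_snd {E F : Type*} [NormedAddCommGroup E] [NormedSpace ℝ E]
    [CompleteSpace E] [NormedAddCommGroup F] [InnerProductSpace ℝ F] [CompleteSpace F]
    (G : Submodule ℝ (E × F)) (hG : IsClosed (G : Set (E × F))) {κ : ℝ} (hκ : 0 ≤ κ)
    (hbd : ∀ x ∈ G, ‖x‖ ≤ κ * ‖x.2‖) (a : F) :
    ∃ x ∈ G, ∀ y ∈ G, inner ℝ (a - x.2) y.2 = 0 := by
  have hGc : CompleteSpace G := hG.completeSpace_coe
  -- The bound by the second component makes that component an embedding with closed range, so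
  -- orthogonal projection onto the range exists.
  have hanti : AntilipschitzWith (Real.toNNReal κ) fun x : G => x.1.2 := by
    refine AntilipschitzWith.of_le_mul_dist fun x y => ?_
    rw [Real.coe_toNNReal _ hκ, Subtype.dist_eq, dist_eq_norm, dist_eq_norm]
    exact hbd _ (G.sub_mem x.2 y.2)
  have huc : UniformContinuous fun x : G => x.1.2 :=
    uniformContinuous_snd.comp uniformContinuous_subtype_val
  set V : Submodule ℝ F := G.map (LinearMap.snd ℝ _ _) with hV
  have hcl : IsClosed (V : Set F) := by
    convert hanti.isClosed_range huc using 1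
    ext v
    simp only [hV, SetLike.mem_coe, Submodule.mem_map, Set.mem_range]
    exact ⟨fun ⟨x, hx, hxv⟩ => ⟨⟨x, hx⟩, hxv⟩, fun ⟨x, hxv⟩ => ⟨x.1, x.2, hxv⟩⟩
  have hVc : CompleteSpace V := hcl.completeSpace_coe
  obtain ⟨x, hx, hx2⟩ := Submodule.mem_map.1 (V.starProjection_apply_mem a)
  refine ⟨x, hx, fun y hy => ?_⟩
  have horth := V.starProjection_inner_eq_zero a y.2 (Submodule.mem_map.2 ⟨y, hy, rfl⟩)
  rw [← hx2] at horth
  exact horth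

/-- The Poincaré inequality bounds the function by its gradient, and the lower bound on `s²` bounds
the gradient by the weighted gradient. The weighted gradients therefore form a closed subspace. -/
theorem exists_projection {s : E2 → ℝ} (hs : Continuous s) (hs0 : ∀ z, s z ≠ 0) {c : ℝ}
    (hc : 0 < c) (hcs : ∀ z, c ≤ s z ^ 2) (a : Lp E2 2 (volume.restrict Zp)) :
    ∃ x ∈ weightedGraph s hs hs0, ∀ y ∈ weightedGraph s hs hs0, inner ℝ (a - x.2) y.2 = 0 := by
  have hinv : Continuous fun z => (s z)⁻¹ := hs.inv₀ hs0
  have hbd : ∀ x ∈ weightedGraph s hs hs0, ‖x‖ ≤ (max 1 (Real.sqrt c⁻¹)) * ‖x.2‖ := by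
    intro x hx
    obtain ⟨h0, h1⟩ := (mem_weightedGraph hs hs0 x).1 hx
    have hm := memLp_smul_continuous hinv (Lp.memLp x.2)
    have h2 := h1.poincare (Lp.memLp x.1) hm h0
    have h3 : ∫ z in Zp, ‖(s z)⁻¹ • x.2 z‖ ^ 2 ≤ c⁻¹ * ∫ z in Zp, ‖x.2 z‖ ^ 2 := by
      rw [← integral_const_mul]
      refine integral_mono (integrable_norm_sq hm)
        ((integrable_norm_sq (Lp.memLp x.2)).const_mul _) fun z => ?_
      simp only [norm_smul, mul_pow, norm_inv, inv_pow, Real.norm_eq_abs, sq_abs]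
      exact mul_le_mul_of_nonneg_right (inv_anti₀ hc (hcs z)) (sq_nonneg _)
    have h4 : ‖x.1‖ ^ 2 ≤ (Real.sqrt c⁻¹ * ‖x.2‖) ^ 2 := by
      rw [mul_pow, Real.sq_sqrt (by positivity), norm_sq_Lp, norm_sq_Lp]
      simp only [Real.norm_eq_abs, sq_abs] at h2 ⊢
      exact h2.trans h3
    have h5 : ‖x.1‖ ≤ Real.sqrt c⁻¹ * ‖x.2‖ :=
      (sq_le_sq₀ (norm_nonneg _) (by positivity)).1 h4
    rw [Prod.norm_def]
    refine max_le (h5.trans ?_) ?_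
    · exact mul_le_mul_of_nonneg_right (le_max_right _ _) (norm_nonneg _)
    · exact le_mul_of_one_le_left (norm_nonneg _) (le_max_left _ _)
  exact exists_projection_snd _ (isClosed_weightedGraph hs hs0)
    (le_max_of_le_left zero_le_one) hbd a

/-- The solution of the cell problem, by orthogonal projection. -/
theorem exists_isCellSolution (hM : 0 < M) (hh : IsProfile h) (i : Fin 2) :
    ∃ ψ γ, IsCellSolution M h i ψ γ := by
  obtain ⟨c, C, hc, hcC⟩ := exists_cellCoeff_bounds hM hh
  -- Multiplication by `√(-c)` turns the weighted energy into the plain `L²` norm. The cell equation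
  -- then says that `s (eᵢ + ∇ψ)` is orthogonal to all `s ∇χ`.
  set s : E2 → ℝ := fun z => Real.sqrt (-cellCoeff M h z) with hsdef
  have hs : Continuous s := (continuous_cellCoeff hM hh).neg.sqrt
  have hpos : ∀ z, 0 < s z := fun z => Real.sqrt_pos.2 (hc.trans_le (hcC z).1)
  have hs0 : ∀ z, s z ≠ 0 := fun z => (hpos z).ne'
  have hsq : ∀ z, s z * s z = -cellCoeff M h z := fun z =>
    Real.mul_self_sqrt (hc.trans_le (hcC z).1).le
  have hinv : Continuous fun z => (s z)⁻¹ := hs.inv₀ hs0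
  have hse : MemLp (fun z => s z • e i) 2 (volume.restrict Zp) :=
    memLp_Zp_of_continuous (hs.smul continuous_const)
  obtain ⟨x, hx, horth'⟩ := exists_projection hs hs0 hc
    (fun z => by rw [sq, hsq]; exact (hcC z).1) (hse.toLp _)
  obtain ⟨h0, h1⟩ := (mem_weightedGraph hs hs0 x).1 hx
  have hm := memLp_smul_continuous hinv (Lp.memLp x.2)
  have hm' : MemLp (fun z => (-1 : ℝ) • (s z)⁻¹ • x.2 z) 2 (volume.restrict Zp) :=
    hm.const_smul (-1 : ℝ)
  have hχ' : MemLp (fun z => (-1 : ℝ) * x.1 z) 2 (volume.restrict Zp) := (Lp.memLp x.1).const_mul _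
  -- The residual of the projection is `s eᵢ - s ∇χ`, so the solution is minus the projected
  -- potential.
  refine ⟨_, _, isPerH1_comp_cellRep (h1.const_smul (-1)) hχ' hm', ?_, fun χ η H => ?_⟩
  · rw [setIntegral_congr_fun (g := fun z => (-1 : ℝ) * x.1 z) measurableSet_Zp fun z hz => by
      simp only [cellRep_of_mem hz], integral_const_mul, h0, mul_zero]
  · set m := ∫ z in Zp, χ z with hmdef
    have hsη : MemLp (fun z => s z • η z) 2 (volume.restrict Zp) :=
      memLp_smul_continuous hs H.memLp_grad
    have hχm : MemLp (fun z => χ z + -m) 2 (volume.restrict Zp) :=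
      H.memLp.add (memLp_const _)
    have hT : TrigGrad (fun z => χ z + -m) fun z => η z + 0 :=
      H.trigGrad.add (trigGrad_const (-m)) (H.memLp.integrable one_le_two) (integrable_const _)
        (fun j => (memLp_coord H.memLp_grad j).integrable one_le_two) fun j => by simp
    -- General test functions need not have zero mean. Subtracting the mean puts them in the space
    -- and leaves the gradient unchanged.
    have hmem : (hχm.toLp _, hsη.toLp _) ∈ weightedGraph s hs hs0 := by
      rw [mem_weightedGraph]
      constructor
      · rw [integral_congr_ae hχm.coeFn_toLp, integral_add (H.memLp.integrable one_le_two)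
          (integrable_const _), ← hmdef]
        simp
      · refine hT.congr hχm.coeFn_toLp.symm ?_
        filter_upwards [hsη.coeFn_toLp] with z hz
        rw [hz, smul_smul, inv_mul_cancel₀ (hs0 z), one_smul, add_zero]
    have horth := horth' _ hmem
    rw [L2.inner_def] at horth
    rw [← neg_eq_zero, ← horth, ← integral_neg]
    refine integral_congr_ae ?_
    filter_upwards [hsη.coeFn_toLp, hse.coeFn_toLp, Lp.coeFn_sub (hse.toLp _) x.2,
      ae_restrict_mem measurableSet_Zp] with z a1 a2 a3 hz
    rw [a3, Pi.sub_apply, a1, a2, cellRep_of_mem hz, inner_smul_right, ← neg_mul, ← hsq,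
      mul_assoc, ← real_inner_smul_left (r := s z)]
    congr 2
    rw [smul_add, smul_smul, smul_smul]
    have : s z * -1 * (s z)⁻¹ = -1 := by field_simp [hs0 z]
    rw [this]
    module

end Existence

/-! ### Uniqueness for the cell problem and properties of the permeability tensor -/

section Uniqueness

variable {h : E2 → ℝ} {M : ℝ} {π ψ : E2 → ℝ} {γ η : E2 → E2}

theorem Periodic.ae_of_ae_Zp {P : E2 → Prop} (hP : Periodic P)
    (H : ∀ᵐ z ∂volume.restrict Zp, P z) : ∀ᵐ z, P z := by
  have h0 : ∀ᵐ z : E2, cellIdx z = 0 → P z := by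
    filter_upwards [(ae_restrict_iff' measurableSet_Zp).1 H, volume_cell_zero.mem_iff] with z h1 h2 h3
    exact h1 (h2.1 h3)
  have h1 : ∀ k : Fin 2 → ℤ, ∀ᵐ z : E2, cellIdx (z + lat k) = 0 → P (z + lat k) := fun k =>
    (measurePreserving_add_right volume (lat k)).quasiMeasurePreserving.ae h0
  filter_upwards [ae_all_iff.2 h1] with z hz
  have h2 := hz (-cellIdx z) (by rw [cellIdx_add_lat]; simp)
  rwa [hP.add_lat] at h2

theorem integrable_coeff_inner (hM : 0 < M) (hh : IsProfile h)
    (hγ : MemLp γ 2 (volume.restrict Zp)) (hη : MemLp η 2 (volume.restrict Zp)) :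
    IntegrableOn (fun z => cellCoeff M h z * inner ℝ (γ z) (η z)) Zp := by
  have h1 := memLp_smul_continuous (continuous_cellCoeff hM hh) hγ
  have h2 : ∀ j, IntegrableOn (fun z => (cellCoeff M h z • γ z) j * η z j) Zp := fun j =>
    (memLp_coord h1 j).integrable_mul (memLp_coord hη j)
  refine ((h2 0).add (h2 1)).congr (Eventually.of_forall fun z => ?_)
  simp only [Pi.add_apply, PiLp.smul_apply, PiLp.inner_apply, Fin.sum_univ_two, smul_eq_mul,
    RCLike.inner_apply, conj_trivial]
  ring

theorem ae_eq_zero_of_integral_coeff (hM : 0 < M) (hh : IsProfile h)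
    (hη : MemLp η 2 (volume.restrict Zp))
    (H : ∫ z in Zp, cellCoeff M h z * inner ℝ (η z) (η z) = 0) :
    η =ᵐ[volume.restrict Zp] 0 := by
  have hc : ∀ z, 0 < -cellCoeff M h z := fun z => neg_pos.2 (cellCoeff_neg hM z (hh.pos z))
  have H' : ∫ z in Zp, -(cellCoeff M h z * inner ℝ (η z) (η z)) = 0 := by
    rw [integral_neg, H, neg_zero]
  have J : IntegrableOn (fun z => -(cellCoeff M h z * inner ℝ (η z) (η z))) Zp :=
    (integrable_coeff_inner hM hh hη hη).neg
  rw [integral_eq_zero_iff_of_nonneg (fun z => ?_) J] at H'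
  · filter_upwards [H'] with z hz
    have h1 : -cellCoeff M h z * inner ℝ (η z) (η z) = 0 := by
      simpa using hz
    exact inner_self_eq_zero.1 ((mul_eq_zero.1 h1).resolve_left (hc z).ne')
  · simp only [Pi.zero_apply, ← neg_mul]
    exact mul_nonneg (hc z).le real_inner_self_nonneg

theorem IsPerH1.sub (H1 : IsPerH1 π γ) (H2 : IsPerH1 ψ η) :
    IsPerH1 (fun z => π z + -1 * ψ z) fun z => γ z + (-1 : ℝ) • η z := by
  have p1 : Periodic fun z => π z + -1 * ψ z := fun z i => by
    simp only [H1.periodic z i, H2.periodic z i]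
  have p2 : Periodic fun z => γ z + (-1 : ℝ) • η z := fun z i => by
    simp only [H1.periodic_grad z i, H2.periodic_grad z i]
  have m2 : MemLp (fun z => (-1 : ℝ) • η z) 2 (volume.restrict Zp) := H2.memLp_grad.const_smul (-1 : ℝ)
  have m3 := H2.memLp.const_mul (-1)
  have T := H1.trigGrad.add (H2.trigGrad.const_smul (-1)) (H1.memLp.integrable one_le_two)
    (m3.integrable one_le_two) (fun j => (memLp_coord H1.memLp_grad j).integrable one_le_two)
    fun j => (memLp_coord m2 j).integrable one_le_two
  exact ⟨p1, p2, H1.memLp.add m3, H1.memLp_grad.add m2,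
    T.isWeakGrad p1 p2 (H1.memLp.add m3) (H1.memLp_grad.add m2)⟩

theorem IsCellSolution.memLp_flux {i : Fin 2} (H : IsCellSolution M h i π γ) :
    MemLp (fun z => e i + γ z) 2 (volume.restrict Zp) := by
  have h1 : MemLp (fun _ : E2 => e i) 2 (volume.restrict Zp) := memLp_const _
  exact h1.add H.perH1.memLp_grad

/-- Both equations are tested with the difference. The sign of `c` annihilates its gradient, the
Poincaré inequality annihilates the function on the cell, and periodicity spreads this over the
plane. -/
theorem IsCellSolution.unique (hM : 0 < M) (hh : IsProfile h) {i : Fin 2}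
    (H1 : IsCellSolution M h i π γ) (H2 : IsCellSolution M h i ψ η) :
    ψ =ᵐ[volume] π ∧ η =ᵐ[volume] γ := by
  have D := H2.perH1.sub H1.perH1
  have w1 := H1.weak _ _ D
  have w2 := H2.weak _ _ D
  have hη : (fun z => η z + (-1 : ℝ) • γ z) =ᵐ[volume.restrict Zp] 0 := by
    refine ae_eq_zero_of_integral_coeff hM hh D.memLp_grad ?_
    have hw := integral_sub (integrable_coeff_inner hM hh H2.memLp_flux D.memLp_grad)
      (integrable_coeff_inner hM hh H1.memLp_flux D.memLp_grad)
    rw [w1, w2, sub_zero] at hw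
    rw [← hw]
    congr 1; ext z
    rw [← mul_sub, ← inner_sub_left]
    congr 2
    module
  have hmean : ∫ z in Zp, (ψ z + -1 * π z) = 0 := by
    rw [integral_add (H2.perH1.memLp.integrable one_le_two)
      ((H1.perH1.memLp.integrable one_le_two).const_mul _), integral_const_mul, H1.mean, H2.mean]
    simp
  have hP := D.trigGrad.poincare D.memLp D.memLp_grad hmean
  have h0 : ∫ z in Zp, ‖η z + (-1 : ℝ) • γ z‖ ^ 2 = 0 := by
    rw [integral_congr_ae (g := fun _ => (0 : ℝ)) (hη.mono fun z hz => by
      simp only [hz]; simp), integral_zero]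
  have hψ : (fun z => (ψ z + -1 * π z) ^ 2) =ᵐ[volume.restrict Zp] 0 := by
    rw [← integral_eq_zero_iff_of_nonneg (fun z => sq_nonneg _) D.memLp.integrable_sq]
    exact le_antisymm (hP.trans h0.le) (integral_nonneg fun z => sq_nonneg _)
  constructor
  · refine Periodic.ae_of_ae_Zp (P := fun z => ψ z = π z)
      (fun z i => by simp only [H1.perH1.periodic z i, H2.perH1.periodic z i]) ?_
    filter_upwards [hψ] with z hz
    have := pow_eq_zero_iff (two_ne_zero) |>.1 hz
    linarith
  · refine Periodic.ae_of_ae_Zp (P := fun z => η z = γ z)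
      (fun z i => by simp only [H1.perH1.periodic_grad z i, H2.perH1.periodic_grad z i]) ?_
    filter_upwards [hη] with z hz
    have hz' : η z + (-1 : ℝ) • γ z = 0 := hz
    rw [← sub_eq_zero, ← hz']; module

theorem IsCellSolution.weak_of_trigGrad {i : Fin 2} (H : IsCellSolution M h i π γ)
    (T : TrigGrad ψ η) (hψ : MemLp ψ 2 (volume.restrict Zp)) (hη : MemLp η 2 (volume.restrict Zp)) :
    ∫ z in Zp, cellCoeff M h z * inner ℝ (e i + γ z) (η z) = 0 := by
  rw [← H.weak _ _ (isPerH1_comp_cellRep T hψ hη)]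
  exact setIntegral_congr_fun measurableSet_Zp fun z hz => by simp only [cellRep_of_mem hz]

theorem sum_smul_e (r : E2) : ∑ i : Fin 2, r i • e i = r := by
  ext j; fin_cases j <;> simp [Fin.sum_univ_two, e]

/-- The horizontal flux is determined by its divergence and by the pressure gradient. -/
theorem flux_eq_sum (hM : 0 < M) (hh : IsProfile h) {P : Fin 2 → E2 → ℝ} {Γ : Fin 2 → E2 → E2}
    (H : ∀ i, IsCellSolution M h i (P i) (Γ i)) {r : E2} {g : E2 → E2} {ϖ : E2 → ℝ}
    (hg : MemLp g 2 (volume.restrict Zp)) (hϖ : MemLp ϖ 2 (volume.restrict Zp))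
    (T : TrigGrad ϖ fun z => r - g z)
    (h1 : ∀ k, ∑ j, (k j : ℝ) * cosCoeff (fun z => cellCoeff M h z * g z j) k = 0)
    (h2 : ∀ k, ∑ j, (k j : ℝ) * sinCoeff (fun z => cellCoeff M h z * g z j) k = 0) :
    ∀ᵐ z ∂volume.restrict Zp, g z = ∑ i, r i • (e i + Γ i z) := by
  have m0 : MemLp (fun z => r - g z) 2 (volume.restrict Zp) := (memLp_const r).sub hg
  have mΓ : ∀ i, MemLp (fun z => r i • Γ i z) 2 (volume.restrict Zp) := fun i =>
    (H i).perH1.memLp_grad.const_smul (r i)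
  have mP : ∀ i, MemLp (fun z => r i * P i z) 2 (volume.restrict Zp) := fun i =>
    (H i).perH1.memLp.const_mul (r i)
  have i2 : ∀ {F : E2 → E2}, MemLp F 2 (volume.restrict Zp) →
      ∀ j, IntegrableOn (fun z => F z j) Zp := fun hF j =>
    (memLp_coord hF j).integrable one_le_two
  -- `W` is the difference between the claimed expression and `g`. It is the gradient of `S`, and `c
  -- W` is orthogonal to gradients, so the weighted energy of `W` vanishes.
  set W : E2 → E2 := fun z => r - g z + r 0 • Γ 0 z + r 1 • Γ 1 z with hW
  set S : E2 → ℝ := fun z => ϖ z + r 0 * P 0 z + r 1 * P 1 z with hS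
  have mW : MemLp W 2 (volume.restrict Zp) := (m0.add (mΓ 0)).add (mΓ 1)
  have mS : MemLp S 2 (volume.restrict Zp) := (hϖ.add (mP 0)).add (mP 1)
  have TW : TrigGrad S W := by
    refine TrigGrad.add (TrigGrad.add T ((H 0).perH1.trigGrad.const_smul (r 0))
      (hϖ.integrable one_le_two) ((mP 0).integrable one_le_two) (i2 m0) (i2 (mΓ 0)))
      ((H 1).perH1.trigGrad.const_smul (r 1)) ((hϖ.add (mP 0)).integrable one_le_two)
      ((mP 1).integrable one_le_two) (i2 (m0.add (mΓ 0))) (i2 (mΓ 1))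
  have hrW : ∀ z, W z = r 0 • (e 0 + Γ 0 z) + r 1 • (e 1 + Γ 1 z) - g z := fun z => by
    have := sum_smul_e r
    rw [Fin.sum_univ_two] at this
    simp only [hW]
    nth_rw 1 [← this]
    module
  have z0 := (H 0).weak_of_trigGrad TW mS mW
  have z1 := (H 1).weak_of_trigGrad TW mS mW
  have zg : ∫ z in Zp, cellCoeff M h z * inner ℝ (g z) (W z) = 0 := by
    have := TW.integral_inner_eq_zero mS mW
      (memLp_smul_continuous (continuous_cellCoeff hM hh) hg) h1 h2
    simpa only [real_inner_smul_left] using this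
  have J0 := (integrable_coeff_inner hM hh (H 0).memLp_flux mW).const_mul (r 0)
  have J1 := (integrable_coeff_inner hM hh (H 1).memLp_flux mW).const_mul (r 1)
  have Jg := integrable_coeff_inner hM hh hg mW
  have hz : W =ᵐ[volume.restrict Zp] 0 := by
    refine ae_eq_zero_of_integral_coeff hM hh mW ?_
    have e1 : ∀ z, cellCoeff M h z * inner ℝ (W z) (W z) =
        r 0 * (cellCoeff M h z * inner ℝ (e 0 + Γ 0 z) (W z)) +
          r 1 * (cellCoeff M h z * inner ℝ (e 1 + Γ 1 z) (W z)) -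
          cellCoeff M h z * inner ℝ (g z) (W z) := fun z => by
      nth_rw 1 [hrW z]
      rw [inner_sub_left, inner_add_left, real_inner_smul_left, real_inner_smul_left]
      ring
    simp only [e1]
    have J01 : IntegrableOn (fun z => r 0 * (cellCoeff M h z * inner ℝ (e 0 + Γ 0 z) (W z)) +
      r 1 * (cellCoeff M h z * inner ℝ (e 1 + Γ 1 z) (W z))) Zp := J0.add J1
    rw [integral_sub J01 Jg, integral_add J0 J1, integral_const_mul, integral_const_mul,
      z0, z1, zg]
    simp
  filter_upwards [hz] with z hz
  rw [hrW] at hz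
  rw [Fin.sum_univ_two]
  exact (sub_eq_zero.1 hz).symm

/-- The added term is the `i`-th cell equation tested with `πʲ`. The resulting form shows symmetry
and nonnegativity of the tensor. -/
theorem permeability_eq (hM : 0 < M) (hh : IsProfile h) {P : Fin 2 → E2 → ℝ}
    {Γ : Fin 2 → E2 → E2} (H : ∀ i, IsCellSolution M h i (P i) (Γ i)) (i j : Fin 2) :
    permeability M h Γ i j =
      -∫ z in Zp, cellCoeff M h z * inner ℝ (e i + Γ i z) (e j + Γ j z) := by
  have h1 := (H i).weak _ _ (H j).perH1
  simp only [permeability, Matrix.of_apply, inner_add_right (e i + Γ i _), mul_add]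
  rw [integral_add (integrable_coeff_inner hM hh (H i).memLp_flux (memLp_const _))
    (integrable_coeff_inner hM hh (H i).memLp_flux (H j).perH1.memLp_grad), h1, add_zero]

theorem permeability_symm (hM : 0 < M) (hh : IsProfile h) {P : Fin 2 → E2 → ℝ}
    {Γ : Fin 2 → E2 → E2} (H : ∀ i, IsCellSolution M h i (P i) (Γ i)) (i j : Fin 2) :
    permeability M h Γ i j = permeability M h Γ j i := by
  rw [permeability_eq hM hh H, permeability_eq hM hh H]
  simp only [real_inner_comm]

theorem inner_act_eq (hM : 0 < M) (hh : IsProfile h) {P : Fin 2 → E2 → ℝ}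
    {Γ : Fin 2 → E2 → E2} (H : ∀ i, IsCellSolution M h i (P i) (Γ i)) (v : E2) :
    inner ℝ (act (permeability M h Γ) v) v =
      -∫ z in Zp, cellCoeff M h z * inner ℝ (∑ i, v i • (e i + Γ i z)) (∑ i, v i • (e i + Γ i z)) := by
  have J : ∀ i j, IntegrableOn (fun z => v i * v j * (cellCoeff M h z *
      inner ℝ (e i + Γ i z) (e j + Γ j z))) Zp := fun i j =>
    (integrable_coeff_inner hM hh (H i).memLp_flux (H j).memLp_flux).const_mul _
  have e1 : ∀ z, cellCoeff M h z * inner ℝ (∑ i, v i • (e i + Γ i z)) (∑ i, v i • (e i + Γ i z)) =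
      ∑ i, ∑ j, v i * v j * (cellCoeff M h z * inner ℝ (e i + Γ i z) (e j + Γ j z)) := fun z => by
    simp only [sum_inner, inner_sum, real_inner_smul_left, real_inner_smul_right, Finset.mul_sum]
    refine Finset.sum_congr rfl fun i _ => Finset.sum_congr rfl fun j _ => ?_
    rw [real_inner_comm (e i + Γ i z) (e j + Γ j z)]
    ring
  simp only [e1]
  rw [integral_finsetSum _ fun i _ => integrable_finsetSum _ fun j _ => J i j, PiLp.inner_apply,
    ← Finset.sum_neg_distrib]
  refine Finset.sum_congr rfl fun i _ => ?_
  rw [integral_finsetSum _ fun j _ => J i j, ← Finset.sum_neg_distrib, act]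
  simp only [Matrix.mulVec, dotProduct, integral_const_mul]
  simp only [RCLike.inner_apply, conj_trivial, Finset.mul_sum]
  refine Finset.sum_congr rfl fun j _ => ?_
  rw [permeability_eq hM hh H]; ring

theorem inner_act_nonneg (hM : 0 < M) (hh : IsProfile h) {P : Fin 2 → E2 → ℝ}
    {Γ : Fin 2 → E2 → E2} (H : ∀ i, IsCellSolution M h i (P i) (Γ i)) (v : E2) :
    0 ≤ inner ℝ (act (permeability M h Γ) v) v := by
  rw [inner_act_eq hM hh H, ← integral_neg]
  refine integral_nonneg fun z => ?_
  simp only [Pi.zero_apply, ← neg_mul]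
  exact mul_nonneg (neg_pos.2 (cellCoeff_neg hM z (hh.pos z))).le real_inner_self_nonneg

/-- Zero energy forces `∑ vᵢ (eᵢ + ∇πⁱ) = 0` almost everywhere. Periodic gradients have zero mean,
so the mean of this field over the cell is `v`. -/
theorem eq_zero_of_inner_act (hM : 0 < M) (hh : IsProfile h) {P : Fin 2 → E2 → ℝ}
    {Γ : Fin 2 → E2 → E2} (H : ∀ i, IsCellSolution M h i (P i) (Γ i)) {v : E2}
    (hv : inner ℝ (act (permeability M h Γ) v) v = 0) : v = 0 := by
  rw [inner_act_eq hM hh H, neg_eq_zero] at hv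
  have m : MemLp (fun z => ∑ i, v i • (e i + Γ i z)) 2 (volume.restrict Zp) :=
    memLp_finsetSum _ fun i _ => (H i).memLp_flux.const_smul (v i)
  have h0 := ae_eq_zero_of_integral_coeff hM hh m hv
  have hγ : ∀ i j, IntegrableOn (fun z => Γ i z j) Zp := fun i j =>
    (memLp_coord (H i).perH1.memLp_grad j).integrable one_le_two
  ext j
  have h1 : ∫ z in Zp, (v j + v 0 * Γ 0 z j + v 1 * Γ 1 z j) = 0 := by
    rw [integral_congr_ae (g := fun _ => (0 : ℝ)), integral_zero]
    filter_upwards [h0] with z hz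
    have h2 := congrArg (fun w : E2 => w j) hz
    have h3 := congrArg (fun w : E2 => w j) (sum_smul_e v)
    simp only [Fin.sum_univ_two, PiLp.add_apply, PiLp.smul_apply, smul_eq_mul, Pi.zero_apply,
      PiLp.zero_apply] at h2 h3
    linear_combination h2 - h3
  have J : IntegrableOn (fun z => v j + v 0 * Γ 0 z j) Zp :=
    (integrable_const _).add ((hγ 0 j).const_mul _)
  rw [integral_add J ((hγ 1 j).const_mul _),
    integral_add (integrable_const _) ((hγ 0 j).const_mul _), integral_const_mul,
    integral_const_mul, (H 0).perH1.trigGrad.integral_eq_zero, (H 1).perH1.trigGrad.integral_eq_zero]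
    at h1
  simpa using h1

end Uniqueness

/-! ### Identification of the flux -/

section Flux

variable {ω : Set E2} {h : E2 → ℝ} {M : ℝ}

theorem ae_prod_of_ae_ae {α β F : Type*} [MeasurableSpace α] [MeasurableSpace β]
    [NormedAddCommGroup F] {μ : Measure α} {ν : Measure β} [SFinite ν] {D : α × β → F}
    (hD : AEStronglyMeasurable D (μ.prod ν)) (H : ∀ᵐ x ∂μ, ∀ᵐ y ∂ν, D (x, y) = 0) :
    ∀ᵐ p ∂μ.prod ν, D p = 0 := by
  have h1 : ∫⁻ p, ‖D p‖ₑ ∂μ.prod ν = 0 := by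
    rw [lintegral_prod _ hD.enorm, lintegral_congr_ae (g := fun _ => 0), lintegral_zero]
    filter_upwards [H] with x hx
    rw [lintegral_congr_ae (g := fun _ => 0), lintegral_zero]
    filter_upwards [hx] with y hy
    rw [hy, enorm_zero]
  filter_upwards [(lintegral_eq_zero_iff' hD.enorm).1 h1] with p hp
  simpa using hp

theorem isFiniteMeasure_restrict (hωb : Bornology.IsBounded ω) :
    IsFiniteMeasure (volume.restrict ω) :=
  ⟨by rw [Measure.restrict_apply_univ]; exact hωb.measure_lt_top⟩

theorem isFiniteMeasure_restrict_prod (hωb : Bornology.IsBounded ω) :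
    IsFiniteMeasure (volume.restrict (ω ×ˢ Zp)) :=
  ⟨by rw [Measure.restrict_apply_univ]; exact (hωb.prod isBounded_Zp).measure_lt_top⟩

theorem restrict_prod_Zp (ω : Set E2) : (volume.restrict (ω ×ˢ Zp) : Measure (E2 × E2)) =
    (volume.restrict ω).prod (volume.restrict Zp) :=
  (Measure.prod_restrict ω Zp).symm

theorem integrableOn_mul_snd {G : E2 × E2 → ℝ} (hω : IsOpen ω) (hG : IntegrableOn G (ω ×ˢ Zp))
    {τ : E2 → ℝ} (hτ : Continuous τ) : IntegrableOn (fun p => G p * τ p.2) (ω ×ˢ Zp) := by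
  obtain ⟨c, hc⟩ := (isCompact_closedBall (0 : E2) 1).exists_bound_of_continuousOn hτ.continuousOn
  refine Integrable.mul_bdd (c := c) hG (hτ.comp continuous_snd).aestronglyMeasurable
    (ae_restrict_of_forall_mem (hω.measurableSet.prod measurableSet_Zp) fun p hp => hc _ ?_)
  rw [mem_closedBall_zero_iff]
  exact norm_le_of_coord fun i => abs_le.2 ⟨(hp.2 i).1.le, (hp.2 i).2.le⟩

/-- The fundamental lemma of the calculus of variations in `x'`, applied to the cell integral.
Product test functions thereby localize the equations to individual `x'`. -/
theorem ae_integral_slice_eq_zero (hω : IsOpen ω) {F : E2 × E2 → ℝ} (hF : IntegrableOn F (ω ×ˢ Zp))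
    (H : ∀ a : E2 → ℝ, ContDiff ℝ ((⊤ : ℕ∞) : WithTop ℕ∞) a → HasCompactSupport a → tsupport a ⊆ ω →
      ∫ p in ω ×ˢ Zp, a p.1 * F p = 0) :
    ∀ᵐ x ∂volume.restrict ω, ∫ z in Zp, F (x, z) = 0 := by
  rw [IntegrableOn, restrict_prod_Zp] at hF
  have h1 : IntegrableOn (fun x => ∫ z in Zp, F (x, z)) ω := hF.integral_prod_left
  rw [ae_restrict_iff' hω.measurableSet]
  refine hω.ae_eq_zero_of_integral_contDiff_smul_eq_zero h1.locallyIntegrableOn fun a ha hc hs => ?_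
  obtain ⟨c, hcb⟩ := hc.exists_bound_of_continuous ha.continuous
  have h2 : Integrable (fun p : E2 × E2 => a p.1 * F p)
      ((volume.restrict ω).prod (volume.restrict Zp)) :=
    Integrable.bdd_mul (c := c) hF (ha.continuous.comp continuous_fst).aestronglyMeasurable
      (Eventually.of_forall fun p => hcb _)
  have h3 := H a ha hc hs
  rw [restrict_prod_Zp, integral_prod _ h2] at h3
  rw [← setIntegral_eq_integral_of_forall_compl_eq_zero (s := ω), ← h3]
  · simp only [integral_const_mul, smul_eq_mul]
  · intro x hx
    rw [image_eq_zero_of_notMem_tsupport fun hx' => hx (hs hx'), zero_smul]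

theorem ae_memLp_slice {g : E2 × E2 → ℝ} (hg : MemLp g 2 (volume.restrict (ω ×ˢ Zp))) :
    ∀ᵐ x ∂volume.restrict ω, MemLp (fun z => g (x, z)) 2 (volume.restrict Zp) := by
  rw [restrict_prod_Zp] at hg
  filter_upwards [hg.1.prodMk_left, hg.integrable_sq.prod_right_ae] with x h1 h2
  exact (memLp_two_iff_integrable_sq h1).2 h2

theorem dz_tensor (a τ : E2 → ℝ) (hτ : Differentiable ℝ τ) (j : Fin 2) (x z : E2) (t : ℝ) :
    dz j (fun y => a y.1 * τ y.2.1) (x, z, t) = a x * pd j τ z := by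
  simp only [dz, pd]
  rw [fderiv_const_mul (hτ z)]
  rfl

/-- The weak momentum balance over the base, localized in the macroscopic variable. -/
theorem ae_momentum_slice (hω : IsOpen ω) {j : Fin 2} {r : E2 → ℝ} {g ϖ : E2 × E2 → ℝ}
    (hg : IntegrableOn g (ω ×ˢ Zp)) (hϖ : IntegrableOn ϖ (ω ×ˢ Zp)) (hr : IntegrableOn r ω)
    (H : ∀ a, IsTest ω a → (∀ x z t, a (x, z, t) = a (x, z, 0)) →
      (∫ p in ω ×ˢ Zp, g p * a (p.1, p.2, 0)) - (∫ p in ω ×ˢ Zp, ϖ p * dz j a (p.1, p.2, 0)) =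
        ∫ p in ω ×ˢ Zp, r p.1 * a (p.1, p.2, 0))
    {τ : E2 → ℝ} (hτ : ContDiff ℝ ((⊤ : ℕ∞) : WithTop ℕ∞) τ) (hp : Periodic τ) :
    ∀ᵐ x ∂volume.restrict ω,
      ∫ z in Zp, ϖ (x, z) * pd j τ z = -∫ z in Zp, (r x - g (x, z)) * τ z := by
  have hτ' : Continuous (pd j τ) := (contDiff_fderiv_apply hτ (e j)).continuous
  have hr' : IntegrableOn (fun p : E2 × E2 => r p.1) (ω ×ˢ Zp) := by
    rw [IntegrableOn, restrict_prod_Zp]; exact Integrable.comp_fst hr _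
  have J1 := integrableOn_mul_snd hω hϖ hτ'
  have J2 : IntegrableOn (fun p : E2 × E2 => (r p.1 - g p) * τ p.2) (ω ×ˢ Zp) :=
    integrableOn_mul_snd hω (hr'.sub hg) hτ.continuous
  have J3 : IntegrableOn (fun p : E2 × E2 => ϖ p * pd j τ p.2 + (r p.1 - g p) * τ p.2) (ω ×ˢ Zp) :=
    J1.add J2
  have h1 := ae_integral_slice_eq_zero hω J3 fun a ha hc hs => by
    have h2 := H _ (isTest_tensor ha hc hs hτ hp) fun x z t => rfl
    simp only [dz_tensor a τ (hτ.differentiable (by simp))] at h2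
    obtain ⟨c, hcb⟩ := hc.exists_bound_of_continuous ha.continuous
    have hb : ∀ {F : E2 × E2 → ℝ}, IntegrableOn F (ω ×ˢ Zp) →
        IntegrableOn (fun p => a p.1 * F p) (ω ×ˢ Zp) := fun hF =>
      Integrable.bdd_mul (c := c) hF (ha.continuous.comp continuous_fst).aestronglyMeasurable
        (Eventually.of_forall fun p => hcb _)
    have K1 := hb J1
    have K2 := hb (integrableOn_mul_snd hω hr' hτ.continuous)
    have K3 := hb (integrableOn_mul_snd hω hg hτ.continuous)
    have e1 : ∫ p in ω ×ˢ Zp, a p.1 * (ϖ p * pd j τ p.2 + (r p.1 - g p) * τ p.2) =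
        (∫ p in ω ×ˢ Zp, a p.1 * (ϖ p * pd j τ p.2)) +
          ((∫ p in ω ×ˢ Zp, a p.1 * (r p.1 * τ p.2)) - ∫ p in ω ×ˢ Zp, a p.1 * (g p * τ p.2)) := by
      have K4 : IntegrableOn (fun p : E2 × E2 => a p.1 * (r p.1 * τ p.2) - a p.1 * (g p * τ p.2))
        (ω ×ˢ Zp) := K2.sub K3
      rw [← integral_sub K2 K3, ← integral_add K1 K4]
      congr 1; ext p; ring
    have c1 : ∀ p : E2 × E2, a p.1 * (ϖ p * pd j τ p.2) = ϖ p * (a p.1 * pd j τ p.2) :=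
      fun p => by ring
    have c2 : ∀ p : E2 × E2, a p.1 * (r p.1 * τ p.2) = r p.1 * (a p.1 * τ p.2) := fun p => by ring
    have c3 : ∀ p : E2 × E2, a p.1 * (g p * τ p.2) = g p * (a p.1 * τ p.2) := fun p => by ring
    rw [e1]
    simp only [c1, c2, c3]
    linarith
  rw [IntegrableOn, restrict_prod_Zp] at J1 J2
  filter_upwards [h1, J1.prod_right_ae, J2.prod_right_ae] with x hx i1 i2
  rw [integral_add i1 i2] at hx
  linarith

theorem ae_div_slice (hω : IsOpen ω) {Q : Fin 2 → E2 × E2 → ℝ}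
    (hQ : ∀ j, IntegrableOn (Q j) (ω ×ˢ Zp))
    (H : ∀ a, IsTest ω a → (∀ x z t, a (x, z, t) = a (x, z, 0)) →
      ∫ p in ω ×ˢ Zp, ∑ j, Q j p * dz j a (p.1, p.2, 0) = 0)
    {τ : E2 → ℝ} (hτ : ContDiff ℝ ((⊤ : ℕ∞) : WithTop ℕ∞) τ) (hp : Periodic τ) :
    ∀ᵐ x ∂volume.restrict ω, ∑ j, ∫ z in Zp, Q j (x, z) * pd j τ z = 0 := by
  have hτ' : ∀ j, Continuous (pd j τ) := fun j => (contDiff_fderiv_apply hτ (e j)).continuous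
  have J1 : ∀ j, IntegrableOn (fun p : E2 × E2 => Q j p * pd j τ p.2) (ω ×ˢ Zp) := fun j =>
    integrableOn_mul_snd hω (hQ j) (hτ' j)
  have J3 : IntegrableOn (fun p : E2 × E2 => ∑ j, Q j p * pd j τ p.2) (ω ×ˢ Zp) :=
    integrable_finsetSum _ fun j _ => J1 j
  have h1 := ae_integral_slice_eq_zero hω J3 fun a ha hc hs => by
    have h2 := H _ (isTest_tensor ha hc hs hτ hp) fun x z t => rfl
    simp only [dz_tensor a τ (hτ.differentiable (by simp))] at h2
    rw [← h2]
    congr 1; ext p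
    rw [Finset.mul_sum]
    exact Finset.sum_congr rfl fun j _ => by ring
  have J4 : ∀ᵐ x ∂volume.restrict ω, ∀ j, IntegrableOn (fun z => Q j (x, z) * pd j τ z) Zp := by
    refine ae_all_iff.2 fun j => ?_
    have := J1 j
    rw [IntegrableOn, restrict_prod_Zp] at this
    exact this.prod_right_ae
  filter_upwards [h1, J4] with x hx i1
  rwa [integral_finsetSum _ fun j _ => i1 j] at hx

/-- The horizontal flux in terms of the macroscopic forcing and of the cell solutions. -/
theorem ae_flux_eq_sum (hω : IsOpen ω) (hωb : Bornology.IsBounded ω) (hM : 0 < M) (hh : IsProfile h)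
    {P : Fin 2 → E2 → ℝ} {Γ : Fin 2 → E2 → E2} (HC : ∀ i, IsCellSolution M h i (P i) (Γ i))
    {r : E2 → E2} {g : Fin 2 → E2 × E2 → ℝ} {ϖ : E2 × E2 → ℝ}
    (hg : ∀ j, MemLp (g j) 2 (volume.restrict (ω ×ˢ Zp)))
    (hϖ : MemLp ϖ 2 (volume.restrict (ω ×ˢ Zp))) (hr : MemLp r 2 (volume.restrict ω))
    (H1 : ∀ j a, IsTest ω a → (∀ x z t, a (x, z, t) = a (x, z, 0)) →
      (∫ p in ω ×ˢ Zp, g j p * a (p.1, p.2, 0)) - (∫ p in ω ×ˢ Zp, ϖ p * dz j a (p.1, p.2, 0)) =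
        ∫ p in ω ×ˢ Zp, r p.1 j * a (p.1, p.2, 0))
    (H2 : ∀ a, IsTest ω a → (∀ x z t, a (x, z, t) = a (x, z, 0)) →
      ∫ p in ω ×ˢ Zp, ∑ j, cellCoeff M h p.2 * g j p * dz j a (p.1, p.2, 0) = 0) :
    ∀ᵐ p ∂volume.restrict (ω ×ˢ Zp), ∀ j, g j p = (∑ i, r p.1 i • (e i + Γ i p.2)) j := by
  have hfin := isFiniteMeasure_restrict_prod hωb
  have hfin' := isFiniteMeasure_restrict hωb
  have hg1 : ∀ j, IntegrableOn (g j) (ω ×ˢ Zp) := fun j => (hg j).integrable one_le_two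
  have hϖ1 : IntegrableOn ϖ (ω ×ˢ Zp) := hϖ.integrable one_le_two
  have hr1 : ∀ j, IntegrableOn (fun x => r x j) ω := fun j =>
    (memLp_coord hr j).integrable one_le_two
  have hQ : ∀ j, IntegrableOn (fun p : E2 × E2 => cellCoeff M h p.2 * g j p) (ω ×ˢ Zp) := fun j => by
    simpa only [mul_comm] using integrableOn_mul_snd hω (hg1 j) (continuous_cellCoeff hM hh)
  -- The exceptional set of `x'` depends on the test function. Trigonometric test functions are
  -- countable, so one null set serves them all.
  have A1 : ∀ᵐ x ∂volume.restrict ω, ∀ (k : Fin 2 → ℤ) (j : Fin 2), _ := ae_all_iff.2 fun k =>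
    ae_all_iff.2 fun j => ae_momentum_slice hω (hg1 j) hϖ1 (hr1 j) (H1 j) (contDiff_cos_phase k)
      (periodic_cos_phase k)
  have A2 : ∀ᵐ x ∂volume.restrict ω, ∀ (k : Fin 2 → ℤ) (j : Fin 2), _ := ae_all_iff.2 fun k =>
    ae_all_iff.2 fun j => ae_momentum_slice hω (hg1 j) hϖ1 (hr1 j) (H1 j) (contDiff_sin_phase k)
      (periodic_sin_phase k)
  have B1 : ∀ᵐ x ∂volume.restrict ω, ∀ (k : Fin 2 → ℤ), _ := ae_all_iff.2 fun k =>
    ae_div_slice hω hQ H2 (contDiff_cos_phase k) (periodic_cos_phase k)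
  have B2 : ∀ᵐ x ∂volume.restrict ω, ∀ (k : Fin 2 → ℤ), _ := ae_all_iff.2 fun k =>
    ae_div_slice hω hQ H2 (contDiff_sin_phase k) (periodic_sin_phase k)
  have C1 : ∀ᵐ x ∂volume.restrict ω, ∀ j, MemLp (fun z => g j (x, z)) 2 (volume.restrict Zp) :=
    ae_all_iff.2 fun j => ae_memLp_slice (hg j)
  have key : ∀ᵐ x ∂volume.restrict ω, ∀ᵐ z ∂volume.restrict Zp,
      (WithLp.toLp 2 fun j => g j (x, z) : E2) = ∑ i, r x i • (e i + Γ i z) := by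
    filter_upwards [A1, A2, B1, B2, C1, ae_memLp_slice hϖ] with x a1 a2 b1 b2 c1 c2
    refine flux_eq_sum hM hh HC (memLp_of_coord c1) c2
      (trigGrad_of_forall fun k j => ⟨a1 k j, a2 k j⟩) (fun k => ?_) fun k => ?_
    -- Differentiation exchanges sine and cosine: testing the divergence with the sine gives the
    -- condition on the cosine coefficients, and conversely.
    · have := b2 k
      simp only [pd_sin_phase] at this
      have h2 : ∀ j : Fin 2, ∫ z in Zp, cellCoeff M h z * g j (x, z) *
          (2 * Real.pi * k j * Real.cos (phase k z)) = 2 * Real.pi * (k j * cosCoeff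
            (fun z => cellCoeff M h z * g j (x, z)) k) := fun j => by
        rw [cosCoeff, ← mul_assoc, ← integral_const_mul]
        congr 1; ext z; ring
      simp only [h2, ← Finset.mul_sum] at this
      exact (mul_eq_zero.1 this).resolve_left (by positivity)
    · have := b1 k
      simp only [pd_cos_phase] at this
      have h2 : ∀ j : Fin 2, ∫ z in Zp, cellCoeff M h z * g j (x, z) *
          -(2 * Real.pi * k j * Real.sin (phase k z)) = -(2 * Real.pi) * (k j * sinCoeff
            (fun z => cellCoeff M h z * g j (x, z)) k) := fun j => by
        rw [sinCoeff, ← mul_assoc, ← integral_const_mul]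
        congr 1; ext z; ring
      simp only [h2, ← Finset.mul_sum] at this
      exact (mul_eq_zero.1 this).resolve_left (by have := Real.pi_pos; linarith)
  -- An identity on almost every slice passes to the product measure only with joint measurability
  -- of the difference.
  have hD : ∀ j, AEStronglyMeasurable
      (fun p : E2 × E2 => g j p - (∑ i, r p.1 i • (e i + Γ i p.2)) j)
      ((volume.restrict ω).prod (volume.restrict Zp)) := fun j => by
    have m0 := (hg j).1
    rw [restrict_prod_Zp] at m0
    have m1 : ∀ i, AEStronglyMeasurable (fun p : E2 × E2 => r p.1 i * (e i + Γ i p.2) j)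
        ((volume.restrict ω).prod (volume.restrict Zp)) := fun i =>
      (hr1 i).1.comp_fst.mul (memLp_coord (HC i).memLp_flux j).1.comp_snd
    have m2 := m0.sub ((m1 0).add (m1 1))
    refine m2.congr (Eventually.of_forall fun p => ?_)
    simp only [Fin.sum_univ_two, Pi.sub_apply, Pi.add_apply, PiLp.add_apply, PiLp.smul_apply,
      smul_eq_mul]
  rw [restrict_prod_Zp]
  refine ae_all_iff.2 fun j => ?_
  have h3 := ae_prod_of_ae_ae (hD j) (by
    filter_upwards [key] with x hx
    filter_upwards [hx] with z hz
    rw [← hz]; simp)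
  filter_upwards [h3] with p hp
  exact sub_eq_zero.1 hp

end Flux

/-! ### Functions with vanishing weak gradient -/

section Constancy

variable {ω : Set E2} {p : E2 → ℝ}

/-- The derivative of the mollification at `x` is, up to sign, `p` tested with the derivative of `y
↦ ρ(x - y)`. This function is an admissible test function because its support lies in the ball
assumed to be contained in `ω`. -/
theorem fderiv_mollify_eq_zero (hω : IsOpen ω) (hp : IntegrableOn p ω)
    (H : IsWeakGrad ω p 0) (ρ : ContDiffBump (0 : E2)) {x : E2}
    (hx : Metric.closedBall x ρ.rOut ⊆ ω) :
    HasFDerivAt (convolution (ρ.normed volume) (ω.indicator p) (ContinuousLinearMap.lsmul ℝ ℝ) volume)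
      (0 : E2 →L[ℝ] ℝ) x := by
  have hρ : ContDiff ℝ ((⊤ : ℕ∞) : WithTop ℕ∞) (ρ.normed (volume : Measure E2)) := ρ.contDiff_normed
  have hρc : HasCompactSupport (ρ.normed (volume : Measure E2)) := ρ.hasCompactSupport_normed
  have hP : Integrable (ω.indicator p) := (integrable_indicator_iff hω.measurableSet).2 hp
  have hd := hρc.hasFDerivAt_convolution_left (ContinuousLinearMap.lsmul ℝ ℝ)
    (hρ.of_le (by exact_mod_cast le_top)) hP.locallyIntegrable x
  have hce := (hρc.fderiv (𝕜 := ℝ)).convolutionExists_left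
    (ContinuousLinearMap.precompL E2 (ContinuousLinearMap.lsmul ℝ ℝ))
    (hρ.continuous_fderiv (by simp)) hP.locallyIntegrable x
  have key : ∀ j, convolution (fderiv ℝ (ρ.normed (volume : Measure E2))) (ω.indicator p)
      (ContinuousLinearMap.precompL E2 (ContinuousLinearMap.lsmul ℝ ℝ)) volume x (e j) = 0 := by
    intro j
    set φ : E2 → ℝ := fun y => ρ.normed volume (x - y) with hφ
    have hφs : ContDiff ℝ ((⊤ : ℕ∞) : WithTop ℕ∞) φ := hρ.comp (contDiff_const.sub contDiff_id)
    have hts : tsupport φ ⊆ Metric.closedBall x ρ.rOut := by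
      refine closure_minimal (fun y hy => ?_) Metric.isClosed_closedBall
      have h1 : x - y ∈ Function.support (ρ.normed (volume : Measure E2)) := hy
      rw [ρ.support_normed_eq, Metric.mem_ball, dist_zero_right] at h1
      rw [Metric.mem_closedBall, dist_comm, dist_eq_norm]
      exact h1.le
    have hφc : HasCompactSupport φ :=
      HasCompactSupport.of_support_subset_isCompact (isCompact_closedBall x ρ.rOut)
        (subset_closure.trans hts)
    have h2 := H φ hφs hφc (hts.trans hx) j
    have h3 : ∀ y, pd j φ y = -fderiv ℝ (ρ.normed (volume : Measure E2)) (x - y) (e j) := by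
      intro y
      have h4 : HasFDerivAt φ ((fderiv ℝ (ρ.normed (volume : Measure E2)) (x - y)).comp
          (-ContinuousLinearMap.id ℝ E2)) y :=
        ((hρ.differentiable (by simp)) (x - y)).hasFDerivAt.comp y ((hasFDerivAt_id y).const_sub x)
      rw [pd, h4.fderiv]; simp
    rw [convolution_def, ContinuousLinearMap.integral_apply hce]
    simp only [ContinuousLinearMap.precompL_apply, ContinuousLinearMap.lsmul_apply, smul_eq_mul]
    rw [← integral_sub_left_eq_self _ volume x]
    simp only [sub_sub_cancel]
    simp only [h3, Pi.zero_apply, PiLp.zero_apply, zero_mul, integral_zero, neg_zero] at h2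
    rw [← neg_eq_zero, ← integral_neg, ← h2, ← integral_indicator hω.measurableSet]
    congr 1; ext y
    by_cases hy : y ∈ ω
    · simp only [indicator_of_mem hy]; ring
    · simp only [indicator_of_notMem hy]; simp
  refine hd.congr_fderiv (ContinuousLinearMap.ext fun v => ?_)
  rw [← sum_smul_e v, map_sum]
  simp [key]

theorem exists_ae_const_ball (hω : IsOpen ω) (hp : IntegrableOn p ω) (H : IsWeakGrad ω p 0) {x : E2}
    (hx : x ∈ ω) : ∃ r > 0, Metric.ball x r ⊆ ω ∧
      ∃ c, ∀ᵐ y ∂volume.restrict (Metric.ball x r), p y = c := by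
  obtain ⟨R, hR, hRω⟩ := Metric.isOpen_iff.1 hω x hx
  set r := R / 2 with hr
  have hr0 : 0 < r := by positivity
  have hsub : Metric.ball x r ⊆ ω := (Metric.ball_subset_ball (by linarith)).trans hRω
  refine ⟨r, hr0, hsub, ?_⟩
  -- The outer radii tend to zero and are twice the inner ones, the bounded ratio required for
  -- almost everywhere convergence. They are smaller than `r`, so the mollifier balls around points
  -- of `ball x r` stay in `ball x R`.
  let ρ : ℕ → ContDiffBump (0 : E2) := fun n =>
    ⟨r / 2 / ((n : ℝ) + 2), r / ((n : ℝ) + 2), by positivity, by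
      rw [div_div, mul_comm, ← div_div]
      exact half_lt_self (by positivity)⟩
  have hlim : Tendsto (fun n => (ρ n).rOut) atTop (nhds 0) :=
    tendsto_const_nhds.div_atTop (tendsto_atTop_add_const_right _ _ tendsto_natCast_atTop_atTop)
  have hP : Integrable (ω.indicator p) := (integrable_indicator_iff hω.measurableSet).2 hp
  have hae := ContDiffBump.ae_convolution_tendsto_right_of_locallyIntegrable (μ := volume) (φ := ρ)
    (K := 2) hlim (Eventually.of_forall fun n => by
      change r / ((n : ℝ) + 2) ≤ 2 * (r / 2 / ((n : ℝ) + 2))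
      apply le_of_eq; field_simp) hP.locallyIntegrable
  have hconst : ∀ n, ∀ y ∈ Metric.ball x r, ∀ z ∈ Metric.ball x r,
      convolution ((ρ n).normed volume) (ω.indicator p) (ContinuousLinearMap.lsmul ℝ ℝ) volume y =
      convolution ((ρ n).normed volume) (ω.indicator p) (ContinuousLinearMap.lsmul ℝ ℝ) volume z := by
    intro n y hy z hz
    have hd : ∀ w ∈ Metric.ball x r, _ := fun w hw =>
      fderiv_mollify_eq_zero hω hp H (ρ n) (x := w) (by
        intro v hv
        apply hRω
        have h1 : (ρ n).rOut < r := by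
          change r / ((n : ℝ) + 2) < r
          have : (0 : ℝ) ≤ n := n.cast_nonneg
          exact div_lt_self hr0 (by linarith)
        rw [Metric.mem_ball] at hw ⊢
        rw [Metric.mem_closedBall] at hv
        linarith [dist_triangle v w x])
    exact Metric.isOpen_ball.is_const_of_fderiv_eq_zero (𝕜 := ℝ) (convex_ball x r).isPreconnected
      (fun w hw => (hd w hw).differentiableAt.differentiableWithinAt) (fun w hw => (hd w hw).fderiv) hy hz
  have hae' : ∀ᵐ y ∂volume.restrict (Metric.ball x r), y ∈ Metric.ball x r ∧ Tendsto (fun n =>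
      convolution ((ρ n).normed volume) (ω.indicator p) (ContinuousLinearMap.lsmul ℝ ℝ) volume y)
      atTop (nhds (p y)) := by
    filter_upwards [ae_restrict_of_ae hae, ae_restrict_mem measurableSet_ball] with y hy hyB
    rw [indicator_of_mem (hsub hyB)] at hy
    exact ⟨hyB, hy⟩
  have hne : (ae (volume.restrict (Metric.ball x r))).NeBot := by
    rw [ae_neBot, Ne, Measure.restrict_eq_zero]
    exact (Metric.measure_ball_pos volume x hr0).ne'
  -- Each mollification is constant on the ball, so its limit at any convergence point equals the
  -- limit at one fixed such point.
  obtain ⟨y₀, hy₀, hl₀⟩ := hae'.exists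
  refine ⟨p y₀, ?_⟩
  filter_upwards [hae'] with y hy
  refine tendsto_nhds_unique hy.2 (hl₀.congr fun n => ?_)
  exact hconst n _ hy₀ _ hy.1

/-- A function with zero weak gradient on a connected open set is constant. -/
theorem exists_ae_const (hω : IsOpen ω) (hc : IsConnected ω) (hp : IntegrableOn p ω)
    (H : IsWeakGrad ω p 0) : ∃ c, ∀ᵐ x ∂volume.restrict ω, p x = c := by
  obtain ⟨x₀, hx₀⟩ := hc.nonempty
  obtain ⟨r₀, hr₀, hB₀, c₀, hc₀⟩ := exists_ae_const_ball hω hp H hx₀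
  refine ⟨c₀, ?_⟩
  -- Points near which `p` equals `c₀`, against points near which it equals another constant: two
  -- disjoint open sets covering `ω`, and connectedness leaves only the first.
  set U : Set E2 := {x | ∃ O, IsOpen O ∧ x ∈ O ∧ ∀ᵐ y ∂volume.restrict O, p y = c₀} with hU
  set V : Set E2 := {x | ∃ O, IsOpen O ∧ x ∈ O ∧ ∃ c, c ≠ c₀ ∧ ∀ᵐ y ∂volume.restrict O, p y = c}
    with hV
  have hUo : IsOpen U := isOpen_iff_forall_mem_open.2 fun x ⟨O, hO, hxO, h⟩ =>
    ⟨O, fun y hy => ⟨O, hO, hy, h⟩, hO, hxO⟩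
  have hVo : IsOpen V := isOpen_iff_forall_mem_open.2 fun x ⟨O, hO, hxO, h⟩ =>
    ⟨O, fun y hy => ⟨O, hO, hy, h⟩, hO, hxO⟩
  have hdisj : Disjoint U V := by
    rw [Set.disjoint_left]
    rintro x ⟨O, hO, hxO, h1⟩ ⟨O', hO', hxO', c, hcc, h2⟩
    have hne : (ae (volume.restrict (O ∩ O'))).NeBot := by
      rw [ae_neBot, Ne, Measure.restrict_eq_zero]
      exact ((hO.inter hO').measure_pos volume ⟨x, hxO, hxO'⟩).ne'
    obtain ⟨y, hy1, hy2⟩ := ((ae_restrict_of_ae_restrict_of_subset inter_subset_left h1).and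
      (ae_restrict_of_ae_restrict_of_subset inter_subset_right h2)).exists
    exact hcc (hy2.symm.trans hy1)
  have hcov : ω ⊆ U ∪ V := fun x hx => by
    obtain ⟨r, hr, hB, c, hcr⟩ := exists_ae_const_ball hω hp H hx
    by_cases h : c = c₀
    · exact Or.inl ⟨_, Metric.isOpen_ball, Metric.mem_ball_self hr, h ▸ hcr⟩
    · exact Or.inr ⟨_, Metric.isOpen_ball, Metric.mem_ball_self hr, c, h, hcr⟩
  have hsub : ω ⊆ U := hc.isPreconnected.subset_left_of_subset_union hUo hVo hdisj hcov
    ⟨x₀, hx₀, _, Metric.isOpen_ball, Metric.mem_ball_self hr₀, hc₀⟩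
  have hnull : volume ({x | ¬p x = c₀} ∩ ω) = 0 := by
    refine measure_null_of_locally_null _ fun x hx => ?_
    obtain ⟨O, hO, hxO, h⟩ := hsub hx.2
    refine ⟨{x | ¬p x = c₀} ∩ O, ?_, ?_⟩
    · filter_upwards [inter_mem_nhdsWithin _ (hO.mem_nhds hxO)] with y hy
      exact ⟨hy.1.1, hy.2⟩
    · rw [ae_restrict_iff' hO.measurableSet] at h
      refine measure_mono_null (fun y hy => ?_) (ae_iff.1 h)
      simp only [mem_ofPred_eq, Classical.not_imp]
      exact ⟨hy.2, hy.1⟩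
  rw [ae_restrict_iff' hω.measurableSet, ae_iff]
  refine measure_mono_null (fun y hy => ?_) hnull
  simp only [mem_ofPred_eq, Classical.not_imp] at hy
  exact ⟨hy.2, hy.1⟩

end Constancy

/-! ### Averages over the cell -/

section Average

variable {ω : Set E2} {h : E2 → ℝ} {M : ℝ}

theorem measurableSet_Zcell (hh : IsProfile h) : MeasurableSet (Zcell h) :=
  (isOpen_Zcell hh.continuous).measurableSet

/-- Fubini with the vertical variable outermost. Boundedness of `h` makes `hMax h` a true upper
bound, so the interval contains every height occurring in the cell. -/
theorem average_eq_integral {F : Type*} [NormedAddCommGroup F] [NormedSpace ℝ F]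
    (hh : IsProfile h) {v : X → F} {x : E2} (hv : IntegrableOn (fun z => v (x, z)) (Zcell h)) :
    average h v x = ∫ z in Zcell h, v (x, z) := by
  obtain ⟨H, B, hH, hB⟩ := hh.exists_bounds
  have hbdd : BddAbove (range h) := ⟨B, by rintro _ ⟨z, rfl⟩; exact (hB z).2⟩
  have hle : ∀ z, h z ≤ hMax h := fun z => le_ciSup hbdd z
  have hi := (integrable_indicator_iff (measurableSet_Zcell hh)).2 hv
  have h1 : ∀ t, tilde h v x t = ∫ z', (Zcell h).indicator (fun z => v (x, z)) (z', t) := fun t => by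
    rw [tilde, setIntegral_eq_integral_of_forall_compl_eq_zero]
    intro z' hz'
    exact indicator_of_notMem (fun hz => hz' hz.1) _
  rw [average, intervalIntegral.integral_of_le ((hh.pos 0).le.trans (hle 0)),
    setIntegral_eq_integral_of_forall_compl_eq_zero, ← integral_indicator (measurableSet_Zcell hh),
    Measure.volume_eq_prod, integral_prod_symm _ hi]
  · simp only [h1]
  · intro t ht
    rw [h1, integral_eq_zero_of_ae]
    refine Eventually.of_forall fun z' => indicator_of_notMem (fun hz => ht ?_) _
    exact ⟨hz.2.1, hz.2.2.le.trans (hle z')⟩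

theorem ae_average_eq {F : Type*} [NormedAddCommGroup F] [NormedSpace ℝ F]
    (hh : IsProfile h) {v : X → F} (hv : IntegrableOn v (bulk ω h)) :
    ∀ᵐ x ∂volume.restrict ω, IntegrableOn (fun z => v (x, z)) (Zcell h) ∧
      average h v x = ∫ z in Zcell h, v (x, z) := by
  rw [IntegrableOn, restrict_bulk_prod] at hv
  filter_upwards [hv.prod_right_ae] with x hx
  exact ⟨hx, average_eq_integral hh hx⟩

theorem integral_profile (hM : 0 < M) (hh : IsProfile h) {z : E2} {w : ℝ → ℝ} {κ : ℝ}
    (H : ∀ᵐ t ∂volume.restrict (Ioo 0 (h z)), w t = κ * shape M h z t) :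
    ∫ t in (0 : ℝ)..h z, w t = -(κ * cellCoeff M h z) := by
  have h1 := integral_shape hM z (hh.pos z)
  rw [intervalIntegral.integral_of_le (hh.pos z).le, integral_Ioc_eq_integral_Ioo] at h1 ⊢
  rw [integral_congr_ae H, integral_const_mul, h1]
  ring

theorem integral_Zcell_profile (hM : 0 < M) (hh : IsProfile h) {w : E2 × ℝ → ℝ} {G : E2 → ℝ}
    {κ : ℝ} (hw : IntegrableOn w (Zcell h))
    (H : ∀ᵐ z ∂volume.restrict (Zcell h), w z = κ * G z.1 * shape M h z.1 z.2) :
    ∫ z in Zcell h, w z = -(κ * ∫ z in Zp, cellCoeff M h z * G z) := by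
  have hmeas := hh.continuous.measurable
  rw [IntegrableOn, restrict_Zcell hmeas] at hw
  rw [restrict_Zcell hmeas] at H
  rw [restrict_Zcell hmeas, integral_subgraph hmeas hh.pos hw, ← integral_const_mul, ← integral_neg]
  refine integral_congr_ae ?_
  filter_upwards [ae_slice_subgraph hmeas H] with z hz
  rw [integral_profile hM hh hz]
  ring

theorem horiz_apply (v : E3) (j : Fin 2) : horiz v j = v j.castSucc := by
  fin_cases j <;> rfl

theorem integral_apply_E3 {α : Type*} [MeasurableSpace α] {μ : Measure α} {v : α → E3}
    (hv : Integrable v μ) (i : Fin 3) : (∫ a, v a ∂μ) i = ∫ a, v a i ∂μ :=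
  ((EuclideanSpace.proj i : E3 →L[ℝ] ℝ).integral_comp_comm hv).symm

theorem permeability_apply (γ : Fin 2 → E2 → E2) (i j : Fin 2) :
    permeability M h γ i j = -∫ z in Zp, cellCoeff M h z * (e i + γ i z) j := by
  simp only [permeability, Matrix.of_apply, e, EuclideanSpace.inner_single_right]
  simp

end Average

/-! ### The Reynolds equation -/

section Reynolds

variable {ω : Set E2} {h : E2 → ℝ} {M : ℝ}

theorem act_sub (A : Matrix (Fin 2) (Fin 2) ℝ) (v w : E2) : act A (v - w) = act A v - act A w := by
  simp only [act, WithLp.ofLp_sub, Matrix.mulVec_sub, WithLp.toLp_sub]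

theorem act_neg (A : Matrix (Fin 2) (Fin 2) ℝ) (v : E2) : act A (-v) = -act A v := by
  simp only [act, WithLp.ofLp_neg, Matrix.mulVec_neg, WithLp.toLp_neg]

theorem inner_act (A : Matrix (Fin 2) (Fin 2) ℝ) (v w : E2) :
    inner ℝ (act A v) w = ∑ i, ∑ j, A i j * (v j * w i) := by
  rw [PiLp.inner_apply]
  refine Finset.sum_congr rfl fun i _ => ?_
  simp only [act, Matrix.mulVec, dotProduct, RCLike.inner_apply, conj_trivial, Finset.mul_sum]
  exact Finset.sum_congr rfl fun j _ => by ring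

theorem integrable_inner_act (A : Matrix (Fin 2) (Fin 2) ℝ) {v w : E2 → E2} {μ : Measure E2}
    (hv : MemLp v 2 μ) (hw : MemLp w 2 μ) : Integrable (fun x => inner ℝ (act A (v x)) (w x)) μ := by
  simp only [inner_act]
  exact integrable_finsetSum _ fun i _ => integrable_finsetSum _ fun j _ =>
    ((memLp_coord hv j).integrable_mul (memLp_coord hw i)).const_mul _

theorem IsH1.sub (hωb : Bornology.IsBounded ω) {p q : E2 → ℝ} {dp dq : E2 → E2}
    (hp : IsH1 ω p dp) (hq : IsH1 ω q dq) :
    IsH1 ω (fun x => p x - q x) fun x => dp x - dq x := by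
  have hfin := isFiniteMeasure_restrict hωb
  refine ⟨hp.memLp.sub hq.memLp, hp.memLp_grad.sub hq.memLp_grad, fun φ hφ hc hs j => ?_⟩
  have c1 : Continuous (pd j φ) := (contDiff_fderiv_apply hφ (e j)).continuous
  have hc' : HasCompactSupport (pd j φ) := hc.fderiv_apply (𝕜 := ℝ) (e j)
  obtain ⟨b, hb⟩ := hc.exists_bound_of_continuous hφ.continuous
  obtain ⟨b', hb'⟩ := hc'.exists_bound_of_continuous c1
  have J : ∀ {F : E2 → ℝ}, MemLp F 2 (volume.restrict ω) → IntegrableOn (fun x => F x * φ x) ω :=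
    fun hF => (hF.integrable one_le_two).mul_bdd (c := b) hφ.continuous.aestronglyMeasurable
      (Eventually.of_forall hb)
  have J' : ∀ {F : E2 → ℝ}, MemLp F 2 (volume.restrict ω) →
      IntegrableOn (fun x => F x * pd j φ x) ω :=
    fun hF => (hF.integrable one_le_two).mul_bdd (c := b') c1.aestronglyMeasurable
      (Eventually.of_forall hb')
  simp only [sub_mul, PiLp.sub_apply]
  rw [integral_sub (J' hp.memLp) (J' hq.memLp),
    integral_sub (J (memLp_coord hp.memLp_grad j)) (J (memLp_coord hq.memLp_grad j)),
    hp.weakGrad φ hφ hc hs j, hq.weakGrad φ hφ hc hs j]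
  ring

/-- Testing the difference of the equations with the difference of the solutions makes its gradient
vanish by definiteness of `A`. The difference is then constant on the connected set, and the zero
means over a set of positive measure make this constant zero. -/
theorem IsReynoldsSolution.unique (hω : IsOpen ω) (hc : IsConnected ω)
    (hωb : Bornology.IsBounded ω) {A : Matrix (Fin 2) (Fin 2) ℝ}
    (hA : ∀ v, 0 ≤ inner ℝ (act A v) v) (hA' : ∀ v, inner ℝ (act A v) v = 0 → v = 0)
    {κ : ℝ} (hκ : 0 < κ) {f : E2 → E2} (hf : MemLp f 2 (volume.restrict ω)) {p q : E2 → ℝ}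
    {dp dq : E2 → E2} (hp : IsReynoldsSolution ω κ A f p dp)
    (hq : IsReynoldsSolution ω κ A f q dq) : q =ᵐ[volume.restrict ω] p := by
  have hfin := isFiniteMeasure_restrict hωb
  have D := hq.h1.sub hωb hp.h1
  have w1 := hq.weak _ _ D
  have w2 := hp.weak _ _ D
  simp only [real_inner_smul_left, integral_const_mul] at w1 w2
  have w1' := (mul_eq_zero.1 w1).resolve_left hκ.ne'
  have w2' := (mul_eq_zero.1 w2).resolve_left hκ.ne'
  have hz : ∫ x in ω, inner ℝ (act A (dq x - dp x)) (dq x - dp x) = 0 := by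
    have hs := integral_sub (integrable_inner_act A (hq.h1.memLp_grad.sub hf) D.memLp_grad)
      (integrable_inner_act A (hp.h1.memLp_grad.sub hf) D.memLp_grad)
    simp only [Pi.sub_apply] at hs
    rw [w1', w2', sub_zero] at hs
    rw [← hs]
    congr 1; ext x
    rw [← inner_sub_left, ← act_sub, sub_sub_sub_cancel_right]
  rw [integral_eq_zero_iff_of_nonneg (fun x => hA _)
    (integrable_inner_act A D.memLp_grad D.memLp_grad)] at hz
  have hg : IsWeakGrad ω (fun x => q x - p x) 0 := fun φ hφ hφc hs j => by
    rw [D.weakGrad φ hφ hφc hs j]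
    congr 1
    refine integral_congr_ae ?_
    filter_upwards [hz] with x hx
    rw [hA' _ hx]
    rfl
  obtain ⟨c, hcc⟩ := exists_ae_const hω hc (D.memLp.integrable one_le_two) hg
  have hmean : ∫ x in ω, (q x - p x) = 0 := by
    rw [integral_sub (hq.h1.memLp.integrable one_le_two) (hp.h1.memLp.integrable one_le_two),
      hq.mean, hp.mean, sub_zero]
  rw [integral_congr_ae hcc, setIntegral_const, smul_eq_mul] at hmean
  have hvol : volume.real ω ≠ 0 :=
    (ENNReal.toReal_pos (hω.measure_pos volume hc.nonempty).ne' hωb.measure_lt_top.ne).ne'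
  have hc0 := (mul_eq_zero.1 hmean).resolve_left hvol
  filter_upwards [hcc] with x hx
  linarith

end Reynolds

/-! ### Consequences for solutions of the homogenized system -/

section LimitSolution

variable {ω : Set E2} {h : E2 → ℝ} {μ μeff K k q : ℝ} {f : E2 → E2} {b : E2 → ℝ} {u du : X → E3}
  {p : E2 → ℝ} {dp : E2 → E2} {T dT : X → ℝ} {ϖ : E2 × E2 → ℝ} {M : ℝ}

theorem memLp_coord_E3 {α : Type*} [MeasurableSpace α] {ν : Measure α} {v : α → E3}
    (hv : MemLp v 2 ν) (i : Fin 3) : MemLp (fun y => v y i) 2 ν :=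
  hv.of_le (by have := hv.1; fun_prop) (Eventually.of_forall fun z => PiLp.norm_apply_le _ _)

theorem IsLimitSolution.memLp_forcing
    (S : IsLimitSolution ω h μ μeff K k q f b u du p dp T dT ϖ)
    (hf : MemLp f 2 (volume.restrict ω)) : MemLp (fun x => f x - dp x) 2 (volume.restrict ω) :=
  hf.sub S.p_H1.memLp_grad

theorem IsLimitSolution.isMomentumComponent
    (S : IsLimitSolution ω h μ μeff K k q f b u du p dp T dT ϖ) (hωb : Bornology.IsBounded ω)
    (hf : MemLp f 2 (volume.restrict ω)) (j : Fin 2) :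
    IsMomentumComponent ω h μ μeff K j (fun y => horiz (u y) j) (fun y => horiz (du y) j)
      (fun x => f x j - dp x j) ϖ := by
  have := isFiniteMeasure_restrict hωb
  have := isFiniteMeasure_restrict_prod hωb
  simp only [horiz_apply]
  refine ⟨memLp_coord_E3 S.u_L2 _, memLp_coord_E3 S.du_L2 _, S.u_deriv _, S.u_top _, S.u_bottom _,
    (memLp_coord (S.memLp_forcing hf) j).integrable one_le_two, S.micro_L2.integrable one_le_two, ?_⟩
  simpa only [horiz_apply] using S.momentum j

/-- The velocity profile. -/
theorem IsLimitSolution.ae_velocity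
    (S : IsLimitSolution ω h μ μeff K k q f b u du p dp T dT ϖ) (hω : IsOpen ω)
    (hωb : Bornology.IsBounded ω) (hh : IsProfile h) (hμ : 0 < μ) (hμeff : 0 < μeff) (hK : 0 < K)
    (hM : M = Real.sqrt (μ / (K * μeff))) (hf : MemLp f 2 (volume.restrict ω))
    {P : Fin 2 → E2 → ℝ} {Γ : Fin 2 → E2 → E2} (HC : ∀ i, IsCellSolution M h i (P i) (Γ i)) :
    ∀ᵐ y ∂volume.restrict (bulk ω h), ∀ j, horiz (u y) j =
      K / μ * (∑ i, (f y.1 - dp y.1) i • (e i + Γ i y.2.1)) j * shape M h y.2.1 y.2.2 := by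
  have hMpos : 0 < M := by rw [hM]; positivity
  have hmeas := hh.continuous.measurable
  choose g hg hgu hga using fun j =>
    (S.isMomentumComponent hωb hf j).exists_velocity hω hωb hh hμ hμeff hK hM
  have hflux : ∀ᵐ p ∂volume.restrict (ω ×ˢ Zp), ∀ j,
      ∫ t in (0 : ℝ)..h p.2, horiz (u (p.1, p.2, t)) j = -(K / μ * g j p * cellCoeff M h p.2) := by
    refine ae_all_iff.2 fun j => ?_
    filter_upwards [ae_slice_bulk hmeas (hgu j)] with p hp
    exact integral_profile hMpos hh hp
  -- The vertical flux is `-(K/μ) c g`. The nonzero constant factor drops out of the divergence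
  -- condition.
  have hdiv : ∀ a, IsTest ω a → (∀ x z t, a (x, z, t) = a (x, z, 0)) →
      ∫ p in ω ×ˢ Zp, ∑ j, cellCoeff M h p.2 * g j p * dz j a (p.1, p.2, 0) = 0 := by
    intro a ha h0
    have h1 := S.micro_div a ha h0
    rw [integral_congr_ae (g := fun p : E2 × E2 => -(K / μ) *
      ∑ j, cellCoeff M h p.2 * g j p * dz j a (p.1, p.2, 0)), integral_const_mul] at h1
    · exact (mul_eq_zero.1 h1).resolve_left (neg_ne_zero.2 (by positivity))
    · filter_upwards [hflux] with p hp
      rw [Finset.mul_sum]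
      refine Finset.sum_congr rfl fun j _ => ?_
      rw [hp j]; ring
  have hsum := ae_flux_eq_sum hω hωb hMpos hh HC hg S.micro_L2 (S.memLp_forcing hf)
    (fun j => hga j) hdiv
  filter_upwards [ae_all_iff.2 hgu, ae_base_bulk hmeas hsum] with y h1 h2 j
  rw [h1 j, h2 j]

/-- The averaged velocity is given by Darcy's law. -/
theorem IsLimitSolution.ae_average_velocity
    (S : IsLimitSolution ω h μ μeff K k q f b u du p dp T dT ϖ) (hω : IsOpen ω)
    (hωb : Bornology.IsBounded ω) (hh : IsProfile h) (hμ : 0 < μ) (hμeff : 0 < μeff) (hK : 0 < K)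
    (hM : M = Real.sqrt (μ / (K * μeff))) (hf : MemLp f 2 (volume.restrict ω))
    {P : Fin 2 → E2 → ℝ} {Γ : Fin 2 → E2 → E2} (HC : ∀ i, IsCellSolution M h i (P i) (Γ i)) :
    ∀ᵐ x ∂volume.restrict ω,
      horiz (average h u x) = (K / μ) • act (permeability M h Γ) (f x - dp x) ∧
        average h u x 2 = 0 := by
  have hMpos : 0 < M := by rw [hM]; positivity
  have := isFiniteMeasure_bulk hωb hh
  have hv := S.ae_velocity hω hωb hh hμ hμeff hK hM hf HC
  have h3 := S.u_three
  rw [restrict_bulk_prod] at hv h3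
  filter_upwards [ae_average_eq hh (S.u_L2.integrable one_le_two), Measure.ae_ae_of_ae_prod hv,
    Measure.ae_ae_of_ae_prod h3] with x ⟨hi, hx⟩ hvx h3x
  rw [hx]
  constructor
  · ext j
    have hij : IntegrableOn (fun z => u (x, z) j.castSucc) (Zcell h) :=
      (EuclideanSpace.proj j.castSucc : E3 →L[ℝ] ℝ).integrable_comp hi
    rw [horiz_apply, integral_apply_E3 hi, integral_Zcell_profile hMpos hh (κ := K / μ)
      (G := fun z => (∑ i, (f x - dp x) i • (e i + Γ i z)) j) hij]
    · have J : ∀ i, IntegrableOn (fun z => (f x - dp x) i *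
          (cellCoeff M h z * (e i + Γ i z) j)) Zp := fun i => by
        have h1 := integrable_coeff_inner hMpos hh (HC i).memLp_flux
          (memLp_const (e j) : MemLp (fun _ : E2 => e j) 2 (volume.restrict Zp))
        refine Integrable.const_mul (h1.congr (Eventually.of_forall fun z => ?_)) _
        simp [e, EuclideanSpace.inner_single_right]
      have h2 : ∀ z, cellCoeff M h z * (∑ i, (f x - dp x) i • (e i + Γ i z)) j =
          ∑ i, (f x - dp x) i * (cellCoeff M h z * (e i + Γ i z) j) := fun z => by
        simp only [Fin.sum_univ_two, PiLp.add_apply, PiLp.smul_apply, smul_eq_mul]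
        ring
      simp only [h2]
      rw [integral_finsetSum _ fun i _ => J i]
      simp only [integral_const_mul, PiLp.smul_apply, smul_eq_mul, act, Matrix.mulVec, dotProduct]
      rw [← mul_neg, ← Finset.sum_neg_distrib]
      congr 1
      refine Finset.sum_congr rfl fun i _ => ?_
      -- Component `j` of the averaged flux sums `rᵢ` against the entries `(i, j)`, whereas the
      -- matrix action uses the entries `(j, i)`; symmetry of the tensor reconciles them.
      rw [permeability_symm hMpos hh HC, permeability_apply]
      ring
    · filter_upwards [hvx] with z hz
      rw [← horiz_apply, hz j]
  · rw [integral_apply_E3 hi]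
    exact integral_eq_zero_of_ae h3x

/-- By Darcy's law the Reynolds flux is minus the averaged velocity, so the weak equation is the
macroscopic divergence condition with its sign reversed. -/
theorem IsLimitSolution.isReynoldsSolution
    (S : IsLimitSolution ω h μ μeff K k q f b u du p dp T dT ϖ) {A : Matrix (Fin 2) (Fin 2) ℝ}
    {κ : ℝ} (H : ∀ᵐ x ∂volume.restrict ω, horiz (average h u x) = κ • act A (f x - dp x)) :
    IsReynoldsSolution ω κ A f p dp := by
  refine ⟨S.p_H1, S.p_mean, fun ψ η hψ => ?_⟩
  rw [← neg_eq_zero, ← integral_neg, ← S.macro_div ψ η hψ]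
  refine integral_congr_ae ?_
  filter_upwards [H] with x hx
  rw [hx, ← inner_neg_left, ← smul_neg, ← act_neg, neg_sub]

/-- The temperature profile. -/
theorem IsLimitSolution.ae_temperature
    (S : IsLimitSolution ω h μ μeff K k q f b u du p dp T dT ϖ) (hω : IsOpen ω)
    (hωb : Bornology.IsBounded ω) (hh : IsProfile h) (hk : 0 < k) (hq : 1 < q)
    (hb : IntegrableOn b ω) :
    (∀ᵐ x ∂volume.restrict ω, average h T x = ∫ z in Zcell h, T (x, z)) ∧
    ∀ᵐ y ∂volume.restrict (bulk ω h),
      T y = b y.1 / k * (h y.2.1 - y.2.2)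
        - μ / (k * K) * doubleInt (fun τ => ‖horiz (u (y.1, y.2.1, τ))‖ ^ 2) (h y.2.1) y.2.2
        - μeff / k * doubleInt (fun τ => ‖horiz (du (y.1, y.2.1, τ))‖ ^ 2) (h y.2.1) y.2.2 := by
  have := isFiniteMeasure_bulk hωb hh
  have hq' : 1 ≤ ENNReal.ofReal q := by
    rw [← ENNReal.ofReal_one]; exact ENNReal.ofReal_le_ofReal hq.le
  have hT := S.T_Lq.integrable hq'
  have hdT := S.dT_Lq.integrable hq'
  have hsq : ∀ {v : X → E3}, MemLp v 2 (volume.restrict (bulk ω h)) →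
      IntegrableOn (fun y => ‖horiz (v y)‖ ^ 2) (bulk ω h) := fun hv => by
    refine ((memLp_coord_E3 hv 0).integrable_sq.add (memLp_coord_E3 hv 1).integrable_sq).congr
      (Eventually.of_forall fun y => ?_)
    simp [EuclideanSpace.norm_sq_eq, Fin.sum_univ_two, horiz]
  refine ⟨(ae_average_eq hh hT).mono fun x hx => hx.2, ?_⟩
  filter_upwards [ThinFilm.ae_temperature hω hh hk hT hdT (hsq S.u_L2) (hsq S.du_L2) hb S.T_top
    S.heat] with y hy
  rw [hy, div_div, mul_comm K k]

end LimitSolution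

end ThinFilm

/-! ### The main theorem -/

theorem mainTheorem3
    (ω : Set ThinFilm.E2) (hω_open : IsOpen ω) (hω_conn : IsConnected ω)
    (hω_bdd : Bornology.IsBounded ω)
    (h : ThinFilm.E2 → ℝ) (hh : ThinFilm.IsProfile h)
    (μ μeff K k : ℝ) (hμ : 0 < μ) (hμeff : 0 < μeff) (hK : 0 < K) (hk : 0 < k)
    (q : ℝ) (hq1 : 1 < q) (hq2 : q < 3 / 2)
    (f : ThinFilm.E2 → ThinFilm.E2) (hf : MemLp f 2 (volume.restrict ω))
    (b : ThinFilm.E2 → ℝ) (hb : IntegrableOn b ω)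
    (M : ℝ) (hM : M = Real.sqrt (μ / (K * μeff)))
    (u du : ThinFilm.X → ThinFilm.E3) (p : ThinFilm.E2 → ℝ) (dp : ThinFilm.E2 → ThinFilm.E2)
    (T dT : ThinFilm.X → ℝ) (ϖ : ThinFilm.E2 × ThinFilm.E2 → ℝ)
    (hsol : ThinFilm.IsLimitSolution ω h μ μeff K k q f b u du p dp T dT ϖ) :
    -- the cell problems have solutions, which are unique
    ∃ (π : Fin 2 → ThinFilm.E2 → ℝ) (γ : Fin 2 → ThinFilm.E2 → ThinFilm.E2),
      (∀ i, ThinFilm.IsCellSolution M h i (π i) (γ i) ∧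
        ∀ π' γ', ThinFilm.IsCellSolution M h i π' γ' →
          π' =ᵐ[volume] π i ∧ γ' =ᵐ[volume] γ i) ∧
      -- average velocity
      (∀ᵐ x ∂volume.restrict ω,
        ThinFilm.horiz (ThinFilm.average h u x)
            = (K / μ) • ThinFilm.act (ThinFilm.permeability M h γ) (f x - dp x) ∧
          ThinFilm.average h u x 2 = 0) ∧
      -- the pressure is the unique solution of the Reynolds equation
      (ThinFilm.IsReynoldsSolution ω (K / μ) (ThinFilm.permeability M h γ) f p dp ∧
        ∀ p' dp', ThinFilm.IsReynoldsSolution ω (K / μ) (ThinFilm.permeability M h γ) f p' dp' →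
          p' =ᵐ[volume.restrict ω] p) ∧
      -- average temperature
      (∀ᵐ x ∂volume.restrict ω,
        ThinFilm.average h T x = ∫ z in ThinFilm.Zcell h, T (x, z)) ∧
      -- temperature
      (∀ᵐ y ∂volume.restrict (ThinFilm.bulk ω h),
        T y = b y.1 / k * (h y.2.1 - y.2.2)
          - μ / (k * K) * ThinFilm.doubleInt
              (fun τ => ‖ThinFilm.horiz (u (y.1, y.2.1, τ))‖ ^ 2) (h y.2.1) y.2.2
          - μeff / k * ThinFilm.doubleInt
              (fun τ => ‖ThinFilm.horiz (du (y.1, y.2.1, τ))‖ ^ 2) (h y.2.1) y.2.2) ∧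
      -- velocity
      (∀ᵐ y ∂volume.restrict (ThinFilm.bulk ω h),
        ThinFilm.horiz (u y) = (K / μ) • ∑ i : Fin 2,
          ((f y.1 i - dp y.1 i) *
            (ThinFilm.A1 M h y.2.1 * Real.exp (M * y.2.2)
              + ThinFilm.A2 M h y.2.1 * Real.exp (-(M * y.2.2)) + 1)) •
            (ThinFilm.e i + γ i y.2.1)) := by
  have hMpos : 0 < M := by rw [hM]; positivity
  choose π γ HC using fun i => ThinFilm.exists_isCellSolution hMpos hh i
  have hav := hsol.ae_average_velocity hω_open hω_bdd hh hμ hμeff hK hM hf HC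
  have hR := hsol.isReynoldsSolution (hav.mono fun x hx => hx.1)
  obtain ⟨hT, hT'⟩ := hsol.ae_temperature hω_open hω_bdd hh hk hq1 hb
  refine ⟨π, γ, fun i => ⟨HC i, fun π' γ' H => (HC i).unique hMpos hh H⟩, hav,
    ⟨hR, fun p' dp' H => hR.unique hω_open hω_conn hω_bdd (ThinFilm.inner_act_nonneg hMpos hh HC)
      (fun v => ThinFilm.eq_zero_of_inner_act hMpos hh HC) (by positivity) hf H⟩, hT, hT', ?_⟩
  filter_upwards [hsol.ae_velocity hω_open hω_bdd hh hμ hμeff hK hM hf HC] with y hy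
  ext j
  rw [hy j]
  simp only [Fin.sum_univ_two, PiLp.add_apply, PiLp.smul_apply, PiLp.sub_apply, smul_eq_mul,
    ThinFilm.shape]
  ring
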